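/- Let $\mu,\sigma,\delta>0$ and $0<p<1$, and put $q=\frac{p}{1-p}$, $\hat\delta=\delta(1+q)$, $$G_0=\sqrt{\tfrac{2\delta(1-p)\sigma^2}{p}},\qquad A=\tfrac{\delta}{p}+\tfrac{(1-p)\sigma^2}{2},\qquad \pi=\tfrac{\mu}{(1-p)\sigma^2}.$$ Assume $G_0\le\mu<A$. Define $$P(x,z)=-2q\delta z^2+2p(\mu x+1)z-(1-p)^2\sigma^2x^2,$$ $$Q(x,z)=-P(x,z)+(p\sigma^2-2\hat\delta)xz+2(\mu-(1-p)\sigma^2)x^2+2x,$$ $L=P/Q$, the curve $\mathbb T=\{(x,z): x>0,\ P(x,z)=0\}$ and, for $x>0$, let $T_u(x)$ and $T_d(x)$ be the largest and the smallest $z$ with $P(x,z)=0$. Let $x_P=\frac1{A-\mu}$, $z_P=\frac{x_P}{q}$; the point $P=(x_P,z_P)$ is the common zero of the polynomials $P$ and $Q$ with $x>0$. A continuous solution on an interval $\mathcal D\subseteq(0,\infty)$ is a continuous $g:\mathcal D\to\mathbb R$ such that, for every interior point $x\ne x_P$ of $\mathcal D$, $Q(x,g(x))\neq0$, $g$ is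 differentiable at $x$ and $g'(x)=L(x,g(x))$. It is a maximal inner solution if $T_d\le g\le T_u$ on $\mathcal D$ and $g$ cannot be extended to a strictly larger interval as a continuous solution with this property. For $\alpha>0$ with $(\alpha,T_u(\alpha))\ne P$ let $g_\alpha:\mathcal D_\alpha\to\mathbb R$ be any maximal inner solution with $\alpha\in\mathcal D_\alpha$ and $g_\alpha(\alpha)=T_u(\alpha)$, and put $\beta_\alpha=\sup\mathcal D_\alpha$. If $(x_P,T_u(x_P))=P$, then for $\alpha=x_P$ put $\beta_{x_P}=\lim_{\alpha\searrow x_P}\beta_\alpha$, $\mathcal D_{x_P}=\{x\in\mathbb R: x_P\le x\le\beta_{x_P}\}$, $g_{x_P}(x_P)=z_P$ and $g_{x_P}(x)=\lim_{\alpha\searrow x_P}g_\alpha(x)$ for $x\in\mathcal D_{x_P}$, $x>x_P$. Let $\Gamma_\alpha=\{(x,g_\alpha(x)):x\in\mathcal D_\alpha\}$. Then such solutions $g_\alpha$ (and the limits just used) exist, and for every choice of them the following hold. 1. For every $\alpha>0$, $\alpha<\beta_\alpha<\infty$, $\mathcal D_\alpha=[\alpha,\beta_\alpha]$ and $(\beta_\alpha,g_\alpha(\beta_\alpha))\in\mathbb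 T$. 2. If $\pi<1$, then $P\notin\Gamma_\alpha$ for every $\alpha>0$. 3. If $\pi>1$, then for every $\alpha>0$: $P\in\Gamma_\alpha$ if and only if $\alpha\le x_P$. 4. For every $\alpha>0$ the integral $G(\alpha)=\int_\alpha^{\beta_\alpha}\frac{g_\alpha'(x)}{x}\,dx$ converges absolutely, $G$ is continuous on $(0,\infty)$, $\lim_{\alpha\searrow0}G(\alpha)=+\infty$ and $\lim_{\alpha\to\infty}G(\alpha)=C$, where $$K=\frac{(1-p)(\mu-G_0)}{(A-\mu)+p(\mu-G_0)},\qquad C=\int_0^K k\Big(\frac{l_u'(k)}{k-l_u(k)}-\frac{l_d'(k)}{k-l_d(k)}\Big)dk,$$ the last integral converges absolutely, and $l_u(k)\ge l_d(k)$ are the two solutions $X$ of $a(k)X^2-b(k)X+c(k)=0$ with $a(k)=2p\delta(1+k)$, $b(k)=(2\delta+p(1-p)(2\mu-\sigma^2))k+2p(1-p)\mu$, $c(k)=(1-p)(2\mu+(p^2-1)\sigma^2)k+(1-p)^3\sigma^2$. -/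

import Mathlib

open Set Filter Topology MeasureTheory

noncomputable section

/-- The parameters of the model: drift `mu` and volatility `sigma` of the stock, exponent `p` of the
power utility, impatience rate `delta`.  Restrictions on them are hypotheses of the theorem. -/
structure Market where
  mu : ℝ
  sigma : ℝ
  p : ℝ
  delta : ℝ

namespace Market

variable (m : Market)

/-- `q = p / (1 - p)`. -/
def q : ℝ := m.p / (1 - m.p)

/-- `hat δ = δ (1 + q)`. -/
def deltaHat : ℝ := m.delta * (1 + m.q)

/-- Geometric mean of `2δ/p` and `(1-p)σ²`. -/
def gMean : ℝ := √(2 * m.delta * (1 - m.p) * m.sigma ^ 2 / m.p)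

/-- Arithmetic mean of `2δ/p` and `(1-p)σ²`. -/
def aMean : ℝ := m.delta / m.p + (1 - m.p) * m.sigma ^ 2 / 2

/-- The Merton proportion `π`. -/
def merton : ℝ := m.mu / ((1 - m.p) * m.sigma ^ 2)

/-- The polynomial `P(x,z)`, for `0 < p`. -/
def polyP (x z : ℝ) : ℝ :=
  -2 * m.q * m.delta * z ^ 2 + 2 * m.p * (m.mu * x + 1) * z - (1 - m.p) ^ 2 * m.sigma ^ 2 * x ^ 2

/-- The polynomial `Q(x,z)`, for `0 < p`. -/
def polyQ (x z : ℝ) : ℝ :=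
  -m.polyP x z + (m.p * m.sigma ^ 2 - 2 * m.deltaHat) * x * z
    + 2 * (m.mu - (1 - m.p) * m.sigma ^ 2) * x ^ 2 + 2 * x

/-- The right-hand side `L = P / Q` of the ODE (only used where `Q ≠ 0`). -/
def rhs (x z : ℝ) : ℝ := m.polyP x z / m.polyQ x z

/-- The curve `P = 0` in the right half-plane. -/
def curveT : Set (ℝ × ℝ) := {w | 0 < w.1 ∧ m.polyP w.1 w.2 = 0}

/-- The abscissa `x_P` of the singular point, for `0 < p` and `μ < A`. -/
def xP : ℝ := 1 / (m.aMean - m.mu)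

/-- The ordinate `z_P` of the singular point, for `0 < p` and `μ < A`. -/
def zP : ℝ := m.xP / m.q

/-- The singular point, i.e. the common zero of `P` and `Q` with `x > 0`. -/
def singularPoint : ℝ × ℝ := (m.xP, m.zP)

/-- The section at `x` of the level curve `L = k`. -/
def levelSection (x k : ℝ) : Set ℝ := {z | m.polyP x z = k * m.polyQ x z}

/-- The set of all `x > 0` over which the level curve `L = k` has a point. -/
def levelDomain (k : ℝ) : Set ℝ := {x | 0 < x ∧ (m.levelSection x k).Nonempty}

/-- The upper graph of the level curve `L = k`: the largest `z` with `P(x,z) = k Q(x,z)`. -/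
def Tu (x k : ℝ) : ℝ := sSup (m.levelSection x k)

/-- The lower graph of the level curve `L = k`: the smallest `z` with `P(x,z) = k Q(x,z)`. -/
def Td (x k : ℝ) : ℝ := sInf (m.levelSection x k)

/-- `g`, restricted to the interval `D ⊆ (0,∞)`, is a continuous solution of `g' = L(·,g)`: the
equation is required (and has to make sense) at the interior points of `D` other than `x_P`.
Values of `g` outside `D` are irrelevant. -/
structure IsContinuousSolution (D : Set ℝ) (g : ℝ → ℝ) : Prop where
  nonempty : D.Nonempty
  interval : D.OrdConnected
  pos : D ⊆ Ioi 0
  continuousOn : ContinuousOn g D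
  ode : ∀ x ∈ interior D, x ≠ m.xP →
    m.polyQ x (g x) ≠ 0 ∧ HasDerivAt g (m.rhs x (g x)) x

/-- A continuous solution which stays between the lower and the upper branch of `L = 0`. -/
structure IsInnerSolution (D : Set ℝ) (g : ℝ → ℝ) : Prop extends m.IsContinuousSolution D g where
  inner : ∀ x ∈ D, x ∈ m.levelDomain 0 ∧ m.Td x 0 ≤ g x ∧ g x ≤ m.Tu x 0

/-- An inner solution which cannot be extended to a strictly larger interval as an inner
solution. -/
structure IsMaximalInnerSolution (D : Set ℝ) (g : ℝ → ℝ) : Prop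
    extends m.IsInnerSolution D g where
  maximal : ∀ (D' : Set ℝ) (g' : ℝ → ℝ), m.IsInnerSolution D' g' → D ⊆ D' → EqOn g' g D → D' = D

/-- The right end-point `sup D`, as an extended real. -/
def rightEnd (D : Set ℝ) : EReal := sSup (Real.toEReal '' D)

/-- A choice, for every `α > 0`, of the solution `g α` with domain `D α` started at the point
`(α, T_u(α,0))` of the upper branch of the curve `L = 0`.

If the initial point is not the singular point, this is any maximal inner solution through it.
If the upper branch passes through the singular point, then for `α = x_P` it is the limit of the
solutions for `α ↘ x_P`: the right end-point is the limit `b` of the right end-points, the domain is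
the interval from `x_P` to `b`, and the function is the pointwise limit there. -/
structure IsSolutionFamily (D : ℝ → Set ℝ) (g : ℝ → ℝ → ℝ) : Prop where
  regular : ∀ α : ℝ, 0 < α → (α, m.Tu α 0) ≠ m.singularPoint →
    m.IsMaximalInnerSolution (D α) (g α) ∧ α ∈ D α ∧ g α α = m.Tu α 0
  singular : (m.xP, m.Tu m.xP 0) = m.singularPoint →
    g m.xP m.xP = m.zP ∧
    ∃ b : EReal, Tendsto (fun α => rightEnd (D α)) (𝓝[>] m.xP) (𝓝 b) ∧
      D m.xP = {x : ℝ | m.xP ≤ x ∧ (x : EReal) ≤ b} ∧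
      ∀ x ∈ D m.xP, m.xP < x → Tendsto (fun α => g α x) (𝓝[>] m.xP) (𝓝 (g m.xP x))

/-- The graph of `g` over `D`. -/
def graphOver (D : Set ℝ) (g : ℝ → ℝ) : Set (ℝ × ℝ) := (fun x => (x, g x)) '' D

/-- The coefficients of the quadratic equation `a X² - b X + c = 0` for the asymptotic slopes of the
level curve `L = k`. -/
def coeffA (k : ℝ) : ℝ := 2 * m.p * m.delta * (1 + k)

def coeffB (k : ℝ) : ℝ :=
  (2 * m.delta + m.p * (1 - m.p) * (2 * m.mu - m.sigma ^ 2)) * k + 2 * m.p * (1 - m.p) * m.mu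

def coeffC (k : ℝ) : ℝ :=
  (1 - m.p) * (2 * m.mu + (m.p ^ 2 - 1) * m.sigma ^ 2) * k + (1 - m.p) ^ 3 * m.sigma ^ 2

/-- The larger solution of `a(k) X² - b(k) X + c(k) = 0`. -/
def slopeU (k : ℝ) : ℝ := sSup {X | m.coeffA k * X ^ 2 - m.coeffB k * X + m.coeffC k = 0}

/-- The smaller solution of `a(k) X² - b(k) X + c(k) = 0`. -/
def slopeD (k : ℝ) : ℝ := sInf {X | m.coeffA k * X ^ 2 - m.coeffB k * X + m.coeffC k = 0}

/-- The constant `K`. -/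
def constK : ℝ :=
  (1 - m.p) * (m.mu - m.gMean) / ((m.aMean - m.mu) + m.p * (m.mu - m.gMean))

/-- The integrand in the definition of the constant `C`. -/
def integrandC (k : ℝ) : ℝ :=
  k * (deriv m.slopeU k / (k - m.slopeU k) - deriv m.slopeD k / (k - m.slopeD k))

/-- The constant `C`. -/
def constC : ℝ := ∫ k in (0 : ℝ)..m.constK, m.integrandC k

end Market

end

/-! ### The equation in reduced coordinates, its two branches and the trapping region -/

noncomputable section

/-! In the coordinate u = q z the equation reads u' = F(x,u) = p P / Q, where P(x,·) is a concave
quadratic with zeros `dn x < up x`, and the singular point becomes (X, X), on the diagonal.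
Everything rests on the identity u Q = (u - x) S + p x P with S = b x (u - x) - (1 - p) P
(`mul_Q_eq`). Where P ≥ 0 and (u - x) S ≥ 0, away from (X, X), it gives Q > 0, F ≥ 0 and x F ≤ u:
solutions increase and u / x decreases. To the right of X the inequality (u - x) S ≥ 0 follows from
P ≥ 0 (`slack_pos_right`). To the left it is imposed through u ≥ x and S ≥ 0; the resulting `Region`
contains the upper branch and is left only through the lower branch, because P increases along
solutions at the upper branch and x S' = 2 (1 - p) u > 0 wherever S = 0 (`eventually_region`).

An `Arc` is a solution in the region from the upper to the lower branch. To construct one, F is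
replaced outside a compact set by a bounded Lipschitz function and the solution is followed to its
exit time (`exists_solution_until`). Left of X the lower branch lies below the diagonal and cannot
be met; right of X the ratio u / x falls at least logarithmically, so the lower branch is reached at
a finite abscissa (`exists_log_bound`). The assumptions exclude b = d. If b < d, which is π > 1, the
section of the region over X is the single point (X, X), and every arc from the left passes through
it. If d < b, which is π < 1, a Gronwall argument for u - x shows that no arc reaches it
(`ne_X_of_region`).

Uniqueness to the right holds since F is locally Lipschitz off the singular point and one-sided
Lipschitz at it when b < d (`oneSided_singular`). Hence arcs are ordered by their starting points,
one-sided limits in α exist, and by dominated convergence these limits are arcs again. This yields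
the arc from (X, X), the continuity of α ↦ β_α and of the arcs, and, by dominated convergence once
more, that of G.

As α → 0, comparing m log x - P / x with the integral of F / x gives a lower bound of order -log α
for G (`exists_log_le_integral`). For large x, with s = u / x, the integrand F / x equals -w(s) s'
up to a relative perturbation of w by O(1/x), where w = p Y / E is built from the leading parts
along rays (`exists_density`). So G tends to the integral of w between the asymptotic slopes of the
two branches. On the ray where the asymptotic level of F is k, w = k / (s - k); substituting s =
`lvDn k` and s = `lvUp k` turns that integral into C (`integral_lvIntegrand`). -/

/-- Coefficients of the equation in the coordinate `u = q z`: here `b = (1-p)σ²`, `d = 2δ/p`. -/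
structure ReducedODE where
  p : ℝ
  mu : ℝ
  b : ℝ
  d : ℝ
  p_pos : 0 < p
  p_lt : p < 1
  mu_pos : 0 < mu
  b_pos : 0 < b
  d_pos : 0 < d
  le_sq : b * d ≤ mu ^ 2
  lt_mean : 2 * mu < b + d

namespace ReducedODE

variable (c : ReducedODE)

/-- The gap between the arithmetic mean of `b`, `d` and `μ`. -/
def e : ℝ := (c.b + c.d) / 2 - c.mu

/-- Both coordinates of the singular point. -/
def X : ℝ := 1 / c.e

/-- The numerator. -/
def P (x u : ℝ) : ℝ := -c.d * u ^ 2 + 2 * (c.mu * x + 1) * u - c.b * x ^ 2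

/-- The denominator. -/
def Q (x u : ℝ) : ℝ :=
  -(1 - c.p) * c.P x u + (c.b - c.d) * x * u + 2 * (c.mu - c.b) * x ^ 2 + 2 * x

/-- The right-hand side of the equation. -/
def F (x u : ℝ) : ℝ := c.p * c.P x u / c.Q x u

/-- The square root of the discriminant of `P x`. -/
def root (x : ℝ) : ℝ := √((c.mu * x + 1) ^ 2 - c.b * c.d * x ^ 2)

/-- The larger zero of `P x`. -/
def up (x : ℝ) : ℝ := ((c.mu * x + 1) + c.root x) / c.d

/-- The smaller zero of `P x`. -/
def dn (x : ℝ) : ℝ := ((c.mu * x + 1) - c.root x) / c.d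

/-- The region which contains all solutions started on the upper branch. -/
structure Region (x u : ℝ) : Prop where
  pos : 0 < x
  nonneg : 0 ≤ c.P x u
  left : x ≤ c.X → x ≤ u ∧ (1 - c.p) * c.P x u ≤ c.b * x * (u - x)

variable {c}

lemma one_sub_p_pos : 0 < 1 - c.p := sub_pos.2 c.p_lt

lemma e_pos : 0 < c.e := by
  have := c.lt_mean
  unfold e; linarith

lemma X_pos : 0 < c.X := one_div_pos.2 e_pos

lemma e_mul_X : c.e * c.X = 1 := mul_one_div_cancel e_pos.ne'

lemma lt_X_iff {x : ℝ} : x < c.X ↔ c.e * x < 1 := by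
  rw [X, lt_div_iff₀ e_pos, mul_comm]

lemma X_lt_iff {x : ℝ} : c.X < x ↔ 1 < c.e * x := by
  rw [X, div_lt_iff₀ e_pos, mul_comm]

/-- Equality would give μ ≥ b from the geometric mean and μ < b from the arithmetic one. The whole
argument therefore splits into b < d and d < b. -/
lemma b_ne_d : c.b ≠ c.d := by
  intro h
  have h1 := c.le_sq; have h2 := c.lt_mean; have h3 := c.mu_pos
  rw [← h] at h1 h2
  nlinarith [c.b_pos]

lemma mu_lt_b (h : c.d < c.b) : c.mu < c.b := by
  have h2 := c.lt_mean
  linarith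

/-- Otherwise μ² ≤ b² < b d. -/
lemma b_lt_mu (h : c.b < c.d) : c.b < c.mu := by
  have h1 := c.le_sq
  by_contra! h2
  nlinarith [c.b_pos, c.mu_pos]

/-- Expansion about the diagonal, where the singular point lies. Right of X the first and the last
term are nonpositive for u > 0, so P ≥ 0 must be paid for by the middle one. -/
lemma P_eq (x u : ℝ) :
    c.P x u = 2 * u * (1 - c.e * x) + (c.b - c.d) * x * (u - x) - c.d * (u - x) ^ 2 := by
  unfold P e; ring

/-- The central identity: once the product of u - x with the slack is nonnegative, it bounds u Q
below by p x P, which controls the sign of Q and gives x F ≤ u. -/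
lemma mul_Q_eq (x u : ℝ) :
    u * c.Q x u = (u - x) * (c.b * x * (u - x) - (1 - c.p) * c.P x u) + c.p * x * c.P x u := by
  unfold Q P; ring

lemma disc_pos {x : ℝ} (hx : 0 ≤ x) : 0 < (c.mu * x + 1) ^ 2 - c.b * c.d * x ^ 2 := by
  have h1 := c.le_sq; have h3 := c.mu_pos
  nlinarith [mul_nonneg (sub_nonneg.2 h1) (sq_nonneg x), mul_nonneg h3.le hx]

lemma root_pos {x : ℝ} (hx : 0 ≤ x) : 0 < c.root x := Real.sqrt_pos.2 (disc_pos hx)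

lemma root_sq {x : ℝ} (hx : 0 ≤ x) : c.root x ^ 2 = (c.mu * x + 1) ^ 2 - c.b * c.d * x ^ 2 :=
  Real.sq_sqrt (disc_pos hx).le

lemma P_factor {x : ℝ} (hx : 0 ≤ x) (u : ℝ) :
    c.P x u = c.d * ((c.up x - u) * (u - c.dn x)) := by
  have h := root_sq (c := c) hx
  have hd := c.d_pos.ne'
  have : c.d * ((c.up x - u) * (u - c.dn x)) =
      -c.d * u ^ 2 + 2 * (c.mu * x + 1) * u - ((c.mu * x + 1) ^ 2 - c.root x ^ 2) / c.d := by
    unfold up dn; field_simp; ring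
  rw [this, h]
  unfold P; field_simp; ring

lemma dn_lt_up {x : ℝ} (hx : 0 ≤ x) : c.dn x < c.up x := by
  unfold dn up
  have := root_pos (c := c) hx
  exact div_lt_div_of_pos_right (by linarith) c.d_pos

lemma up_pos {x : ℝ} (hx : 0 ≤ x) : 0 < c.up x := by
  have := root_pos (c := c) hx
  have := mul_nonneg c.mu_pos.le hx
  exact div_pos (by linarith) c.d_pos

lemma up_mul_dn {x : ℝ} (hx : 0 ≤ x) : c.up x * c.dn x = c.b / c.d * x ^ 2 := by
  have h := root_sq (c := c) hx
  have hd := c.d_pos.ne'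
  have : c.up x * c.dn x = ((c.mu * x + 1) ^ 2 - c.root x ^ 2) / c.d ^ 2 := by
    unfold up dn; field_simp; ring
  rw [this, h]; field_simp; ring

lemma up_add_dn (x : ℝ) : c.up x + c.dn x = 2 * (c.mu * x + 1) / c.d := by
  unfold up dn; ring

lemma dn_pos {x : ℝ} (hx : 0 < x) : 0 < c.dn x := by
  have h := up_mul_dn (c := c) hx.le
  have h1 : 0 < c.b / c.d * x ^ 2 := mul_pos (div_pos c.b_pos c.d_pos) (pow_pos hx 2)
  rw [← h] at h1
  exact (pos_iff_pos_of_mul_pos h1).1 (up_pos hx.le)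

lemma P_nonneg_iff {x u : ℝ} (hx : 0 ≤ x) : 0 ≤ c.P x u ↔ c.dn x ≤ u ∧ u ≤ c.up x := by
  rw [P_factor hx, mul_nonneg_iff_of_pos_left c.d_pos]
  have := dn_lt_up (c := c) hx
  constructor
  · intro h
    constructor <;> by_contra! h1 <;> nlinarith
  · rintro ⟨h1, h2⟩
    exact mul_nonneg (sub_nonneg.2 h2) (sub_nonneg.2 h1)

lemma P_pos_iff {x u : ℝ} (hx : 0 ≤ x) : 0 < c.P x u ↔ c.dn x < u ∧ u < c.up x := by
  rw [P_factor hx, mul_pos_iff_of_pos_left c.d_pos]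
  have := dn_lt_up (c := c) hx
  constructor
  · intro h
    constructor <;> by_contra! h1 <;> nlinarith
  · rintro ⟨h1, h2⟩
    exact mul_pos (sub_pos.2 h2) (sub_pos.2 h1)

lemma P_eq_zero_iff {x u : ℝ} (hx : 0 ≤ x) : c.P x u = 0 ↔ u = c.dn x ∨ u = c.up x := by
  rw [P_factor hx, mul_eq_zero, mul_eq_zero, sub_eq_zero, sub_eq_zero, or_iff_right c.d_pos.ne',
    or_comm, eq_comm (a := c.up x)]

lemma P_up {x : ℝ} (hx : 0 ≤ x) : c.P x (c.up x) = 0 := (P_eq_zero_iff hx).2 (Or.inr rfl)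

lemma P_dn {x : ℝ} (hx : 0 ≤ x) : c.P x (c.dn x) = 0 := (P_eq_zero_iff hx).2 (Or.inl rfl)

lemma continuous_P : Continuous fun w : ℝ × ℝ => c.P w.1 w.2 := by
  unfold P; fun_prop

lemma continuous_Q : Continuous fun w : ℝ × ℝ => c.Q w.1 w.2 := by
  unfold Q P; fun_prop

lemma continuous_root : Continuous c.root := by
  unfold root; fun_prop

lemma continuous_up : Continuous c.up := by
  have := continuous_root (c := c)
  unfold up; fun_prop

lemma continuous_dn : Continuous c.dn := by
  have := continuous_root (c := c)
  unfold dn; fun_prop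

/-- On the upper branch, `P` increases in `x`. -/
lemma b_lt_mu_mul_up {x : ℝ} (hx : 0 < x) : c.b * x < c.mu * c.up x := by
  have h1 := up_mul_dn (c := c) hx.le
  have h2 := dn_lt_up (c := c) hx.le
  have h3 := up_pos (c := c) hx.le
  have h4 : c.b * x ^ 2 < c.d * c.up x ^ 2 := by
    have : c.d * (c.up x * c.dn x) = c.b * x ^ 2 := by
      rw [h1]; field_simp [c.d_pos.ne']
    nlinarith [mul_pos c.d_pos h3]
  -- Chain of squares: b² x² < b d u² ≤ μ² u² at u = `c.up x`.
  have h5 : (c.b * x) ^ 2 < (c.mu * c.up x) ^ 2 := by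
    have := mul_lt_mul_of_pos_left h4 c.b_pos
    have := mul_le_mul_of_nonneg_right c.le_sq (sq_nonneg (c.up x))
    nlinarith
  exact lt_of_pow_lt_pow_left₀ 2 (mul_pos c.mu_pos h3).le h5

/-- On the lower branch, `P` decreases in `x`. -/
lemma mu_mul_dn_lt_b {x : ℝ} (hx : 0 < x) : c.mu * c.dn x < c.b * x := by
  have h1 := up_mul_dn (c := c) hx.le
  have h2 := dn_lt_up (c := c) hx.le
  have h3 := dn_pos (c := c) hx
  have h0 := P_dn (c := c) hx.le
  have h4 : c.d * c.dn x ^ 2 < c.b * x ^ 2 := by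
    have : c.d * (c.up x * c.dn x) = c.b * x ^ 2 := by
      rw [h1]; field_simp [c.d_pos.ne']
    nlinarith [mul_pos c.d_pos h3]
  unfold P at h0
  have : x * (c.mu * c.dn x) < x * (c.b * x) := by nlinarith
  exact lt_of_mul_lt_mul_left this hx.le

/-- If `c.up y` were smaller, P would be negative at (y, `c.up x`). But for fixed u the increment of
P from x to y is (y - x)(2 μ u - b (x + y)), nonnegative by `b_lt_mu_mul_up` at both points. -/
lemma up_le_up {x y : ℝ} (hx : 0 < x) (hxy : x ≤ y) : c.up x ≤ c.up y := by
  have h1 := b_lt_mu_mul_up (c := c) hx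
  have h0 := P_up (c := c) hx.le
  by_contra! hlt
  have h2 := up_pos (c := c) (hx.le.trans hxy)
  have h3 : ¬ 0 ≤ c.P y (c.up x) := fun h => by
    have := ((P_nonneg_iff (hx.le.trans hxy)).1 h).2
    linarith
  apply h3
  have h5 : c.P y (c.up x) - c.P x (c.up x) =
      (y - x) * (2 * c.mu * c.up x - c.b * (x + y)) := by unfold P; ring
  have h6 := up_add_dn (c := c) y
  have h7 := dn_pos (c := c) (hx.trans_le hxy)
  have h8 := b_lt_mu_mul_up (c := c) (hx.trans_le hxy)
  have h9 : c.mu * c.up y < c.mu * c.up x := mul_lt_mul_of_pos_left hlt c.mu_pos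
  have : 0 ≤ (y - x) * (2 * c.mu * c.up x - c.b * (x + y)) :=
    mul_nonneg (by linarith) (by linarith)
  linarith

lemma up_lt_up {x y : ℝ} (hx : 0 < x) (hxy : x < y) : c.up x < c.up y := by
  refine lt_of_le_of_ne (up_le_up hx hxy.le) fun h => ?_
  have h0 := P_up (c := c) hx.le
  have h1 := P_up (c := c) (hx.trans hxy).le
  rw [← h] at h1
  have h2 := b_lt_mu_mul_up (c := c) hx
  have h3 := b_lt_mu_mul_up (c := c) (hx.trans hxy)
  rw [← h] at h3
  have h5 : c.P y (c.up x) - c.P x (c.up x) =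
      (y - x) * (2 * c.mu * c.up x - c.b * (x + y)) := by unfold P; ring
  have : 0 < (y - x) * (2 * c.mu * c.up x - c.b * (x + y)) :=
    mul_pos (by linarith) (by linarith)
  linarith

lemma dn_lt_dn {x y : ℝ} (hx : 0 < x) (hxy : x < y) : c.dn x < c.dn y := by
  have hy := hx.trans hxy
  by_contra! hle
  have h2 := mu_mul_dn_lt_b (c := c) hx
  have h3 := mu_mul_dn_lt_b (c := c) hy
  have h5 : c.P y (c.dn x) - c.P x (c.dn x) =
      (y - x) * (2 * c.mu * c.dn x - c.b * (x + y)) := by unfold P; ring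
  have h6 : (y - x) * (2 * c.mu * c.dn x - c.b * (x + y)) < 0 :=
    mul_neg_of_pos_of_neg (by linarith) (by nlinarith [c.b_pos])
  have h7 := P_dn (c := c) hx.le
  have h8 : 0 ≤ c.P y (c.dn x) := by
    refine (P_nonneg_iff hy.le).2 ⟨hle, ?_⟩
    exact (dn_lt_up hx.le).le.trans (up_lt_up hx hxy).le
  linarith

lemma inv_d_le_up {x : ℝ} (hx : 0 ≤ x) : 1 / c.d ≤ c.up x := by
  have := root_pos (c := c) hx
  have := mul_nonneg c.mu_pos.le hx
  exact div_le_div_of_nonneg_right (by linarith) c.d_pos.le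

lemma P_diag (x : ℝ) : c.P x x = 2 * x * (1 - c.e * x) := by rw [P_eq]; ring

lemma P_X : c.P c.X c.X = 0 := by rw [P_diag, e_mul_X]; ring

lemma Q_X : c.Q c.X c.X = 0 := by
  have h := mul_Q_eq (c := c) c.X c.X
  rw [P_X] at h
  simpa [X_pos.ne'] using h

/-- To the right of the singular abscissa, `u - x` has the sign of `b - d` where `0 ≤ P`. -/
lemma right_sign {x u : ℝ} (hx : c.X ≤ x) (hP : 0 ≤ c.P x u) (hne : ¬ (x = c.X ∧ u = c.X)) :
    0 < (c.b - c.d) * (u - x) := by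
  have hx0 := X_pos.trans_le hx
  have hu : 0 < u := (dn_pos hx0).trans_le ((P_nonneg_iff hx0.le).1 hP).1
  have hex : 1 ≤ c.e * x := by
    have := mul_le_mul_of_nonneg_left hx (e_pos (c := c)).le
    rwa [e_mul_X] at this
  rw [P_eq] at hP
  have h1 : 0 ≤ 2 * u * (c.e * x - 1) := mul_nonneg (by linarith) (by linarith)
  by_cases hv : u = x
  · subst hv
    exfalso
    have : 2 * u * (c.e * u - 1) ≤ 0 := by nlinarith
    have : c.e * u - 1 ≤ 0 := by
      by_contra! h
      have := mul_pos (mul_pos two_pos hu) h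
      linarith
    have h3 : u = c.X := by
      rw [X, eq_div_iff e_pos.ne']; linarith
    exact hne ⟨h3, h3⟩
  · have h2 : 0 < c.d * (u - x) ^ 2 := mul_pos c.d_pos (by positivity [sub_ne_zero.2 hv])
    have : 0 < x * ((c.b - c.d) * (u - x)) := by nlinarith
    exact (pos_iff_pos_of_mul_pos this).1 hx0

/-- If b < d, then u < x and the term with P only helps. If d < b, then u > x and P ≤ (b - d) x (u -
x), so the slack keeps at least d x (u - x). -/
lemma slack_pos_right {x u : ℝ} (hx : c.X ≤ x) (hP : 0 ≤ c.P x u)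
    (hne : ¬ (x = c.X ∧ u = c.X)) :
    min c.b c.d * x * (u - x) ^ 2 ≤ (u - x) * (c.b * x * (u - x) - (1 - c.p) * c.P x u) := by
  have hs := right_sign hx hP hne
  have hx0 := X_pos.trans_le hx
  have hu : 0 < u := (dn_pos hx0).trans_le ((P_nonneg_iff hx0.le).1 hP).1
  have hex : 1 ≤ c.e * x := by
    have := mul_le_mul_of_nonneg_left hx (e_pos (c := c)).le
    rwa [e_mul_X] at this
  have ha := c.p_pos
  have ha' := one_sub_p_pos (c := c)
  rcases lt_or_gt_of_ne (b_ne_d (c := c)) with h | h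
  · have hv : u - x < 0 := by
      by_contra! h1
      nlinarith
    have : 0 ≤ (x - u) * ((1 - c.p) * c.P x u) :=
      mul_nonneg (by linarith) (mul_nonneg ha'.le hP)
    rw [min_eq_left h.le]
    nlinarith
  · have hv : 0 < u - x := by
      by_contra! h1
      nlinarith
    rw [min_eq_right h.le]
    have h1 : (1 - c.p) * c.P x u ≤ c.P x u := by nlinarith
    have h2 : c.P x u ≤ (c.b - c.d) * x * (u - x) := by
      rw [P_eq]
      have : 0 ≤ 2 * u * (c.e * x - 1) := mul_nonneg (by linarith) (by linarith)
      nlinarith [mul_nonneg c.d_pos.le (sq_nonneg (u - x))]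
    have h3 : c.d * x * (u - x) ≤ c.b * x * (u - x) - (1 - c.p) * c.P x u := by linarith
    nlinarith [mul_le_mul_of_nonneg_left h3 hv.le]

lemma Region.u_pos {x u : ℝ} (h : c.Region x u) : 0 < u :=
  (dn_pos h.pos).trans_le ((P_nonneg_iff h.pos.le).1 h.nonneg).1

lemma Region.le_up {x u : ℝ} (h : c.Region x u) : u ≤ c.up x :=
  ((P_nonneg_iff h.pos.le).1 h.nonneg).2

lemma Region.dn_le {x u : ℝ} (h : c.Region x u) : c.dn x ≤ u :=
  ((P_nonneg_iff h.pos.le).1 h.nonneg).1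

lemma Region.slack_nonneg {x u : ℝ} (h : c.Region x u) :
    0 ≤ (u - x) * (c.b * x * (u - x) - (1 - c.p) * c.P x u) := by
  rcases le_or_gt x c.X with hx | hx
  · obtain ⟨h1, h2⟩ := h.left hx
    exact mul_nonneg (by linarith) (by linarith)
  · refine le_trans ?_ (slack_pos_right hx.le h.nonneg fun h' => hx.ne' h'.1)
    exact mul_nonneg (mul_nonneg (le_min c.b_pos.le c.d_pos.le) h.pos.le) (sq_nonneg _)

/-- On the diagonal left of X, P = 2 x (1 - e x) is positive, while the slack condition at u = x
would force P ≤ 0. -/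
lemma Region.lt_of_lt {x u : ℝ} (h : c.Region x u) (hx : x < c.X) : x < u := by
  obtain ⟨h1, h2⟩ := h.left hx.le
  refine lt_of_le_of_ne h1 fun h3 => ?_
  subst h3
  rw [P_diag, sub_self, mul_zero] at h2
  have := lt_X_iff.1 hx
  have := mul_pos (one_sub_p_pos (c := c)) (mul_pos (mul_pos two_pos h.pos) (sub_pos.2 this))
  linarith

/-- Both summands of u Q in `mul_Q_eq` are nonnegative. They vanish together only if P = 0 and u =
x, which happens only at the singular point. -/
lemma Region.Q_pos {x u : ℝ} (h : c.Region x u) (hne : ¬ (x = c.X ∧ u = c.X)) : 0 < c.Q x u := by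
  have hu := h.u_pos
  have key : 0 < u * c.Q x u := by
    rw [mul_Q_eq]
    have h2 : 0 ≤ c.p * x * c.P x u := mul_nonneg (mul_pos c.p_pos h.pos).le h.nonneg
    have h1 := h.slack_nonneg
    by_contra! h3
    have h4 : c.p * x * c.P x u = 0 := by linarith
    have h5 : c.P x u = 0 := by
      simpa [c.p_pos.ne', h.pos.ne'] using h4
    rw [h5] at h3
    have h6 : u = x := by
      have : c.b * x * (u - x) ^ 2 ≤ 0 := by linarith
      have : (u - x) ^ 2 ≤ 0 := by
        by_contra! h7
        have := mul_pos (mul_pos c.b_pos h.pos) h7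
        linarith
      nlinarith [sq_nonneg (u - x)]
    subst h6
    rw [P_diag] at h5
    have : 1 - c.e * u = 0 := by simpa [h.pos.ne'] using h5
    have h8 : u = c.X := by rw [X, eq_div_iff e_pos.ne']; linarith
    exact hne ⟨h8, h8⟩
  exact (pos_iff_pos_of_mul_pos key).1 hu

lemma region_of_right {x u : ℝ} (hx : c.X < x) (hP : 0 ≤ c.P x u) : c.Region x u :=
  ⟨X_pos.trans hx, hP, fun h => absurd h (not_le.2 hx)⟩

lemma Region.F_nonneg {x u : ℝ} (h : c.Region x u) : 0 ≤ c.F x u := by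
  by_cases hne : x = c.X ∧ u = c.X
  -- At the singular point F has the value 0, by the convention for division by zero.
  · rw [F, hne.1, hne.2, Q_X, div_zero]
  · exact div_nonneg (mul_nonneg c.p_pos.le h.nonneg) (h.Q_pos hne).le

/-- After multiplication by Q this is nonnegativity of the slack product. It is what makes u / x
decrease along solutions. -/
lemma Region.x_mul_F_le {x u : ℝ} (h : c.Region x u) : x * c.F x u ≤ u := by
  by_cases hne : x = c.X ∧ u = c.X
  · rw [F, hne.1, hne.2, Q_X, div_zero, mul_zero]; exact X_pos.le
  · have hQ := h.Q_pos hne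
    rw [F, mul_div_assoc', div_le_iff₀ hQ, mul_Q_eq]
    have := h.slack_nonneg
    nlinarith

/-- The starting points belong to the region. -/
lemma lt_up {x : ℝ} (hx : 0 < x) (h : x < c.X) : x < c.up x := by
  have : 0 < c.P x x := by
    rw [P_diag]
    exact mul_pos (by linarith) (sub_pos.2 (lt_X_iff.1 h))
  exact ((P_pos_iff hx.le).1 this).2

lemma dn_lt {x : ℝ} (hx : 0 < x) (h : x < c.X) : c.dn x < x := by
  have : 0 < c.P x x := by
    rw [P_diag]
    exact mul_pos (by linarith) (sub_pos.2 (lt_X_iff.1 h))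
  exact ((P_pos_iff hx.le).1 this).1

/-- (X, X) is a zero of P, and `right_sign` at x = X forbids a zero above it when b < d. So here the
upper branch carries the singular point; for d < b it is the lower one. -/
lemma up_X_of_lt (h : c.b < c.d) : c.up c.X = c.X := by
  refine le_antisymm ?_ ((P_nonneg_iff X_pos.le).1 P_X.ge).2
  by_contra! h1
  have := right_sign le_rfl (P_up (c := c) X_pos.le).ge (fun h' => by linarith [h'.2])
  nlinarith

lemma dn_X_of_lt (h : c.d < c.b) : c.dn c.X = c.X := by
  refine le_antisymm ((P_nonneg_iff X_pos.le).1 P_X.ge).1 ?_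
  by_contra! h1
  have := right_sign le_rfl (P_dn (c := c) X_pos.le).ge (fun h' => by linarith [h'.2])
  nlinarith

lemma X_le_up_X : c.X ≤ c.up c.X := ((P_nonneg_iff X_pos.le).1 P_X.ge).2

lemma dn_X_le : c.dn c.X ≤ c.X := ((P_nonneg_iff X_pos.le).1 P_X.ge).1

lemma region_up {x : ℝ} (hx : 0 < x) : c.Region x (c.up x) := by
  refine ⟨hx, (P_up hx.le).ge, fun h => ?_⟩
  have : x ≤ c.up x := by
    rcases h.lt_or_eq with h | h
    · exact (lt_up hx h).le
    · rw [h]; exact X_le_up_X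
  refine ⟨this, ?_⟩
  rw [P_up hx.le, mul_zero]
  exact mul_nonneg (mul_pos c.b_pos hx).le (by linarith)

end ReducedODE
end

/-! ### Tools: cut-off of the right-hand side, exit times, one-sided Gronwall -/

noncomputable section

open scoped Manifold ContDiff in
/-- A function which is `C¹` near a compact set `K` coincides on `K` with a bounded, globally
Lipschitz function. -/
lemma exists_lipschitz_extension {f : ℝ × ℝ → ℝ} {K U : Set (ℝ × ℝ)} (hK : IsCompact K)
    (hU : IsOpen U) (hKU : K ⊆ U) (hf : ∀ w ∈ U, ContDiffAt ℝ 1 f w) :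
    ∃ (h : ℝ × ℝ → ℝ) (C : NNReal) (M : NNReal), LipschitzWith C h ∧ (∀ w, ‖h w‖ ≤ M) ∧
      EqOn h f K := by
  obtain ⟨L, hL, hKL, hLU⟩ := exists_compact_between hK hU hKU
  obtain ⟨χ, h1, h0, -⟩ := exists_contMDiffMap_one_nhds_of_subset_interior
    (n := 1) 𝓘(ℝ, ℝ × ℝ) hK.isClosed hKL
  have hχ : ContDiff ℝ 1 χ := χ.contMDiff.contDiff
  have hsub : tsupport χ ⊆ L := by
    refine closure_minimal (fun w hw => ?_) hL.isClosed
    by_contra hwL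
    exact hw (h0 w hwL)
  have hcd : ContDiff ℝ 1 fun w => χ w * f w := by
    rw [contDiff_iff_contDiffAt]
    intro w
    by_cases hw : w ∈ tsupport χ
    · exact hχ.contDiffAt.mul (hf w (hLU (hsub hw)))
    · have : (fun w => χ w * f w) =ᶠ[𝓝 w] fun _ => 0 := by
        filter_upwards [notMem_tsupport_iff_eventuallyEq.1 hw] with v hv
        rw [hv]; simp
      exact contDiffAt_const.congr_of_eventuallyEq this
  have hcs : HasCompactSupport fun w => χ w * f w := by
    refine HasCompactSupport.mul_right ?_
    exact hL.of_isClosed_subset (isClosed_tsupport _) hsub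
  obtain ⟨C, hC⟩ := hcd.lipschitzWith_of_hasCompactSupport hcs one_ne_zero
  obtain ⟨M, hM⟩ := hcs.exists_bound_of_continuous hcd.continuous
  refine ⟨_, C, M.toNNReal, hC, fun w => (hM w).trans (Real.le_coe_toNNReal M), fun w hw => ?_⟩
  have : χ w = 1 := h1.self_of_nhdsSet _ hw
  simp [this]

/-- Global solvability for a bounded Lipschitz right-hand side. -/
lemma exists_solution_of_lipschitz {h : ℝ × ℝ → ℝ} {C M : NNReal} (hC : LipschitzWith C h)
    (hM : ∀ w, ‖h w‖ ≤ M) {x₀ x₁ : ℝ} (hx : x₀ ≤ x₁) (z₀ : ℝ) :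
    ∃ y : ℝ → ℝ, y x₀ = z₀ ∧
      ∀ x ∈ Icc x₀ x₁, HasDerivWithinAt y (h (x, y x)) (Icc x₀ x₁) x := by
  have hp : IsPicardLindelof (fun x z => h (x, z)) (⟨x₀, left_mem_Icc.2 hx⟩ : Icc x₀ x₁) z₀
      (M * (x₁ - x₀).toNNReal) 0 M C :=
    { lipschitzOnWith := fun t _ => by
        refine (LipschitzWith.of_dist_le_mul fun a b => ?_).lipschitzOnWith
        have := hC.dist_le_mul (t, a) (t, b)
        rwa [Prod.dist_eq, dist_self, max_eq_right dist_nonneg] at this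
      continuousOn := fun z _ => by
        have := hC.continuous
        fun_prop
      norm_le := fun t _ z _ => hM _
      mul_max_le := by
        have : (x₁ - x₀) ⊔ 0 = x₁ - x₀ := max_eq_left (sub_nonneg.2 hx)
        simp [this] }
  exact hp.exists_eq_forall_mem_Icc_hasDerivWithinAt₀

/-- A function with positive right derivative is larger immediately to the right. -/
lemma eventually_gt_of_hasDerivWithinAt_pos {f : ℝ → ℝ} {f' x : ℝ}
    (h : HasDerivWithinAt f f' (Ioi x) x) (hf : 0 < f') : ∀ᶠ y in 𝓝[>] x, f x < f y := by
  have := hasDerivWithinAt_iff_tendsto_slope' (notMem_Ioi.2 le_rfl) |>.1 h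
  filter_upwards [this.eventually (lt_mem_nhds hf), self_mem_nhdsWithin] with y hy hxy
  rw [slope_def_field] at hy
  have := (div_pos_iff_of_pos_right (sub_pos.2 hxy)).1 hy
  linarith

/-- The first exit time of a continuous curve from a closed set. -/
lemma exists_exit_time {K : Set (ℝ × ℝ)} (hK : IsClosed K) {y : ℝ → ℝ} {x₀ x₁ : ℝ}
    (hx : x₀ ≤ x₁) (hy : ContinuousOn y (Icc x₀ x₁)) (h₀ : (x₀, y x₀) ∈ K) :
    ∃ b ∈ Icc x₀ x₁, (∀ x ∈ Icc x₀ b, (x, y x) ∈ K) ∧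
      (b < x₁ → ¬ ∀ᶠ x in 𝓝[>] b, (x, y x) ∈ K) := by
  set S : Set ℝ := {x | x ∈ Icc x₀ x₁ ∧ ∀ x' ∈ Icc x₀ x, (x', y x') ∈ K} with hS
  have hS0 : x₀ ∈ S := ⟨left_mem_Icc.2 hx, fun x' hx' => by
    rw [show x' = x₀ from le_antisymm hx'.2 hx'.1]; exact h₀⟩
  have hbdd : BddAbove S := ⟨x₁, fun x h => h.1.2⟩
  set b := sSup S with hb
  have hb0 : x₀ ≤ b := le_csSup hbdd hS0
  have hb1 : b ≤ x₁ := csSup_le ⟨x₀, hS0⟩ fun x h => h.1.2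
  have hlt : ∀ x, x₀ ≤ x → x < b → (x, y x) ∈ K := fun x h1 h2 => by
    obtain ⟨s, hs, hxs⟩ := exists_lt_of_lt_csSup ⟨x₀, hS0⟩ h2
    exact hs.2 x ⟨h1, hxs.le⟩
  have hbK : (b, y b) ∈ K := by
    rcases hb0.eq_or_lt with h | h
    · rw [← h]; exact h₀
    · have hc : Tendsto (fun x => (x, y x)) (𝓝[Ico x₀ b] b) (𝓝 (b, y b)) := by
        refine Tendsto.prodMk_nhds (tendsto_nhdsWithin_of_tendsto_nhds tendsto_id) ?_
        exact ((hy b ⟨hb0, hb1⟩).mono fun x hx => ⟨hx.1, hx.2.le.trans hb1⟩).tendsto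
      have : (𝓝[Ico x₀ b] b).NeBot := by
        rw [nhdsWithin_Ico_eq_nhdsLT h]; infer_instance
      exact hK.mem_of_tendsto hc (eventually_mem_nhdsWithin.mono fun x hx => hlt x hx.1 hx.2)
  have hmem : ∀ x ∈ Icc x₀ b, (x, y x) ∈ K := fun x hx => by
    rcases hx.2.lt_or_eq with h | h
    · exact hlt x hx.1 h
    · rw [h]; exact hbK
  refine ⟨b, ⟨hb0, hb1⟩, hmem, fun hlt1 hev => ?_⟩
  rw [eventually_nhdsWithin_iff, Metric.eventually_nhds_iff] at hev
  obtain ⟨ε, hε, hev⟩ := hev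
  set b' := min x₁ (b + ε / 2) with hb'
  have hbb' : b < b' := lt_min hlt1 (by linarith)
  have : b' ∈ S := by
    refine ⟨⟨hb0.trans hbb'.le, min_le_left _ _⟩, fun x hx => ?_⟩
    rcases le_or_gt x b with h | h
    · exact hmem x ⟨hx.1, h⟩
    · refine hev ?_ h
      have := hx.2.trans (min_le_right _ _)
      rw [Real.dist_eq, abs_lt]; constructor <;> linarith
  exact absurd (le_csSup hbdd this) (not_le.2 hbb')

/-- A one-sided Gronwall lemma. -/
lemma eq_zero_of_mul_deriv_le {h h' : ℝ → ℝ} {a b Λ : ℝ} (hc : ContinuousOn h (Icc a b))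
    (hd : ∀ x ∈ Ioo a b, HasDerivAt h (h' x) x) (h0 : h a = 0)
    (hle : ∀ x ∈ Ioo a b, h x * h' x ≤ Λ * h x ^ 2) : ∀ x ∈ Icc a b, h x = 0 := by
  intro x hx
  have hder : ∀ x ∈ Ioo a b, HasDerivAt (fun x => h x ^ 2 * Real.exp (-(2 * Λ) * x))
      ((2 * h x * h' x) * Real.exp (-(2 * Λ) * x) +
        h x ^ 2 * (Real.exp (-(2 * Λ) * x) * (-(2 * Λ)))) x := fun x hx => by
    have h1 : HasDerivAt (fun x => h x ^ 2) (2 * h x * h' x) x := by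
      simpa using (hd x hx).fun_pow 2
    have h2 : HasDerivAt (fun x => Real.exp (-(2 * Λ) * x))
        (Real.exp (-(2 * Λ) * x) * (-(2 * Λ))) x := by
      simpa using ((hasDerivAt_id x).const_mul (-(2 * Λ))).exp
    exact h1.mul h2
  -- The weight exp(-2Λx) turns the derivative of h² into 2 (h h' - Λ h²) times the weight, which is
  -- nonpositive.
  have hanti : AntitoneOn (fun x => h x ^ 2 * Real.exp (-(2 * Λ) * x)) (Icc a b) := by
    refine antitoneOn_of_deriv_nonpos (convex_Icc a b) ?_ ?_ ?_
    · exact (hc.pow 2).mul (by fun_prop)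
    · rw [interior_Icc]
      exact fun x hx => (hder x hx).differentiableAt.differentiableWithinAt
    · rw [interior_Icc]
      intro x hx
      rw [(hder x hx).deriv]
      have := mul_le_mul_of_nonneg_right (hle x hx) (Real.exp_pos (-(2 * Λ) * x)).le
      linarith
  have := hanti (left_mem_Icc.2 (hx.1.trans hx.2)) hx hx.1
  simp only [h0] at this
  have h3 : h x ^ 2 ≤ 0 := by
    by_contra! h4
    have := mul_pos h4 (Real.exp_pos (-(2 * Λ) * x))
    linarith
  nlinarith [sq_nonneg (h x)]

/-- Induction along an interval: if agreement up to `y` propagates a little further, then it holds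
everywhere. -/
lemma eqOn_Icc_of_forall_extend {f g : ℝ → ℝ} {a b : ℝ} (hf : ContinuousOn f (Icc a b))
    (hg : ContinuousOn g (Icc a b)) (h0 : f a = g a)
    (hext : ∀ y ∈ Ico a b, (∀ x ∈ Icc a y, f x = g x) → ∀ᶠ x in 𝓝[>] y, f x = g x) :
    ∀ x ∈ Icc a b, f x = g x := by
  intro x hx
  have hab := hx.1.trans hx.2
  have hcont : ContinuousOn (fun x => f x - g x) (Icc a b) := hf.sub hg
  obtain ⟨c, hc, hcK, hcex⟩ := exists_exit_time (K := {w : ℝ × ℝ | w.2 = 0})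
    (isClosed_eq continuous_snd continuous_const) hab hcont (by simp [h0])
  have hcK' : ∀ x ∈ Icc a c, f x = g x := fun x hx => sub_eq_zero.1 (hcK x hx)
  rcases hc.2.lt_or_eq with h | h
  · refine absurd ?_ (hcex h)
    filter_upwards [hext c ⟨hc.1, h⟩ hcK'] with x hx
    simp [hx]
  · exact hcK' x (h ▸ hx)

end

/-! ### Inner solutions, barriers at the branches, one-sided Lipschitz estimates -/

noncomputable section

/-- An open condition at a point of the graph persists on a short interval to the right. The
interval also avoids `A` in its interior, because the equation is not required at X. -/
lemma exists_right_nhd {g : ℝ → ℝ} {y b : ℝ} {p : ℝ × ℝ → Prop} (hy : y < b)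
    (hg : ContinuousOn g (Icc y b)) (hp : ∀ᶠ w in 𝓝 (y, g y), p w) (A : ℝ) :
    ∃ c, y < c ∧ c ≤ b ∧ (∀ x ∈ Ioo y c, x ≠ A) ∧ ∀ x ∈ Icc y c, p (x, g x) := by
  have hc : Tendsto (fun x => (x, g x)) (𝓝[Icc y b] y) (𝓝 (y, g y)) :=
    Tendsto.prodMk_nhds (tendsto_nhdsWithin_of_tendsto_nhds tendsto_id)
      (hg y (left_mem_Icc.2 hy.le))
  have h1 := hc.eventually hp
  have h2 : ∀ᶠ x in 𝓝 y, y < A → x < A := by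
    rcases lt_or_ge y A with h | h
    · filter_upwards [Iio_mem_nhds h] with x hx _ using hx
    · exact Eventually.of_forall fun x hx => absurd hx (not_lt.2 h)
  have h3 := h1.and (h2.filter_mono nhdsWithin_le_nhds)
  rw [eventually_nhdsWithin_iff, Metric.eventually_nhds_iff] at h3
  obtain ⟨ε, hε, h3⟩ := h3
  refine ⟨min b (y + ε / 2), lt_min hy (by linarith), min_le_left _ _, fun x hx hxA => ?_,
    fun x hx => ?_⟩
  · have hxb := hx.2.le.trans (min_le_left _ _)
    have hxe := hx.2.le.trans (min_le_right _ _)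
    have := (h3 (by rw [Real.dist_eq, abs_lt]; constructor <;> linarith [hx.1])
      ⟨hx.1.le, hxb⟩).2 (hxA ▸ hx.1)
    exact this.ne hxA
  · have hxb := hx.2.trans (min_le_left _ _)
    have hxe := hx.2.trans (min_le_right _ _)
    exact (h3 (by rw [Real.dist_eq, abs_lt]; constructor <;> linarith [hx.1])
      ⟨hx.1, hxb⟩).1

lemma exists_left_nhd {g : ℝ → ℝ} {y b : ℝ} {p : ℝ × ℝ → Prop} (hy : b < y)
    (hg : ContinuousOn g (Icc b y)) (hp : ∀ᶠ w in 𝓝 (y, g y), p w) (A : ℝ) :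
    ∃ c, c < y ∧ b ≤ c ∧ (∀ x ∈ Ioo c y, x ≠ A) ∧ ∀ x ∈ Icc c y, p (x, g x) := by
  obtain ⟨c, h1, h2, h3, h4⟩ := exists_right_nhd (g := fun x => g (-x)) (y := -y) (b := -b)
    (p := fun w => p (-w.1, w.2)) (neg_lt_neg hy)
    (hg.comp continuousOn_neg fun x hx => ⟨by linarith [hx.2], by linarith [hx.1]⟩)
    (by
      have : Tendsto (fun w : ℝ × ℝ => (-w.1, w.2)) (𝓝 (-y, g (- -y))) (𝓝 (y, g y)) := by
        have : Continuous fun w : ℝ × ℝ => (-w.1, w.2) := by fun_prop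
        have h := this.tendsto (-y, g (- -y))
        simpa using h
      exact this.eventually hp) (-A)
  refine ⟨-c, by linarith, by linarith, fun x hx hxA => ?_, fun x hx => ?_⟩
  · exact h3 (-x) ⟨by linarith [hx.2], by linarith [hx.1]⟩ (by rw [hxA])
  · simpa using h4 (-x) ⟨by linarith [hx.2], by linarith [hx.1]⟩

namespace ReducedODE

variable (c : ReducedODE)

/-- Solutions of the equation in the set `0 ≤ P`. -/
structure Inner (D : Set ℝ) (g : ℝ → ℝ) : Prop where
  interval : D.OrdConnected
  pos : D ⊆ Ioi 0
  cont : ContinuousOn g D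
  nonneg : ∀ x ∈ D, 0 ≤ c.P x (g x)
  ode : ∀ x ∈ interior D, x ≠ c.X → c.Q x (g x) ≠ 0 ∧ HasDerivAt g (c.F x (g x)) x

/-- Solutions which run from the upper to the lower branch of `P = 0`. -/
structure Arc (α β : ℝ) (g : ℝ → ℝ) : Prop where
  pos : 0 < α
  lt : α < β
  cont : ContinuousOn g (Icc α β)
  region : ∀ x ∈ Icc α β, c.Region x (g x)
  ode : ∀ x ∈ Ioo α β, x ≠ c.X → HasDerivAt g (c.F x (g x)) x
  start : g α = c.up α
  terminal : g β = c.dn β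

variable {c}

lemma Arc.inner {α β : ℝ} {g : ℝ → ℝ} (h : c.Arc α β g) : c.Inner (Icc α β) g := by
  refine ⟨ordConnected_Icc, fun x hx => h.pos.trans_le hx.1, h.cont,
    fun x hx => (h.region x hx).nonneg, fun x hx hne => ?_⟩
  rw [interior_Icc] at hx
  exact ⟨((h.region x (Ioo_subset_Icc_self hx)).Q_pos fun h' => hne h'.1).ne', h.ode x hx hne⟩

lemma contDiffAt_F {w : ℝ × ℝ} (hQ : c.Q w.1 w.2 ≠ 0) :
    ContDiffAt ℝ 1 (fun w : ℝ × ℝ => c.F w.1 w.2) w := by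
  unfold F
  refine ContDiffAt.div ?_ ?_ hQ
  · unfold P; fun_prop
  · unfold Q P; fun_prop

lemma continuousAt_F {w : ℝ × ℝ} (hQ : c.Q w.1 w.2 ≠ 0) :
    ContinuousAt (fun w : ℝ × ℝ => c.F w.1 w.2) w := (contDiffAt_F hQ).continuousAt

/-- The partial derivatives of `P`. -/
def Px (c : ReducedODE) (x u : ℝ) : ℝ := 2 * c.mu * u - 2 * c.b * x

def Pu (c : ReducedODE) (x u : ℝ) : ℝ := -2 * c.d * u + 2 * (c.mu * x + 1)

lemma hasDerivAt_P {g : ℝ → ℝ} {g' x : ℝ} (hg : HasDerivAt g g' x) :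
    HasDerivAt (fun x => c.P x (g x)) (c.Px x (g x) + c.Pu x (g x) * g') x := by
  have h1 := ((hg.fun_pow 2).const_mul (-c.d)).add
    (((((hasDerivAt_id x).const_mul (2 * c.mu)).add_const 2)).mul hg)
  have h2 := h1.sub (((hasDerivAt_id x).fun_pow 2).const_mul c.b)
  refine (h2.congr_deriv ?_).congr_of_eventuallyEq (Eventually.of_forall fun y => ?_)
  · simp [Px, Pu]; ring
  · simp only [P, Pi.add_apply, Pi.sub_apply, Pi.mul_apply, id]; ring

lemma Px_up_pos {x : ℝ} (hx : 0 < x) : 0 < c.Px x (c.up x) := by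
  have := b_lt_mu_mul_up (c := c) hx
  unfold Px; linarith

lemma Px_dn_neg {x : ℝ} (hx : 0 < x) : c.Px x (c.dn x) < 0 := by
  have := mu_mul_dn_lt_b (c := c) hx
  unfold Px; linarith

lemma eventually_deriv_P {y ζ : ℝ} (hQ : c.Q y ζ ≠ 0) :
    ContinuousAt (fun w : ℝ × ℝ => c.Px w.1 w.2 + c.Pu w.1 w.2 * c.F w.1 w.2) (y, ζ) := by
  have h := continuousAt_F (c := c) (w := (y, ζ)) hQ
  have h1 : ContinuousAt (fun w : ℝ × ℝ => c.Px w.1 w.2) (y, ζ) := by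
    unfold Px; fun_prop
  have h2 : ContinuousAt (fun w : ℝ × ℝ => c.Pu w.1 w.2) (y, ζ) := by
    unfold Pu; fun_prop
  exact h1.add (h2.mul h)

/-- Solutions cannot be continued beyond the lower branch. -/
lemma not_nonneg_right {g : ℝ → ℝ} {y b : ℝ} (hyb : y < b) (hg : ContinuousOn g (Icc y b))
    (hP : ∀ x ∈ Icc y b, 0 ≤ c.P x (g x))
    (hode : ∀ x ∈ Ioo y b, x ≠ c.X → HasDerivAt g (c.F x (g x)) x)
    (h0 : c.P y (g y) = 0) (hQ : c.Q y (g y) ≠ 0) : 0 ≤ c.Px y (g y) := by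
  by_contra! hPx
  -- Where P = 0 also F = 0, so the derivative of P along the solution is the partial derivative in
  -- x alone; a negative value would make P negative just after y.
  have hv : c.Px y (g y) + c.Pu y (g y) * c.F y (g y) < 0 := by
    rw [F, h0]; simpa using hPx
  obtain ⟨z, hz, hzb, hzA, hz'⟩ := exists_right_nhd hyb hg
    ((eventually_deriv_P hQ).eventually (gt_mem_nhds hv)) c.X
  have hcont : ContinuousOn (fun x => c.P x (g x)) (Icc y z) :=
    continuous_P.comp_continuousOn (continuousOn_id.prodMk (hg.mono (Icc_subset_Icc_right hzb)))
  have hanti : StrictAntiOn (fun x => c.P x (g x)) (Icc y z) := by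
    refine strictAntiOn_of_deriv_neg (convex_Icc _ _) hcont fun x hx => ?_
    rw [interior_Icc] at hx
    rw [(hasDerivAt_P (hode x ⟨hx.1, hx.2.trans_le hzb⟩ (hzA x hx))).deriv]
    exact hz' x (Ioo_subset_Icc_self hx)
  have := hanti (left_mem_Icc.2 hz.le) (right_mem_Icc.2 hz.le) hz
  simp only [h0] at this
  exact absurd (hP z ⟨hz.le, hzb⟩) (not_le.2 this)

/-- Solutions cannot be continued to the left of the upper branch. -/
lemma not_nonneg_left {g : ℝ → ℝ} {y b : ℝ} (hyb : b < y) (hg : ContinuousOn g (Icc b y))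
    (hP : ∀ x ∈ Icc b y, 0 ≤ c.P x (g x))
    (hode : ∀ x ∈ Ioo b y, x ≠ c.X → HasDerivAt g (c.F x (g x)) x)
    (h0 : c.P y (g y) = 0) (hQ : c.Q y (g y) ≠ 0) : c.Px y (g y) ≤ 0 := by
  by_contra! hPx
  have hv : 0 < c.Px y (g y) + c.Pu y (g y) * c.F y (g y) := by
    rw [F, h0]; simpa using hPx
  obtain ⟨z, hz, hzb, hzA, hz'⟩ := exists_left_nhd hyb hg
    ((eventually_deriv_P hQ).eventually (lt_mem_nhds hv)) c.X
  have hcont : ContinuousOn (fun x => c.P x (g x)) (Icc z y) :=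
    continuous_P.comp_continuousOn (continuousOn_id.prodMk (hg.mono (Icc_subset_Icc_left hzb)))
  have hmono : StrictMonoOn (fun x => c.P x (g x)) (Icc z y) := by
    refine strictMonoOn_of_deriv_pos (convex_Icc _ _) hcont fun x hx => ?_
    rw [interior_Icc] at hx
    rw [(hasDerivAt_P (hode x ⟨hzb.trans_lt hx.1, hx.2⟩ (hzA x hx))).deriv]
    exact hz' x (Ioo_subset_Icc_self hx)
  have := hmono (left_mem_Icc.2 hz.le) (right_mem_Icc.2 hz.le) hz
  simp only [h0] at this
  exact absurd (hP z ⟨hzb, hz.le⟩) (not_le.2 this)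

/-- A local one-sided Lipschitz condition, for the sections to the right of `y`. -/
def OneSided (c : ReducedODE) (y ζ : ℝ) : Prop :=
  ∃ Λ ε : ℝ, 0 < ε ∧ ∀ x u v, y < x → x < y + ε → |u - ζ| < ε → |v - ζ| < ε →
    0 ≤ c.P x u → 0 ≤ c.P x v → (u - v) * (c.F x u - c.F x v) ≤ Λ * (u - v) ^ 2

lemma oneSided_regular {y ζ : ℝ} (hQ : c.Q y ζ ≠ 0) : c.OneSided y ζ := by
  obtain ⟨K, t, ht, hK⟩ := (contDiffAt_F (c := c) (w := (y, ζ)) hQ).exists_lipschitzOnWith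
  obtain ⟨ε, hε, ht⟩ := Metric.mem_nhds_iff.1 ht
  refine ⟨K, ε, hε, fun x u v hx hx' hu hv _ _ => ?_⟩
  have hmem : ∀ u, |u - ζ| < ε → (x, u) ∈ t := fun u hu => ht (by
    rw [Metric.mem_ball, Prod.dist_eq, Real.dist_eq, Real.dist_eq]
    exact max_lt (by rw [abs_lt]; constructor <;> linarith) hu)
  have := hK.dist_le_mul (x, u) (hmem u hu) (x, v) (hmem v hv)
  rw [Prod.dist_eq, dist_self, max_eq_right dist_nonneg, Real.dist_eq, Real.dist_eq] at this
  calc (u - v) * (c.F x u - c.F x v)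
      ≤ |u - v| * |c.F x u - c.F x v| := by rw [← abs_mul]; exact le_abs_self _
    _ ≤ |u - v| * (K * |u - v|) := by gcongr
    _ = K * (u - v) ^ 2 := by rw [← sq_abs (u - v)]; ring

/-- Both numerator and denominator of F degenerate at the singular point, but in u v (P(u) Q(v) -
P(v) Q(u)) every surviving term can be bounded by u - v times P(u) P(v), and the product of the two
denominators is at least (p x)² P(u) P(v). The hypothesis `hm`, that u P decreases at a definite
rate in u, controls the only term lacking this form. -/
lemma F_sub_le {x u v k : ℝ} (hx : c.X < x) (hu : 0 ≤ c.P x u) (hv : 0 ≤ c.P x v)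
    (hbd : c.b < c.d) (huv : v ≤ u) (hu2 : u ≤ 2 * c.X) (hk : 0 < k)
    (hm : u * c.P x u - v * c.P x v ≤ -k * (u - v)) :
    c.F x u - c.F x v ≤ (1 + 8 * c.b * c.X ^ 2 / k) / (c.p * c.X) * (u - v) := by
  have hX := X_pos (c := c)
  have hx0 := hX.trans hx
  have Ru := region_of_right hx hu
  have Rv := region_of_right hx hv
  have hu0 := Ru.u_pos
  have hv0 := Rv.u_pos
  have hQu := Ru.Q_pos fun h => hx.ne' h.1
  have hQv := Rv.Q_pos fun h => hx.ne' h.1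
  have hux : u < x := by
    have := right_sign hx.le hu fun h => hx.ne' h.1
    nlinarith
  set n := x - u with hn
  have hn0 : 0 < n := sub_pos.2 hux
  set η := u - v with hη
  have hη0 : 0 ≤ η := sub_nonneg.2 huv
  set A := u * c.P x u with hA
  set B := v * c.P x v with hB
  have hA0 : 0 ≤ A := mul_nonneg hu0.le hu
  have hB0 : 0 ≤ B := mul_nonneg hv0.le hv
  have hAB : A + k * η ≤ B := by linarith
  have hkη : 0 ≤ k * η := mul_nonneg hk.le hη0
  -- Insert B ≥ A + k η and absorb 2 k n A - (k n)² ≤ A²; what remains is a multiple of η A B.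
  have hcomb : A * (n + η) ^ 2 - B * n ^ 2 ≤ η * (2 * (A * B) / k) := by
    have h1 : k * (A * (n + η) ^ 2 - B * n ^ 2) ≤ η * (2 * (A * B)) := by
      have h2 : B * n ^ 2 ≥ (A + k * η) * n ^ 2 := mul_le_mul_of_nonneg_right hAB (sq_nonneg n)
      have h3 : k * (A * (n + η) ^ 2 - B * n ^ 2) ≤
          η * (2 * k * n * A + A * (k * η) - (k * n) ^ 2) := by nlinarith
      refine h3.trans (mul_le_mul_of_nonneg_left ?_ hη0)
      nlinarith [sq_nonneg (A - k * n), mul_nonneg hA0 (sub_nonneg.2 hAB), mul_nonneg hA0 hkη]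
    rw [mul_div_assoc', le_div_iff₀ hk]; linarith
  have hUQ := mul_Q_eq (c := c) x u
  have hVQ := mul_Q_eq (c := c) x v
  have hPuv : 0 ≤ c.P x u * c.P x v := mul_nonneg hu hv
  have hlow : (c.p * x) ^ 2 * (c.P x u * c.P x v) ≤ (u * c.Q x u) * (v * c.Q x v) := by
    have h1 : c.p * x * c.P x u ≤ u * c.Q x u := by
      rw [hUQ]; linarith [Ru.slack_nonneg]
    have h2 : c.p * x * c.P x v ≤ v * c.Q x v := by
      rw [hVQ]; linarith [Rv.slack_nonneg]
    have := mul_le_mul h1 h2 (mul_nonneg (mul_pos c.p_pos hx0).le hv) (mul_pos hu0 hQu).le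
    calc _ = c.p * x * c.P x u * (c.p * x * c.P x v) := by ring
      _ ≤ _ := this
  set Λ := (1 + 8 * c.b * c.X ^ 2 / k) / (c.p * c.X) with hΛ
  have hΛ0 : 0 ≤ Λ := by
    have := c.b_pos; have := c.p_pos
    positivity
  have hΛ1 : 1 + 2 * c.b * (u * v) / k ≤ Λ * (c.p * x) := by
    have huv4 : u * v ≤ 4 * c.X ^ 2 := by nlinarith
    calc 1 + 2 * c.b * (u * v) / k ≤ 1 + 2 * c.b * (4 * c.X ^ 2) / k := by
          have := c.b_pos; gcongr
      _ = Λ * (c.p * c.X) := by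
          have := c.p_pos.ne'; have := hX.ne'
          rw [hΛ]; field_simp; ring
      _ ≤ Λ * (c.p * x) := by
          have := c.p_pos; gcongr
  have key : u * v * (c.p * (c.P x u * c.Q x v - c.P x v * c.Q x u)) ≤
      u * v * (Λ * η * (c.Q x u * c.Q x v)) := by
    -- By `mul_Q_eq` for u and v, the mixed terms combine because u (n + η) - v n = η x - p-free and
    -- p-weighted parts then add up to P(u) P(v) η x.
    have e1 : u * v * (c.p * (c.P x u * c.Q x v - c.P x v * c.Q x u)) =
        c.p * x * (c.P x u * c.P x v * η + c.b * (A * (n + η) ^ 2 - B * n ^ 2)) := by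
      calc _ = c.p * (u * c.P x u * (v * c.Q x v) - v * c.P x v * (u * c.Q x u)) := by ring
        _ = _ := by rw [hUQ, hVQ, hA, hB, hη, hn]; ring
    have e2 : c.P x u * c.P x v * η + c.b * (A * (n + η) ^ 2 - B * n ^ 2) ≤
        η * (c.P x u * c.P x v) * (1 + 2 * c.b * (u * v) / k) := by
      have := mul_le_mul_of_nonneg_left hcomb c.b_pos.le
      calc _ ≤ c.P x u * c.P x v * η + c.b * (η * (2 * (A * B) / k)) := by linarith
        _ = _ := by rw [hA, hB]; field_simp
    have e3 : η * (c.P x u * c.P x v) * (1 + 2 * c.b * (u * v) / k) ≤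
        η * (c.P x u * c.P x v) * (Λ * (c.p * x)) :=
      mul_le_mul_of_nonneg_left hΛ1 (mul_nonneg hη0 hPuv)
    have hpx : 0 ≤ c.p * x := (mul_pos c.p_pos hx0).le
    have e4 := mul_le_mul_of_nonneg_left (e2.trans e3) hpx
    have e5 := mul_le_mul_of_nonneg_left hlow (mul_nonneg hΛ0 hη0)
    rw [e1]
    refine e4.trans (le_trans (le_of_eq ?_) (e5.trans (le_of_eq ?_)))
    · ring
    · ring
  have key2 := le_of_mul_le_mul_left key (mul_pos hu0 hv0)
  have : c.F x u - c.F x v =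
      c.p * (c.P x u * c.Q x v - c.P x v * c.Q x u) / (c.Q x u * c.Q x v) := by
    unfold F; field_simp [hQu.ne', hQv.ne']
  rw [this, div_le_iff₀ (mul_pos hQu hQv)]
  exact key2

/-- At the singular point, the right-hand side is one-sided Lipschitz if `b < d`. -/
lemma oneSided_singular (hbd : c.b < c.d) : c.OneSided c.X c.X := by
  have hX := X_pos (c := c)
  -- The divided difference of u P at the singular point is -X² (d - b); half of its absolute value
  -- leaves room for a neighbourhood. The function `m` is this divided difference in (x, u, v).
  set k := c.X ^ 2 * (c.d - c.b) / 2 with hk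
  have hk0 : 0 < k := by
    have : 0 < c.d - c.b := sub_pos.2 hbd
    positivity
  set m : ℝ × ℝ × ℝ → ℝ := fun w => -c.d * (w.2.1 ^ 2 + w.2.1 * w.2.2 + w.2.2 ^ 2) +
    2 * (c.mu * w.1 + 1) * (w.2.1 + w.2.2) - c.b * w.1 ^ 2 with hm
  have hmc : Continuous m := by rw [hm]; fun_prop
  have hmX : m (c.X, c.X, c.X) < -k := by
    have h1 : c.mu * c.X + 1 = c.X * (c.b + c.d) / 2 := by
      have := e_mul_X (c := c)
      unfold e at this
      linarith
    have : m (c.X, c.X, c.X) = -(c.X ^ 2 * (c.d - c.b)) := by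
      simp only [hm, h1]; ring
    rw [this]; linarith
  obtain ⟨ε, hε, hball⟩ := Metric.eventually_nhds_iff.1
    (hmc.continuousAt.eventually (gt_mem_nhds hmX))
  have main : ∀ x u v, c.X < x → x < c.X + min ε c.X → |u - c.X| < min ε c.X →
      |v - c.X| < min ε c.X → 0 ≤ c.P x u → 0 ≤ c.P x v → v ≤ u → c.F x u - c.F x v ≤
        (1 + 8 * c.b * c.X ^ 2 / k) / (c.p * c.X) * (u - v) := by
    intro x u v hx hx' hu hv hPu hPv huv
    have h1 := hu.trans_le (min_le_right _ _)
    refine F_sub_le hx hPu hPv hbd huv (by linarith [(abs_lt.1 h1).2]) hk0 ?_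
    have h2 : m (x, u, v) < -k := by
      refine hball ?_
      rw [Prod.dist_eq, Prod.dist_eq, Real.dist_eq, Real.dist_eq, Real.dist_eq]
      refine max_lt ?_ (max_lt (hu.trans_le (min_le_left _ _)) (hv.trans_le (min_le_left _ _)))
      have := min_le_left ε c.X
      rw [abs_lt]; constructor <;> linarith
    have h3 : u * c.P x u - v * c.P x v = m (x, u, v) * (u - v) := by
      simp only [hm, P]; ring
    rw [h3]
    exact mul_le_mul_of_nonneg_right h2.le (sub_nonneg.2 huv)
  refine ⟨(1 + 8 * c.b * c.X ^ 2 / k) / (c.p * c.X), min ε c.X, lt_min hε hX, fun x u v hx hx' hu hv hPu hPv => ?_⟩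
  rcases le_total v u with h | h
  · have := mul_le_mul_of_nonneg_left (main x u v hx hx' hu hv hPu hPv h) (sub_nonneg.2 h)
    calc _ ≤ _ := this
      _ = _ := by ring
  · have := mul_le_mul_of_nonneg_left (main x v u hx hx' hv hu hPv hPu h) (sub_nonneg.2 h)
    calc _ = (v - u) * (c.F x v - c.F x u) := by ring
      _ ≤ _ := this
      _ = _ := by ring

/-- Local uniqueness to the right. -/
lemma eventually_eq_right {f g : ℝ → ℝ} {y b : ℝ} (hyb : y < b) (hf : ContinuousOn f (Icc y b))
    (hg : ContinuousOn g (Icc y b)) (hPf : ∀ x ∈ Icc y b, 0 ≤ c.P x (f x))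
    (hPg : ∀ x ∈ Icc y b, 0 ≤ c.P x (g x))
    (hof : ∀ x ∈ Ioo y b, x ≠ c.X → HasDerivAt f (c.F x (f x)) x)
    (hog : ∀ x ∈ Ioo y b, x ≠ c.X → HasDerivAt g (c.F x (g x)) x)
    (h0 : f y = g y) (hos : c.OneSided y (g y)) : ∀ᶠ x in 𝓝[>] y, f x = g x := by
  obtain ⟨Λ, ε, hε, hos⟩ := hos
  have hnear : ∀ ζ, ∀ᶠ w : ℝ × ℝ in 𝓝 (y, ζ), |w.1 - y| < ε ∧ |w.2 - ζ| < ε := fun ζ => by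
    rw [Metric.eventually_nhds_iff]
    refine ⟨ε, hε, fun w hw => ?_⟩
    rw [Prod.dist_eq, Real.dist_eq, Real.dist_eq] at hw
    exact ⟨(le_max_left _ _).trans_lt hw, (le_max_right _ _).trans_lt hw⟩
  obtain ⟨z₁, h11, h12, h13, h14⟩ := exists_right_nhd hyb hf (hnear (f y)) c.X
  obtain ⟨z₂, h21, h22, h23, h24⟩ := exists_right_nhd hyb hg (hnear (g y)) c.X
  set z := min z₁ z₂ with hz
  have hyz : y < z := lt_min h11 h21
  have hzb : z ≤ b := (min_le_left _ _).trans h12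
  have hz1 : ∀ x ∈ Ioo y z, x ≠ c.X := fun x hx => h13 x ⟨hx.1, hx.2.trans_le (min_le_left _ _)⟩
  have := eq_zero_of_mul_deriv_le (h := fun x => f x - g x)
    (h' := fun x => c.F x (f x) - c.F x (g x)) (a := y) (b := z) (Λ := Λ)
    ((hf.sub hg).mono (Icc_subset_Icc_right hzb))
    (fun x hx => (hof x ⟨hx.1, hx.2.trans_le hzb⟩ (hz1 x hx)).sub
      (hog x ⟨hx.1, hx.2.trans_le hzb⟩ (hz1 x hx))) (sub_eq_zero.2 h0)
    (fun x hx => by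
      have a1 := h14 x ⟨hx.1.le, hx.2.le.trans (min_le_left _ _)⟩
      have a2 := h24 x ⟨hx.1.le, hx.2.le.trans (min_le_right _ _)⟩
      have a3 := (abs_lt.1 a1.1).2
      rw [h0] at a1
      exact hos x (f x) (g x) hx.1 (by linarith) a1.2 a2.2
        (hPf x ⟨hx.1.le, hx.2.le.trans hzb⟩) (hPg x ⟨hx.1.le, hx.2.le.trans hzb⟩))
  filter_upwards [Ioo_mem_nhdsGT hyz] with x hx
  exact sub_eq_zero.1 (this x (Ioo_subset_Icc_self hx))

end ReducedODE
end

/-! ### Behaviour at the singular point and uniqueness of arcs -/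

noncomputable section

/-- Cut the interval at the exceptional point and join the two pieces by continuity. -/
lemma monotoneOn_Icc_of_hasDerivAt_off {f f' : ℝ → ℝ} {a b A : ℝ} (hc : ContinuousOn f (Icc a b))
    (hd : ∀ x ∈ Ioo a b, x ≠ A → HasDerivAt f (f' x) x) (hn : ∀ x ∈ Ioo a b, x ≠ A → 0 ≤ f' x) :
    MonotoneOn f (Icc a b) := by
  have key : ∀ a' b', Icc a' b' ⊆ Icc a b → A ∉ Ioo a' b' → MonotoneOn f (Icc a' b') := by
    intro a' b' hsub hA
    have hI : Ioo a' b' ⊆ Ioo a b := by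
      have := interior_mono hsub
      rwa [interior_Icc, interior_Icc] at this
    refine monotoneOn_of_deriv_nonneg (convex_Icc _ _) (hc.mono hsub) ?_ ?_ <;> rw [interior_Icc]
    · exact fun x hx => (hd x (hI hx) fun h => hA (h ▸ hx)).differentiableAt.differentiableWithinAt
    · intro x hx
      rw [(hd x (hI hx) fun h => hA (h ▸ hx)).deriv]
      exact hn x (hI hx) fun h => hA (h ▸ hx)
  by_cases hA : A ∈ Ioo a b
  · have h1 := key a A (Icc_subset_Icc_right hA.2.le) (fun h => lt_irrefl _ h.2)
    have h2 := key A b (Icc_subset_Icc_left hA.1.le) (fun h => lt_irrefl _ h.1)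
    have := h1.union_right h2 (isGreatest_Icc hA.1.le) (isLeast_Icc hA.2.le)
    rwa [Icc_union_Icc_eq_Icc hA.1.le hA.2.le] at this
  · exact key a b subset_rfl hA

namespace ReducedODE

variable {c : ReducedODE}

/-- F - 1 = ((u - x) P - b x (u - x)²) / (u Q). The first term is nonnegative, and u Q ≥ p x P ≥ p x
k (u - x) cancels one factor u - x of the second. -/
lemma Region.neg_mul_le_F_sub_one {x u k : ℝ} (h : c.Region x u) (hx : x < c.X) (hk : 0 < k)
    (hP : k * (u - x) ≤ c.P x u) : -(c.b / (c.p * k)) * (u - x) ≤ c.F x u - 1 := by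
  have hu := h.u_pos
  have hV : 0 < u - x := sub_pos.2 (h.lt_of_lt hx)
  have hQ := h.Q_pos fun h' => hx.ne h'.1
  have huQ := mul_Q_eq (c := c) x u
  have hp := c.p_pos
  have ha := one_sub_p_pos (c := c)
  have hPpos := h.nonneg
  have h1 : c.F x u - 1 = (c.p * c.P x u * u - u * c.Q x u) / (u * c.Q x u) := by
    unfold F; field_simp [hQ.ne', hu.ne']
  rw [h1, le_div_iff₀ (mul_pos hu hQ)]
  have h2 : c.p * x * (k * (u - x)) ≤ u * c.Q x u := by
    rw [huQ]
    have := h.slack_nonneg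
    have := mul_le_mul_of_nonneg_left hP (mul_pos hp h.pos).le
    linarith
  have h3 : c.b / (c.p * k) * (u - x) * (c.p * x * (k * (u - x))) ≤
      c.b / (c.p * k) * (u - x) * (u * c.Q x u) := by
    refine mul_le_mul_of_nonneg_left h2 (mul_nonneg ?_ hV.le)
    exact (div_pos c.b_pos (mul_pos hp hk)).le
  have h4 : c.b / (c.p * k) * (u - x) * (c.p * x * (k * (u - x))) = c.b * x * (u - x) ^ 2 := by
    field_simp
  have h5 : c.p * c.P x u * u - u * c.Q x u =
      (u - x) * c.P x u - c.b * x * (u - x) ^ 2 := by rw [huQ]; ring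
  have h6 : 0 ≤ (u - x) * c.P x u := mul_nonneg hV.le hPpos
  rw [h5]; linarith

/-- If `d < b`, solutions coming from the left avoid the singular point. -/
lemma ne_X_of_region (hdb : c.d < c.b) {g : ℝ → ℝ} {y : ℝ} (hy : y < c.X)
    (hg : ContinuousOn g (Icc y c.X)) (hR : ∀ x ∈ Icc y c.X, c.Region x (g x))
    (hode : ∀ x ∈ Ioo y c.X, HasDerivAt g (c.F x (g x)) x) : g c.X ≠ c.X := by
  intro hgX
  have hX := X_pos (c := c)
  -- At the singular point `Px` equals -2k.
  set k := c.X * (c.b - c.mu) with hk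
  have hk0 : 0 < k := mul_pos hX (sub_pos.2 (mu_lt_b hdb))
  have hp1 : ∀ᶠ w : ℝ × ℝ in 𝓝 (c.X, g c.X), c.Px w.1 w.2 + k < 0 := by
    have hcont : Continuous fun w : ℝ × ℝ => c.Px w.1 w.2 + k := by unfold Px; fun_prop
    refine hcont.continuousAt.eventually (gt_mem_nhds ?_)
    simp only [hgX, Px]; linarith
  -- The derivative of P - k (g - x) is affine in F, and F lies between 0 and g / x. It is negative
  -- at both ends: at the singular point the values are -k and -2.
  have hp2 : ∀ᶠ w : ℝ × ℝ in 𝓝 (c.X, g c.X),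
      c.Px w.1 w.2 + k + (c.Pu w.1 w.2 - k) * (w.2 / w.1) < 0 := by
    have hcont : ContinuousAt (fun w : ℝ × ℝ =>
        c.Px w.1 w.2 + k + (c.Pu w.1 w.2 - k) * (w.2 / w.1)) (c.X, g c.X) := by
      have : ContinuousAt (fun w : ℝ × ℝ => w.2 / w.1) (c.X, g c.X) :=
        continuousAt_snd.div continuousAt_fst hX.ne'
      have h1 : ContinuousAt (fun w : ℝ × ℝ => c.Px w.1 w.2 + k) (c.X, g c.X) := by
        unfold Px; fun_prop
      have h2 : ContinuousAt (fun w : ℝ × ℝ => c.Pu w.1 w.2 - k) (c.X, g c.X) := by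
        unfold Pu; fun_prop
      exact h1.add (h2.mul this)
    refine hcont.eventually (gt_mem_nhds ?_)
    have he := e_mul_X (c := c)
    unfold e at he
    simp only [hgX, Px, Pu, div_self hX.ne']
    nlinarith
  obtain ⟨z, hzX, hyz, -, hz⟩ := exists_left_nhd hy hg (hp1.and hp2) c.X
  have hsub : Icc z c.X ⊆ Icc y c.X := Icc_subset_Icc_left hyz
  have hode' : ∀ x ∈ Ioo z c.X, HasDerivAt g (c.F x (g x)) x := fun x hx =>
    hode x ⟨hyz.trans_lt hx.1, hx.2⟩
  have hanti : AntitoneOn (fun x => c.P x (g x) - k * (g x - x)) (Icc z c.X) := by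
    have hder : ∀ x ∈ Ioo z c.X, HasDerivAt (fun x => c.P x (g x) - k * (g x - x))
        (c.Px x (g x) + c.Pu x (g x) * c.F x (g x) - k * (c.F x (g x) - 1)) x := fun x hx =>
      (hasDerivAt_P (hode' x hx)).sub (((hode' x hx).sub (hasDerivAt_id x)).const_mul k)
    refine antitoneOn_of_deriv_nonpos (convex_Icc _ _) ?_ ?_ ?_
    · refine ContinuousOn.sub ?_ (((hg.mono hsub).sub continuousOn_id).const_smul k)
      exact continuous_P.comp_continuousOn (continuousOn_id.prodMk (hg.mono hsub))
    · rw [interior_Icc]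
      exact fun x hx => (hder x hx).differentiableAt.differentiableWithinAt
    · rw [interior_Icc]
      intro x hx
      rw [(hder x hx).deriv]
      have hRx := hR x (hsub (Ioo_subset_Icc_self hx))
      obtain ⟨h1, h2⟩ := hz x (Ioo_subset_Icc_self hx)
      simp only at h1 h2
      have hF0 := hRx.F_nonneg
      have hF1 : c.F x (g x) ≤ g x / x := by
        rw [le_div_iff₀ hRx.pos, mul_comm]; exact hRx.x_mul_F_le
      rcases le_total (c.Pu x (g x) - k) 0 with h | h
      · nlinarith
      · nlinarith [mul_le_mul_of_nonneg_left hF1 h]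
  have hPV : ∀ x ∈ Icc z c.X, k * (g x - x) ≤ c.P x (g x) := fun x hx => by
    have := hanti hx (right_mem_Icc.2 hzX.le) hx.2
    simp only [hgX, P_X] at this
    linarith
  -- Now g' - 1 ≥ -C (g - x), so (g - x) exp(C x) cannot decrease; it is positive left of X and
  -- would have to vanish at X.
  set C := c.b / (c.p * k) with hC
  have hder : ∀ x ∈ Ioo z c.X, HasDerivAt (fun x => (g x - x) * Real.exp (C * x))
      ((c.F x (g x) - 1) * Real.exp (C * x) + (g x - x) * (Real.exp (C * x) * C)) x :=
    fun x hx => ((hode' x hx).sub (hasDerivAt_id x)).mul (by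
      simpa using ((hasDerivAt_id x).const_mul C).exp)
  have hmono : MonotoneOn (fun x => (g x - x) * Real.exp (C * x)) (Icc z c.X) := by
    refine monotoneOn_of_deriv_nonneg (convex_Icc _ _) ?_ ?_ ?_
    · exact ((hg.mono hsub).sub continuousOn_id).mul (by fun_prop)
    · rw [interior_Icc]
      exact fun x hx => (hder x hx).differentiableAt.differentiableWithinAt
    · rw [interior_Icc]
      intro x hx
      rw [(hder x hx).deriv]
      have := (hR x (hsub (Ioo_subset_Icc_self hx))).neg_mul_le_F_sub_one hx.2 hk0
        (hPV x (Ioo_subset_Icc_self hx))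
      have h2 : 0 ≤ (c.F x (g x) - 1 + C * (g x - x)) * Real.exp (C * x) :=
        mul_nonneg (by rw [hC]; linarith) (Real.exp_pos _).le
      linarith
  have h1 := hmono (left_mem_Icc.2 hzX.le) (right_mem_Icc.2 hzX.le) hzX.le
  simp only [hgX, sub_self, zero_mul] at h1
  have h2 := (hR z ⟨hyz, hzX.le⟩).lt_of_lt hzX
  have := mul_pos (sub_pos.2 h2) (Real.exp_pos (C * z))
  linarith

/-- If `b < d`, solutions coming from the left pass through the singular point. -/
lemma eq_X_of_region (hbd : c.b < c.d) {u : ℝ} (hR : c.Region c.X u) : u = c.X := by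
  refine le_antisymm ?_ (hR.left le_rfl).1
  rw [← up_X_of_lt hbd]
  have := hR.le_up
  exact this

namespace Arc

variable {α β : ℝ} {g : ℝ → ℝ}

lemma cont' (h : c.Arc α β g) {x y : ℝ} (hx : α ≤ x) (hy : y ≤ β) : ContinuousOn g (Icc x y) :=
  h.cont.mono (Icc_subset_Icc hx hy)

lemma ne_X (h : c.Arc α β g) (hdb : c.d < c.b) {x : ℝ} (hx : x ∈ Icc α β) :
    ¬ (x = c.X ∧ g x = c.X) := by
  rintro ⟨rfl, hg⟩
  rcases hx.1.lt_or_eq with h1 | h1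
  · exact ne_X_of_region hdb h1 (h.cont' le_rfl hx.2)
      (fun y hy => h.region y ⟨hy.1, hy.2.trans hx.2⟩)
      (fun y hy => h.ode y ⟨hy.1, hy.2.trans_le hx.2⟩ hy.2.ne) hg
  · have h2 := h.start
    rw [h1, hg] at h2
    have := dn_lt_up (c := c) (X_pos (c := c)).le
    rw [dn_X_of_lt hdb] at this
    linarith

/-- Left of X the lower branch lies below the diagonal and the region above it. Ending over X itself
would require `c.dn c.X = c.X`: this makes the branches meet if b < d and is excluded by `ne_X` if d
< b. -/
lemma X_lt (h : c.Arc α β g) : c.X < β := by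
  have hβ := h.region β (right_mem_Icc.2 h.lt.le)
  by_contra! hle
  obtain ⟨h1, -⟩ := hβ.left hle
  rw [h.terminal] at h1
  rcases hle.lt_or_eq with h2 | h2
  · exact absurd (dn_lt hβ.pos h2) (not_lt.2 h1)
  · rw [h2] at h1
    have h3 : c.dn c.X = c.X := le_antisymm dn_X_le h1
    rcases lt_or_gt_of_ne (b_ne_d (c := c)) with h4 | h4
    · have := dn_lt_up (c := c) (X_pos (c := c)).le
      rw [h3, up_X_of_lt h4] at this
      exact lt_irrefl _ this
    · exact h.ne_X h4 (right_mem_Icc.2 h.lt.le) ⟨h2, by rw [h.terminal, h2, h3]⟩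

lemma oneSided (h : c.Arc α β g) {y : ℝ} (hy : y ∈ Icc α β) : c.OneSided y (g y) := by
  by_cases hne : y = c.X ∧ g y = c.X
  · rcases lt_or_gt_of_ne (b_ne_d (c := c)) with h4 | h4
    · rw [hne.2, hne.1]; exact oneSided_singular h4
    · exact absurd hne (h.ne_X h4 hy)
  · exact oneSided_regular ((h.region y hy).Q_pos hne).ne'

lemma monotoneOn (h : c.Arc α β g) : MonotoneOn g (Icc α β) :=
  monotoneOn_Icc_of_hasDerivAt_off h.cont h.ode fun x hx _ =>
    (h.region x (Ioo_subset_Icc_self hx)).F_nonneg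

lemma div_antitoneOn (h : c.Arc α β g) : AntitoneOn (fun x => g x / x) (Icc α β) := by
  have hx0 : ∀ x ∈ Icc α β, x ≠ 0 := fun x hx => (h.pos.trans_le hx.1).ne'
  have : MonotoneOn (fun x => -(g x / x)) (Icc α β) := by
    refine monotoneOn_Icc_of_hasDerivAt_off (f' := fun x => -((c.F x (g x) * x - g x * 1) / x ^ 2))
      (A := c.X) (h.cont.div continuousOn_id hx0).neg
      (fun x hx hne => ((h.ode x hx hne).div (hasDerivAt_id x)
        (hx0 x (Ioo_subset_Icc_self hx))).neg) fun x hx _ => ?_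
    have hR := h.region x (Ioo_subset_Icc_self hx)
    rw [neg_nonneg]
    refine div_nonpos_of_nonpos_of_nonneg ?_ (sq_nonneg x)
    have := hR.x_mul_F_le
    linarith
  exact fun x hx y hy hxy => neg_le_neg_iff.1 (this hx hy hxy)

end Arc

/-- Uniqueness to the right of the starting point. -/
lemma Inner.right {α β : ℝ} {g f : ℝ → ℝ} {D : Set ℝ} (h : c.Arc α β g) (hf : c.Inner D f)
    (hα : α ∈ D) (h0 : f α = g α) {x : ℝ} (hx : x ∈ D) (hαx : α ≤ x) : x ≤ β ∧ f x = g x := by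
  have hsub : Icc α x ⊆ D := hf.interval.out hα hx
  have hode : ∀ y ∈ Ioo α x, y ≠ c.X → HasDerivAt f (c.F y (f y)) y := fun y hy hne =>
    (hf.ode y (mem_interior.2 ⟨Ioo α x, Ioo_subset_Icc_self.trans hsub, isOpen_Ioo, hy⟩) hne).2
  have heq : ∀ y ∈ Icc α (min x β), f y = g y := by
    have hs1 : Icc α (min x β) ⊆ Icc α x := Icc_subset_Icc_right (min_le_left _ _)
    have hs2 : Icc α (min x β) ⊆ Icc α β := Icc_subset_Icc_right (min_le_right _ _)
    refine eqOn_Icc_of_forall_extend (hf.cont.mono (hs1.trans hsub)) (h.cont.mono hs2) h0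
      fun y hy hyeq => ?_
    have hys : Icc y (min x β) ⊆ Icc α (min x β) := Icc_subset_Icc_left hy.1
    have hyo : Ioo y (min x β) ⊆ Ioo α x := fun z hz =>
      ⟨hy.1.trans_lt hz.1, hz.2.trans_le (min_le_left _ _)⟩
    have hyo' : Ioo y (min x β) ⊆ Ioo α β := fun z hz =>
      ⟨hy.1.trans_lt hz.1, hz.2.trans_le (min_le_right _ _)⟩
    exact eventually_eq_right hy.2 (hf.cont.mono ((hys.trans hs1).trans hsub))
      (h.cont.mono (hys.trans hs2)) (fun z hz => hf.nonneg z (hsub (hs1 (hys hz))))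
      (fun z hz => (h.region z (hs2 (hys hz))).nonneg)
      (fun z hz => hode z (hyo hz)) (fun z hz => h.ode z (hyo' hz))
      (hyeq y (right_mem_Icc.2 hy.1)) (h.oneSided ⟨hy.1, hy.2.le.trans (min_le_right _ _)⟩)
  -- Past β the solution would continue with P ≥ 0 from a point of the lower branch, where P has a
  -- strictly negative derivative.
  have hxβ : x ≤ β := by
    by_contra! hlt
    have hfβ : f β = c.dn β := by
      rw [heq β ⟨h.lt.le, by rw [min_eq_right hlt.le]⟩, h.terminal]
    have hβ0 : 0 < β := h.pos.trans h.lt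
    have hsβ : Icc β x ⊆ Icc α x := Icc_subset_Icc_left h.lt.le
    have hQ : c.Q β (f β) ≠ 0 := by
      have := (h.region β (right_mem_Icc.2 h.lt.le)).Q_pos fun h' => h.X_lt.ne' h'.1
      rw [hfβ, ← h.terminal]; exact this.ne'
    have := not_nonneg_right hlt (hf.cont.mono (hsβ.trans hsub))
      (fun y hy => hf.nonneg y (hsub (hsβ hy)))
      (fun y hy => hode y ⟨h.lt.trans hy.1, hy.2⟩)
      (by rw [hfβ]; exact P_dn hβ0.le) hQ
    rw [hfβ] at this
    exact absurd (Px_dn_neg (c := c) hβ0) (not_lt.2 this)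
  exact ⟨hxβ, heq x ⟨hαx, by rw [min_eq_left hxβ]⟩⟩

/-- There is nothing to the left of a regular starting point. -/
lemma Inner.left {α : ℝ} {f : ℝ → ℝ} {D : Set ℝ} (hf : c.Inner D f) (hα : α ∈ D)
    (h0 : f α = c.up α) (hne : ¬ (α = c.X ∧ c.up α = c.X)) {x : ℝ} (hx : x ∈ D) : α ≤ x := by
  by_contra! hlt
  have hα0 : 0 < α := hf.pos hα
  have hsub : Icc x α ⊆ D := hf.interval.out hx hα
  have hQ : c.Q α (f α) ≠ 0 := by
    rw [h0]; exact ((region_up hα0).Q_pos hne).ne'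
  have := not_nonneg_left hlt (hf.cont.mono hsub) (fun y hy => hf.nonneg y (hsub hy))
    (fun y hy hneX => (hf.ode y (mem_interior.2
      ⟨Ioo x α, Ioo_subset_Icc_self.trans hsub, isOpen_Ioo, hy⟩) hneX).2)
    (by rw [h0]; exact P_up hα0.le) hQ
  rw [h0] at this
  exact absurd (Px_up_pos (c := c) hα0) (not_lt.2 this)

lemma Arc.unique {α β β' : ℝ} {g g' : ℝ → ℝ} (h : c.Arc α β g) (h' : c.Arc α β' g') :
    β' = β ∧ EqOn g' g (Icc α β) := by
  have h1 := (Inner.right h h'.inner (left_mem_Icc.2 h'.lt.le) (h'.start.trans h.start.symm)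
    (right_mem_Icc.2 h'.lt.le) h'.lt.le).1
  have h2 := (Inner.right h' h.inner (left_mem_Icc.2 h.lt.le) (h.start.trans h'.start.symm)
    (right_mem_Icc.2 h.lt.le) h.lt.le).1
  have h3 : β' = β := le_antisymm h1 h2
  subst h3
  exact ⟨rfl, fun x hx => (Inner.right h h'.inner (left_mem_Icc.2 h'.lt.le)
    (h'.start.trans h.start.symm) hx hx.1).2⟩

end ReducedODE
end

/-! ### Ordering of arcs and limits in the starting point -/

noncomputable section

/-- The two monotonicities give 0 ≤ f y - f x ≤ (f x / x)(y - x), hence a Lipschitz bound. Both pass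
to pointwise limits, which is how limits of arcs are seen to be continuous. -/
lemma continuousOn_of_monotoneOn_of_div_antitoneOn {f : ℝ → ℝ} {a b : ℝ} (ha : 0 < a)
    (hf : ∀ x ∈ Icc a b, ∀ y ∈ Icc a b, x ≤ y → f x ≤ f y ∧ f y / y ≤ f x / x) :
    ContinuousOn f (Icc a b) := by
  rcases lt_or_ge b a with hab | hab
  · simp [Icc_eq_empty_of_lt hab]
  have ha' : a ∈ Icc a b := left_mem_Icc.2 hab
  have key : ∀ x ∈ Icc a b, ∀ y ∈ Icc a b, x ≤ y → |f x - f y| ≤ |f a / a| * |x - y| := by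
    intro x hx y hy hxy
    have hx0 : 0 < x := ha.trans_le hx.1
    have hy0 : 0 < y := ha.trans_le hy.1
    obtain ⟨h1, h2⟩ := hf x hx y hy hxy
    have h3 := (hf a ha' x hx hx.1).2
    rw [abs_sub_comm (f x), abs_of_nonneg (sub_nonneg.2 h1), abs_sub_comm x,
      abs_of_nonneg (sub_nonneg.2 hxy)]
    have h4 : f y = f y / y * y := by field_simp
    have h5 : f x = f x / x * x := by field_simp
    have h6 : f y - f x ≤ f x / x * (y - x) := by
      nlinarith [mul_le_mul_of_nonneg_right h2 hy0.le]
    have h7 : f x / x * (y - x) ≤ f a / a * (y - x) :=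
      mul_le_mul_of_nonneg_right h3 (sub_nonneg.2 hxy)
    have h8 := mul_le_mul_of_nonneg_right (le_abs_self (f a / a)) (sub_nonneg.2 hxy)
    linarith
  have : LipschitzOnWith (Real.toNNReal |f a / a|) f (Icc a b) := by
    refine LipschitzOnWith.of_dist_le_mul fun x hx y hy => ?_
    rw [Real.dist_eq, Real.dist_eq, Real.coe_toNNReal _ (abs_nonneg _)]
    rcases le_total x y with h | h
    · exact key x hx y hy h
    · rw [abs_sub_comm, abs_sub_comm x y]
      exact key y hy x hx h
  exact this.continuousOn

namespace ReducedODE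

variable {c : ReducedODE}

namespace Arc

variable {α β : ℝ} {g : ℝ → ℝ}

/-- Solutions do not touch the lower branch before the end. -/
lemma dn_lt_of_lt (h : c.Arc α β g) {x : ℝ} (hx : c.X < x) (hα : α ≤ x) (hβ : x < β) :
    c.dn x < g x := by
  have hR := h.region x ⟨hα, hβ.le⟩
  refine lt_of_le_of_ne hR.dn_le fun heq => ?_
  have := not_nonneg_right hβ (h.cont' hα le_rfl)
    (fun y hy => (h.region y ⟨hα.trans hy.1, hy.2⟩).nonneg)
    (fun y hy hne => h.ode y ⟨hα.trans_lt hy.1, hy.2⟩ hne)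
    (by rw [← heq]; exact P_dn hR.pos.le) (hR.Q_pos fun h' => hx.ne' h'.1).ne'
  rw [← heq] at this
  exact absurd (Px_dn_neg (c := c) hR.pos) (not_lt.2 this)

/-- At α₂ the second arc is on the upper branch, hence not below the first. To cross they would
first have to meet, and after meeting they coincide by uniqueness to the right. -/
lemma le_of_le {α₁ α₂ β₁ β₂ : ℝ} {g₁ g₂ : ℝ → ℝ} (h₁ : c.Arc α₁ β₁ g₁) (h₂ : c.Arc α₂ β₂ g₂)
    (hα : α₁ ≤ α₂) {x : ℝ} (hx : α₂ ≤ x) (hx₁ : x ≤ β₁) (hx₂ : x ≤ β₂) : g₁ x ≤ g₂ x := by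
  have hc₁ : ContinuousOn g₁ (Icc α₂ x) := h₁.cont' hα hx₁
  have hc₂ : ContinuousOn g₂ (Icc α₂ x) := h₂.cont' le_rfl hx₂
  obtain ⟨b, hb, hbK, hbex⟩ := exists_exit_time (K := {w : ℝ × ℝ | 0 ≤ w.2})
    (isClosed_le continuous_const continuous_snd) hx (hc₂.sub hc₁) (by
      have := (h₁.region α₂ ⟨hα, hx.trans hx₁⟩).le_up
      change 0 ≤ g₂ α₂ - g₁ α₂
      rw [h₂.start]; linarith)
  have hby : 0 ≤ g₂ b - g₁ b := hbK b (right_mem_Icc.2 hb.1)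
  rcases hb.2.lt_or_eq with hlt | heq
  · refine absurd ?_ (hbex hlt)
    rcases hby.lt_or_eq with h0 | h0
    · obtain ⟨z, hz, -, -, hz'⟩ := exists_right_nhd (g := fun x => g₂ x - g₁ x)
        (p := fun w => 0 ≤ w.2) hlt ((hc₂.sub hc₁).mono (Icc_subset_Icc_left hb.1)) (by
        have : Continuous fun w : ℝ × ℝ => w.2 := continuous_snd
        exact (this.continuousAt.eventually (lt_mem_nhds h0)).mono fun w hw => hw.le) 0
      filter_upwards [Ioo_mem_nhdsGT hz] with y hy using hz' y (Ioo_subset_Icc_self hy)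
    · have hs : Icc b x ⊆ Icc α₂ x := Icc_subset_Icc_left hb.1
      have := eventually_eq_right (c := c) hlt (hc₂.mono hs) (hc₁.mono hs)
        (fun y hy => (h₂.region y ⟨hb.1.trans hy.1, hy.2.trans hx₂⟩).nonneg)
        (fun y hy => (h₁.region y ⟨hα.trans (hb.1.trans hy.1), hy.2.trans hx₁⟩).nonneg)
        (fun y hy => h₂.ode y ⟨hb.1.trans_lt hy.1, hy.2.trans_le hx₂⟩)
        (fun y hy => h₁.ode y ⟨hα.trans_lt (hb.1.trans_lt hy.1), hy.2.trans_le hx₁⟩)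
        (sub_eq_zero.1 h0.symm) (h₁.oneSided ⟨hα.trans hb.1, hb.2.trans hx₁⟩)
      filter_upwards [this] with y hy
      simp [hy]
  · rw [heq] at hby
    linarith

/-- At β₂ the ordering puts the first arc on or below the lower branch, which it cannot touch before
its own end. -/
lemma end_le_end {α₁ α₂ β₁ β₂ : ℝ} {g₁ g₂ : ℝ → ℝ} (h₁ : c.Arc α₁ β₁ g₁) (h₂ : c.Arc α₂ β₂ g₂)
    (hα : α₁ ≤ α₂) : β₁ ≤ β₂ := by
  by_contra! hlt
  have h3 := h₁.le_of_le h₂ hα h₂.lt.le hlt.le le_rfl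
  have h4 := h₁.dn_lt_of_lt h₂.X_lt (hα.trans h₂.lt.le) hlt
  rw [h₂.terminal] at h3
  linarith

end Arc

/-- From x F ≤ u ≤ `c.up x`. The bound does not depend on u and so serves as dominating function for
families of arcs. -/
lemma Region.F_le {x u x₁ x₂ : ℝ} (h : c.Region x u) (h1 : 0 < x₁) (hx1 : x₁ ≤ x) (hx2 : x ≤ x₂) :
    ‖c.F x u‖ ≤ c.up x₂ / x₁ := by
  rw [Real.norm_of_nonneg h.F_nonneg, le_div_iff₀ h1]
  have h2 := h.F_nonneg
  calc c.F x u * x₁ ≤ c.F x u * x := by gcongr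
    _ ≤ u := by rw [mul_comm]; exact h.x_mul_F_le
    _ ≤ c.up x := h.le_up
    _ ≤ c.up x₂ := up_le_up h.pos hx2

lemma continuousOn_F {f : ℝ → ℝ} {s : Set ℝ} (hf : ContinuousOn f s)
    (hR : ∀ x ∈ s, c.Region x (f x)) (hX : c.X ∉ s) :
    ContinuousOn (fun x => c.F x (f x)) s := fun x hx => by
  have hQ := ((hR x hx).Q_pos fun h => hX (h.1 ▸ hx)).ne'
  exact ContinuousAt.comp_continuousWithinAt (f := fun x => (x, f x))
    (continuousAt_F (c := c) (w := (x, f x)) hQ) (continuousWithinAt_id.prodMk (hf x hx))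

lemma tendsto_F {ι : Type*} {l : Filter ι} {G : ι → ℝ} {x u : ℝ} (hQ : c.Q x u ≠ 0)
    (h : Tendsto G l (𝓝 u)) : Tendsto (fun i => c.F x (G i)) l (𝓝 (c.F x u)) := by
  have h2 := continuousAt_F (c := c) (w := (x, u)) hQ
  have h3 : ContinuousAt (fun v : ℝ => c.F x v) u :=
    ContinuousAt.comp (f := fun v : ℝ => (x, v)) h2 (by fun_prop)
  exact h3.tendsto.comp h

/-- Pointwise limits of solutions are solutions. -/
lemma hasDerivAt_of_tendsto {ι : Type*} {l : Filter ι} [l.NeBot] [l.IsCountablyGenerated]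
    {G : ι → ℝ → ℝ} {f : ℝ → ℝ} {x₁ x₂ : ℝ} (hx₁ : 0 < x₁) (hX : c.X ∉ Icc x₁ x₂)
    (hG : ∀ᶠ i in l, ContinuousOn (G i) (Icc x₁ x₂) ∧ (∀ x ∈ Icc x₁ x₂, c.Region x (G i x)) ∧
      ∀ x ∈ Ioo x₁ x₂, HasDerivAt (G i) (c.F x (G i x)) x)
    (hlim : ∀ x ∈ Icc x₁ x₂, Tendsto (fun i => G i x) l (𝓝 (f x)))
    (hfc : ContinuousOn f (Icc x₁ x₂)) (hfR : ∀ x ∈ Icc x₁ x₂, c.Region x (f x)) :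
    ∀ x ∈ Ioo x₁ x₂, HasDerivAt f (c.F x (f x)) x := by
  have hFc := continuousOn_F hfc hfR hX
  -- The equation is passed to the limit in integrated form, by dominated convergence, and
  -- differentiated again afterwards.
  have hint : ∀ x ∈ Icc x₁ x₂, f x = f x₁ + ∫ s in x₁..x, c.F s (f s) := by
    intro x hx
    have hsub : Icc x₁ x ⊆ Icc x₁ x₂ := Icc_subset_Icc_right hx.2
    have hsub' : uIoc x₁ x ⊆ Icc x₁ x₂ := by
      rw [uIoc_of_le hx.1]; exact Ioc_subset_Icc_self.trans hsub
    have hI : Tendsto (fun i => ∫ s in x₁..x, c.F s (G i s)) l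
        (𝓝 (∫ s in x₁..x, c.F s (f s))) := by
      refine intervalIntegral.tendsto_integral_filter_of_dominated_convergence
        (fun _ => c.up x₂ / x₁) ?_ ?_ ?_ ?_
      · filter_upwards [hG] with i hi
        exact ((continuousOn_F hi.1 hi.2.1 hX).mono hsub').aestronglyMeasurable measurableSet_uIoc
      · filter_upwards [hG] with i hi
        exact ae_of_all _ fun s hs =>
          (hi.2.1 s (hsub' hs)).F_le hx₁ (hsub' hs).1 (hsub' hs).2
      · exact intervalIntegrable_const
      · refine ae_of_all _ fun s hs => ?_
        have hQ := ((hfR s (hsub' hs)).Q_pos fun h => hX (h.1 ▸ hsub' hs)).ne'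
        exact tendsto_F hQ (hlim s (hsub' hs))
    have hL : Tendsto (fun i => G i x - G i x₁) l (𝓝 (f x - f x₁)) :=
      (hlim x hx).sub (hlim x₁ (left_mem_Icc.2 (hx.1.trans hx.2)))
    have heq : (fun i => ∫ s in x₁..x, c.F s (G i s)) =ᶠ[l] fun i => G i x - G i x₁ := by
      filter_upwards [hG] with i hi
      refine intervalIntegral.integral_eq_sub_of_hasDerivAt_of_le hx.1 (hi.1.mono hsub)
        (fun s hs => hi.2.2 s ⟨hs.1, hs.2.trans_le hx.2⟩) ?_
      exact ((continuousOn_F hi.1 hi.2.1 hX).mono hsub).intervalIntegrable_of_Icc hx.1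
    have := tendsto_nhds_unique (hI.congr' heq) hL
    linarith
  intro x hx
  have hd : HasDerivAt (fun y => f x₁ + ∫ s in x₁..y, c.F s (f s)) (c.F x (f x)) x := by
    refine (intervalIntegral.integral_hasDerivAt_right ?_ ?_ ?_).const_add _
    · exact (hFc.mono (Icc_subset_Icc_right hx.2.le)).intervalIntegrable_of_Icc hx.1.le
    · exact (hFc.mono Ioo_subset_Icc_self).stronglyMeasurableAtFilter isOpen_Ioo x hx
    · exact hFc.continuousAt (Icc_mem_nhds hx.1 hx.2)
  refine hd.congr_of_eventuallyEq ?_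
  filter_upwards [Icc_mem_nhds hx.1 hx.2] with y hy using hint y hy

lemma region_of_tendsto {ι : Type*} {l : Filter ι} [l.NeBot] {G : ι → ℝ} {x u : ℝ} (hx : 0 < x)
    (hG : ∀ᶠ i in l, c.Region x (G i)) (hlim : Tendsto G l (𝓝 u)) : c.Region x u := by
  have hP : Tendsto (fun i => c.P x (G i)) l (𝓝 (c.P x u)) :=
    (continuous_P (c := c)).continuousAt.tendsto.comp (tendsto_const_nhds.prodMk_nhds hlim)
  refine ⟨hx, ge_of_tendsto hP (hG.mono fun i hi => hi.nonneg), fun hxX => ⟨?_, ?_⟩⟩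
  · exact ge_of_tendsto hlim (hG.mono fun i hi => (hi.left hxX).1)
  · exact le_of_tendsto_of_tendsto (hP.const_mul _) ((hlim.sub_const x).const_mul _)
      (hG.mono fun i hi => (hi.left hxX).2)

/-- The limit of arcs, over an interval which they all cover. -/
lemma limit_of_arcs {l : Filter ℝ} [l.NeBot] [l.IsCountablyGenerated] {β : ℝ → ℝ}
    {g : ℝ → ℝ → ℝ} {f : ℝ → ℝ} {α₀ x₂ : ℝ} (hα₀ : 0 < α₀) (hl : l ≤ 𝓝 α₀)
    (harc : ∀ᶠ α in l, c.Arc α (β α) (g α) ∧ x₂ ≤ β α) (h0 : f α₀ = c.up α₀)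
    (hlim : ∀ x ∈ Ioc α₀ x₂, Tendsto (fun α => g α x) l (𝓝 (f x))) :
    ContinuousOn f (Icc α₀ x₂) ∧ (∀ x ∈ Icc α₀ x₂, c.Region x (f x)) ∧
      ∀ x ∈ Ioo α₀ x₂, x ≠ c.X → HasDerivAt f (c.F x (f x)) x := by
  have hlt : ∀ x, α₀ < x → ∀ᶠ α in l, α < x := fun x hx => hl (Iio_mem_nhds hx)
  have hR : ∀ x ∈ Icc α₀ x₂, c.Region x (f x) := by
    intro x hx
    rcases hx.1.lt_or_eq with h | h
    · refine region_of_tendsto (hα₀.trans h) ?_ (hlim x ⟨h, hx.2⟩)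
      filter_upwards [harc, hlt x h] with α h1 h2
      exact h1.1.region x ⟨h2.le, hx.2.trans h1.2⟩
    · rw [← h, h0]; exact region_up hα₀
  have hup : Tendsto c.up l (𝓝 (c.up α₀)) := (continuous_up (c := c)).continuousAt.tendsto.mono_left hl
  have hid : Tendsto (fun α : ℝ => α) l (𝓝 α₀) := hl
  have hc : ContinuousOn f (Icc α₀ x₂) := by
    refine continuousOn_of_monotoneOn_of_div_antitoneOn hα₀ fun x hx y hy hxy => ?_
    rcases hxy.eq_or_lt with hxy | hxy
    · subst hxy; exact ⟨le_rfl, le_rfl⟩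
    have hy0 : α₀ < y := hx.1.trans_lt hxy
    have hly := hlim y ⟨hy0, hy.2⟩
    rcases hx.1.lt_or_eq with h | h
    · have hlx := hlim x ⟨h, hx.2⟩
      constructor
      · refine le_of_tendsto_of_tendsto hlx hly ?_
        filter_upwards [harc, hlt x h] with α h1 h2
        exact h1.1.monotoneOn ⟨h2.le, hx.2.trans h1.2⟩ ⟨(h2.trans hxy).le, hy.2.trans h1.2⟩ hxy.le
      · refine le_of_tendsto_of_tendsto (hly.div_const y) (hlx.div_const x) ?_
        filter_upwards [harc, hlt x h] with α h1 h2
        exact h1.1.div_antitoneOn ⟨h2.le, hx.2.trans h1.2⟩ ⟨(h2.trans hxy).le, hy.2.trans h1.2⟩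
          hxy.le
    · rw [← h, h0]
      constructor
      · refine le_of_tendsto_of_tendsto hup hly ?_
        filter_upwards [harc, hlt y hy0] with α h1 h2
        rw [← h1.1.start]
        exact h1.1.monotoneOn (left_mem_Icc.2 h1.1.lt.le) ⟨h2.le, hy.2.trans h1.2⟩ h2.le
      · refine le_of_tendsto_of_tendsto (hly.div_const y) (hup.div hid hα₀.ne') ?_
        filter_upwards [harc, hlt y hy0] with α h1 h2
        have := h1.1.div_antitoneOn (left_mem_Icc.2 h1.1.lt.le) ⟨h2.le, hy.2.trans h1.2⟩ h2.le
        simp only [h1.1.start] at this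
        exact this
  refine ⟨hc, hR, fun x hx hxX => ?_⟩
  obtain ⟨ε, hε, hball⟩ : ∃ ε > 0, Icc (x - ε) (x + ε) ⊆ Ioo α₀ x₂ \ {c.X} := by
    have : Ioo α₀ x₂ \ {c.X} ∈ 𝓝 x :=
      (isOpen_Ioo.sdiff isClosed_singleton).mem_nhds ⟨hx, hxX⟩
    obtain ⟨ε, hε, h⟩ := Metric.nhds_basis_closedBall.mem_iff.1 this
    exact ⟨ε, hε, by rwa [Real.closedBall_eq_Icc] at h⟩
  have hx1 : x - ε ∈ Icc (x - ε) (x + ε) := ⟨le_rfl, by linarith⟩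
  refine hasDerivAt_of_tendsto (l := l) (G := g) (x₁ := x - ε) (x₂ := x + ε)
    (hα₀.trans (hball hx1).1.1) (fun h => (hball h).2 rfl) ?_
    (fun y hy => hlim y (Ioo_subset_Ioc_self (hball hy).1))
    (hc.mono fun y hy => Ioo_subset_Icc_self (hball hy).1)
    (fun y hy => hR y (Ioo_subset_Icc_self (hball hy).1)) x ⟨by linarith, by linarith⟩
  filter_upwards [harc, hlt _ (hball hx1).1.1] with α h1 h2
  have hsub : Icc (x - ε) (x + ε) ⊆ Icc α (β α) := fun y hy =>
    ⟨h2.le.trans hy.1, (hball hy).1.2.le.trans h1.2⟩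
  refine ⟨h1.1.cont.mono hsub, fun y hy => h1.1.region y (hsub hy), fun y hy => ?_⟩
  have hy' := hball (Ioo_subset_Icc_self hy)
  exact h1.1.ode y ⟨h2.trans hy.1, hy'.1.2.trans_le h1.2⟩ fun h => hy'.2 h

/-- Limits of arcs when the starting point decreases. -/
lemma exists_right_limit {β : ℝ → ℝ} {g : ℝ → ℝ → ℝ} {α₀ : ℝ} (hα₀ : 0 < α₀)
    (h : ∀ α, α₀ < α → c.Arc α (β α) (g α)) :
    ∃ b f, c.Arc α₀ b f ∧ Tendsto β (𝓝[>] α₀) (𝓝 b) ∧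
      ∀ x ∈ Ioc α₀ b, Tendsto (fun α => g α x) (𝓝[>] α₀) (𝓝 (f x)) := by
  have hmono : MonotoneOn β (Ioi α₀) := fun x hx y hy hxy => (h x hx).end_le_end (h y hy) hxy
  have hbdd : BddBelow (β '' Ioi α₀) := ⟨α₀, by
    rintro _ ⟨α, hα, rfl⟩
    exact (lt_trans hα (h α hα).lt).le⟩
  have hβ := hmono.tendsto_nhdsGT hbdd
  set b := sInf (β '' Ioi α₀) with hb
  have hbβ : ∀ α, α₀ < α → b ≤ β α := fun α hα => csInf_le hbdd ⟨α, hα, rfl⟩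
  have hb0 : α₀ ≤ b := le_csInf ⟨_, α₀ + 1, by simp, rfl⟩ (by
    rintro _ ⟨α, hα, rfl⟩
    exact (lt_trans hα (h α hα).lt).le)
  have hdn : Tendsto (fun α => c.dn (β α)) (𝓝[>] α₀) (𝓝 (c.dn b)) :=
    (continuous_dn (c := c)).continuousAt.tendsto.comp hβ
  -- If b = α₀, the inequality `c.up α₀ ≤ g α (β α) = c.dn (β α)` would give `c.up α₀ ≤ c.dn α₀` in
  -- the limit.
  have hb1 : α₀ < b := by
    refine lt_of_le_of_ne hb0 fun heq => ?_
    have h1 : c.up α₀ ≤ c.dn b := by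
      refine ge_of_tendsto hdn ?_
      filter_upwards [self_mem_nhdsWithin] with α hα
      have h2 := h α hα
      rw [← h2.terminal]
      calc c.up α₀ ≤ c.up α := up_le_up hα₀ (le_of_lt hα)
        _ = g α α := h2.start.symm
        _ ≤ g α (β α) := h2.monotoneOn (left_mem_Icc.2 h2.lt.le) (right_mem_Icc.2 h2.lt.le) h2.lt.le
    rw [← heq] at h1
    exact absurd (dn_lt_up (c := c) hα₀.le) (not_lt.2 h1)
  set f : ℝ → ℝ := fun x => if x ≤ α₀ then c.up α₀ else sInf ((fun α => g α x) '' Ioo α₀ x) with hf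
  have hlim : ∀ x ∈ Ioc α₀ b, Tendsto (fun α => g α x) (𝓝[>] α₀) (𝓝 (f x)) := by
    intro x hx
    rw [hf]
    simp only [not_le.2 hx.1, if_false]
    refine MonotoneOn.tendsto_nhdsWithin_Ioo_right (nonempty_Ioo.2 hx.1) ?_ ?_
    · intro s hs t ht hst
      exact (h s hs.1).le_of_le (h t ht.1) hst ht.2.le (hx.2.trans (hbβ s hs.1))
        (hx.2.trans (hbβ t ht.1))
    · refine ⟨c.dn x, ?_⟩
      rintro _ ⟨s, hs, rfl⟩
      exact ((h s hs.1).region x ⟨hs.2.le, hx.2.trans (hbβ s hs.1)⟩).dn_le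
  have hf0 : f α₀ = c.up α₀ := by simp [hf]
  obtain ⟨h1, h2, h3⟩ := limit_of_arcs (c := c) (l := 𝓝[>] α₀) (β := β) (g := g) (f := f)
    (x₂ := b) hα₀ nhdsWithin_le_nhds
    (eventually_mem_nhdsWithin.mono fun α hα => ⟨h α hα, hbβ α hα⟩) hf0 hlim
  refine ⟨b, f, ⟨hα₀, hb1, h1, h2, h3, hf0, ?_⟩, hβ, hlim⟩
  -- Each arc satisfies g α b ≤ `c.dn (β α)` by monotonicity, and the right side tends to `c.dn b`.
  refine le_antisymm ?_ (h2 b (right_mem_Icc.2 hb0)).dn_le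
  refine le_of_tendsto_of_tendsto (hlim b ⟨hb1, le_rfl⟩) hdn ?_
  filter_upwards [Ioo_mem_nhdsGT hb1] with α hα
  have h4 := h α hα.1
  rw [← h4.terminal]
  exact h4.monotoneOn ⟨hα.2.le, hbβ α hα.1⟩ (right_mem_Icc.2 h4.lt.le) (hbβ α hα.1)

/-- The right limit is itself an arc from α₀, so uniqueness identifies it with the given one. -/
lemma tendsto_right {β : ℝ → ℝ} {g : ℝ → ℝ → ℝ} {α₀ : ℝ} (hα₀ : 0 < α₀)
    (h : ∀ α, α₀ ≤ α → c.Arc α (β α) (g α)) :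
    Tendsto β (𝓝[>] α₀) (𝓝 (β α₀)) ∧
      ∀ x ∈ Ioo α₀ (β α₀), Tendsto (fun α => g α x) (𝓝[>] α₀) (𝓝 (g α₀ x)) := by
  obtain ⟨b, f, h1, h2, h3⟩ := exists_right_limit hα₀ fun α hα => h α hα.le
  obtain ⟨h4, h5⟩ := (h α₀ le_rfl).unique h1
  subst h4
  refine ⟨h2, fun x hx => ?_⟩
  rw [← h5 (Ioo_subset_Icc_self hx)]
  exact h3 x (Ioo_subset_Ioc_self hx)

/-- Limits of arcs when the starting point increases. -/
lemma tendsto_left {β : ℝ → ℝ} {g : ℝ → ℝ → ℝ} {α₀ : ℝ} (hα₀ : 0 < α₀)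
    (h : ∀ α, 0 < α → α ≤ α₀ → c.Arc α (β α) (g α)) :
    Tendsto β (𝓝[<] α₀) (𝓝 (β α₀)) ∧
      ∀ x ∈ Ioo α₀ (β α₀), Tendsto (fun α => g α x) (𝓝[<] α₀) (𝓝 (g α₀ x)) := by
  have h0 := h α₀ hα₀ le_rfl
  have hmono : MonotoneOn β (Ioo 0 α₀) := fun x hx y hy hxy =>
    (h x hx.1 hx.2.le).end_le_end (h y hy.1 hy.2.le) hxy
  have hle : ∀ α ∈ Ioo 0 α₀, β α ≤ β α₀ := fun α hα => (h α hα.1 hα.2.le).end_le_end h0 hα.2.le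
  have hbdd : BddAbove (β '' Ioo 0 α₀) := ⟨β α₀, by rintro _ ⟨α, hα, rfl⟩; exact hle α hα⟩
  have hβ := hmono.tendsto_nhdsWithin_Ioo_left (nonempty_Ioo.2 hα₀) hbdd
  set b := sSup (β '' Ioo 0 α₀) with hb
  have hbβ : ∀ α ∈ Ioo 0 α₀, β α ≤ b := fun α hα => le_csSup hbdd ⟨α, hα, rfl⟩
  have hb1 : b ≤ β α₀ := csSup_le ((nonempty_Ioo.2 hα₀).image β) (by
    rintro _ ⟨α, hα, rfl⟩; exact hle α hα)
  have hev0 : ∀ᶠ α in 𝓝[<] α₀, α ∈ Ioo 0 α₀ := Ioo_mem_nhdsLT hα₀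
  -- Choose α so close to α₀ that `c.up α` exceeds `c.dn α₀`; an arc from α ending at or before α₀
  -- would rise from the former to at most the latter.
  have hb0 : α₀ < b := by
    have hup : Tendsto c.up (𝓝[<] α₀) (𝓝 (c.up α₀)) :=
      (continuous_up (c := c)).continuousAt.tendsto.mono_left nhdsWithin_le_nhds
    have hev1 : ∀ᶠ α in 𝓝[<] α₀, c.dn α₀ < c.up α :=
      hup.eventually (lt_mem_nhds (dn_lt_up hα₀.le))
    obtain ⟨α, h1, h2⟩ := (hev1.and hev0).exists
    refine lt_of_lt_of_le ?_ (hbβ α h2)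
    have h3 := h α h2.1 h2.2.le
    by_contra! hcon
    have h4 : c.up α ≤ c.dn (β α) := by
      rw [← h3.start, ← h3.terminal]
      exact h3.monotoneOn (left_mem_Icc.2 h3.lt.le) (right_mem_Icc.2 h3.lt.le) h3.lt.le
    have h5 : c.dn (β α) ≤ c.dn α₀ := by
      rcases hcon.lt_or_eq with h6 | h6
      · exact (dn_lt_dn (h3.pos.trans h3.lt) h6).le
      · rw [h6]
    linarith
  have hXb : c.X < b := by
    obtain ⟨α, h2⟩ := hev0.exists
    exact (h α h2.1 h2.2.le).X_lt.trans_le (hbβ α h2)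
  have hcov : ∀ x, x < b → ∀ᶠ α in 𝓝[<] α₀, x ≤ β α := fun x hx =>
    (hβ.eventually (lt_mem_nhds hx)).mono fun α hα => hα.le
  set f : ℝ → ℝ := fun x => if x ≤ α₀ then c.up α₀ else limUnder (𝓝[<] α₀) fun α => g α x with hf
  have hlim : ∀ x ∈ Ioo α₀ b, Tendsto (fun α => g α x) (𝓝[<] α₀) (𝓝 (f x)) := by
    intro x hx
    rw [hf]
    simp only [not_le.2 hx.1, if_false]
    refine tendsto_nhds_limUnder ?_
    obtain ⟨α₁, h1, h2⟩ := ((hcov x hx.2).and hev0).exists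
    have hcv : ∀ α ∈ Ioo α₁ α₀, x ≤ β α := fun α hα =>
      h1.trans (hmono h2 ⟨h2.1.trans hα.1, hα.2⟩ hα.1.le)
    refine ⟨_, MonotoneOn.tendsto_nhdsWithin_Ioo_left (nonempty_Ioo.2 h2.2) ?_ ?_⟩
    · intro s hs t ht hst
      exact (h s (h2.1.trans hs.1) hs.2.le).le_of_le (h t (h2.1.trans ht.1) ht.2.le) hst
        (ht.2.le.trans hx.1.le) (hcv s hs) (hcv t ht)
    · refine ⟨c.up x, ?_⟩
      rintro _ ⟨s, hs, rfl⟩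
      exact ((h s (h2.1.trans hs.1) hs.2.le).region x ⟨hs.2.le.trans hx.1.le, hcv s hs⟩).le_up
  have hf0 : f α₀ = c.up α₀ := by simp [hf]
  have hfg : ∀ x ∈ Ioo α₀ b, f x = g α₀ x := by
    intro x hx
    obtain ⟨h1, h2, h3⟩ := limit_of_arcs (c := c) (l := 𝓝[<] α₀) (β := β) (g := g) (f := f) (x₂ := x)
      hα₀ nhdsWithin_le_nhds
      ((hev0.and (hcov x hx.2)).mono fun α hα => ⟨h α hα.1.1 hα.1.2.le, hα.2⟩) hf0
      (fun y hy => hlim y ⟨hy.1, hy.2.trans_lt hx.2⟩)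
    have hI : c.Inner (Icc α₀ x) f := ⟨ordConnected_Icc, fun y hy => hα₀.trans_le hy.1, h1,
      fun y hy => (h2 y hy).nonneg, fun y hy hne => by
        rw [interior_Icc] at hy
        exact ⟨((h2 y (Ioo_subset_Icc_self hy)).Q_pos fun h' => hne h'.1).ne', h3 y hy hne⟩⟩
    exact (Inner.right h0 hI (left_mem_Icc.2 hx.1.le) (hf0.trans h0.start.symm)
      (right_mem_Icc.2 hx.1.le) hx.1.le).2
  -- If b < β α₀, the approximating arcs stay at or below `c.dn b` before they end, hence so does
  -- the limit at b. But the arc from α₀ is still strictly above the lower branch there.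
  have hbeq : b = β α₀ := by
    by_contra hne
    have hlt : b < β α₀ := lt_of_le_of_ne hb1 hne
    have h1 := h0.dn_lt_of_lt hXb hb0.le hlt
    have h2 : g α₀ b ≤ c.dn b := by
      have hc : Tendsto (g α₀) (𝓝[<] b) (𝓝 (g α₀ b)) := by
        have : ContinuousAt (g α₀) b := h0.cont.continuousAt (Icc_mem_nhds hb0 hlt)
        exact this.tendsto.mono_left nhdsWithin_le_nhds
      refine le_of_tendsto hc ?_
      filter_upwards [Ioo_mem_nhdsLT hb0] with x hx
      rw [← hfg x hx]
      refine le_of_tendsto (hlim x hx) ?_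
      filter_upwards [hev0, hcov x hx.2] with α h3 h4
      have h5 := h α h3.1 h3.2.le
      have h6 : c.dn (β α) ≤ c.dn b := by
        rcases (hbβ α h3).lt_or_eq with h6 | h6
        · exact (dn_lt_dn (h5.pos.trans h5.lt) h6).le
        · rw [h6]
      refine le_trans ?_ h6
      rw [← h5.terminal]
      exact h5.monotoneOn ⟨h3.2.le.trans hx.1.le, h4⟩ (right_mem_Icc.2 h5.lt.le) h4
    linarith
  rw [hbeq] at hβ hlim hfg
  refine ⟨hβ, fun x hx => ?_⟩
  rw [← hfg x hx]
  exact hlim x hx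

/-! ### Existence of arcs: invariance of the region and finite length -/

lemma hasDerivWithinAt_P {g : ℝ → ℝ} {g' x : ℝ} {s : Set ℝ} (hg : HasDerivWithinAt g g' s x) :
    HasDerivWithinAt (fun x => c.P x (g x)) (c.Px x (g x) + c.Pu x (g x) * g') s x := by
  have h1 := ((hg.fun_pow 2).const_mul (-c.d)).fun_add
    (((((hasDerivWithinAt_id x s).const_mul (2 * c.mu)).add_const 2)).fun_mul hg)
  have h2 := h1.fun_sub (((hasDerivWithinAt_id x s).fun_pow 2).const_mul c.b)
  refine (h2.congr_deriv ?_).congr (fun y _ => ?_) ?_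
  · simp [Px, Pu]; ring
  · simp only [P, id]; ring
  · simp only [P, id]; ring

/-- A curve with the right slope stays in the region unless it sits on the lower branch. -/
lemma eventually_region {y : ℝ → ℝ} {x₀ : ℝ} (hR : c.Region x₀ (y x₀))
    (hne : ¬ (x₀ = c.X ∧ y x₀ = c.X)) (hdn : y x₀ ≠ c.dn x₀)
    (hy : HasDerivWithinAt y (c.F x₀ (y x₀)) (Ioi x₀) x₀) :
    ∀ᶠ x in 𝓝[>] x₀, c.Region x (y x) := by
  have hx0 := hR.pos
  have hu0 := hR.u_pos
  have hQ := hR.Q_pos hne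
  have hcont : Tendsto y (𝓝[>] x₀) (𝓝 (y x₀)) := hy.continuousWithinAt.tendsto
  have hcont2 : Tendsto (fun x => (x, y x)) (𝓝[>] x₀) (𝓝 (x₀, y x₀)) :=
    Tendsto.prodMk_nhds (tendsto_nhdsWithin_of_tendsto_nhds tendsto_id) hcont
  have hPd := hasDerivWithinAt_P (c := c) hy
  have hP : ∀ᶠ x in 𝓝[>] x₀, 0 ≤ c.P x (y x) := by
    rcases hR.nonneg.lt_or_eq with h | h
    · filter_upwards [hcont2.eventually ((continuous_P (c := c)).continuousAt.eventually
        (lt_mem_nhds h))] with x hx using hx.le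
    · have hup : y x₀ = c.up x₀ := ((P_eq_zero_iff hx0.le).1 h.symm).resolve_left hdn
      -- On the upper branch the slope vanishes, so P grows at the rate `Px`, which is positive
      -- there.
      have hF : c.F x₀ (y x₀) = 0 := by rw [F, ← h]; simp
      have := eventually_gt_of_hasDerivWithinAt_pos hPd (by
        rw [hF, mul_zero, add_zero, hup]; exact Px_up_pos hx0)
      filter_upwards [this] with x hx
      rw [h]; exact hx.le
  rcases lt_or_ge x₀ c.X with hX | hX
  · have hV : ∀ᶠ x in 𝓝[>] x₀, x < y x := by
      have : Continuous fun w : ℝ × ℝ => w.2 - w.1 := by fun_prop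
      filter_upwards [hcont2.eventually (this.continuousAt.eventually
        (lt_mem_nhds (sub_pos.2 (hR.lt_of_lt hX))))] with x hx
      exact sub_pos.1 hx
    have hS : ∀ᶠ x in 𝓝[>] x₀, 0 ≤ c.b * x * (y x - x) - (1 - c.p) * c.P x (y x) := by
      rcases (sub_nonneg.2 (hR.left hX.le).2).lt_or_eq with h | h
      · have hc : Continuous fun w : ℝ × ℝ =>
            c.b * w.1 * (w.2 - w.1) - (1 - c.p) * c.P w.1 w.2 := by
          have := continuous_P (c := c)
          fun_prop
        filter_upwards [hcont2.eventually (hc.continuousAt.eventually (lt_mem_nhds h))] with x hx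
        exact hx.le
      · have hd := (((hasDerivWithinAt_id x₀ (Ioi x₀)).const_mul c.b).fun_mul
          (hy.fun_sub (hasDerivWithinAt_id x₀ (Ioi x₀)))).fun_sub (hPd.const_mul (1 - c.p))
        -- On the boundary where the slack vanishes, x F = u exactly, and x times the derivative of
        -- the slack reduces to 2 (1 - p) u > 0.
        have hF : x₀ * c.F x₀ (y x₀) = y x₀ := by
          rw [F, mul_div_assoc', div_eq_iff hQ.ne', mul_Q_eq, ← h]; ring
        have := eventually_gt_of_hasDerivWithinAt_pos hd (by
          simp only [id]
          have ha := one_sub_p_pos (c := c)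
          refine (pos_iff_pos_of_mul_pos ?_).1 hx0
          have : x₀ * (c.b * 1 * (y x₀ - x₀) + c.b * x₀ * (c.F x₀ (y x₀) - 1) -
              (1 - c.p) * (c.Px x₀ (y x₀) + c.Pu x₀ (y x₀) * c.F x₀ (y x₀))) =
              2 * (c.b * x₀ * (y x₀ - x₀) - (1 - c.p) * c.P x₀ (y x₀)) +
              2 * (1 - c.p) * y x₀ +
              (c.b * x₀ - (1 - c.p) * c.Pu x₀ (y x₀)) * (x₀ * c.F x₀ (y x₀) - y x₀) := by
            unfold Px Pu P; ring
          rw [this, ← h, hF]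
          have := mul_pos ha hu0
          linarith)
        filter_upwards [this] with x hx
        simp only [id, ← h] at hx
        exact hx.le
    filter_upwards [hP, hV, hS, self_mem_nhdsWithin] with x h1 h2 h3 h4
    exact ⟨hx0.trans h4, h1, fun _ => ⟨h2.le, sub_nonneg.1 h3⟩⟩
  · filter_upwards [hP, self_mem_nhdsWithin] with x h1 h2
    exact region_of_right (hX.trans_lt h2) h1

/-- Solvability up to the exit time from a closed set `S`. -/
lemma exists_solution_until {S : Set (ℝ × ℝ)} {x₀ x₁ z₀ : ℝ} (hx : x₀ ≤ x₁)
    (hS : IsClosed S)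
    (hSR : ∀ x u, (x, u) ∈ S → x ∈ Icc x₀ x₁ → c.Region x u ∧ ¬ (x = c.X ∧ u = c.X))
    (h0 : (x₀, z₀) ∈ S)
    (hstay : ∀ b ∈ Ico x₀ x₁, ∀ y : ℝ → ℝ, (b, y b) ∈ S → z₀ ≤ y b →
      Tendsto y (𝓝[>] b) (𝓝 (y b)) → (∀ᶠ x in 𝓝[>] b, c.Region x (y x)) →
      ∀ᶠ x in 𝓝[>] b, (x, y x) ∈ S) :
    ∃ b ∈ Icc x₀ x₁, ∃ y : ℝ → ℝ, y x₀ = z₀ ∧ ContinuousOn y (Icc x₀ b) ∧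
      (∀ x ∈ Icc x₀ b, c.Region x (y x) ∧ ¬ (x = c.X ∧ y x = c.X)) ∧
      (∀ x ∈ Ioo x₀ b, HasDerivAt y (c.F x (y x)) x) ∧ (b < x₁ → y b = c.dn b) := by
  set K : Set (ℝ × ℝ) := S ∩ Icc x₀ x₁ ×ˢ Icc 0 (c.up x₁) with hKdef
  have hK : IsCompact K := (isCompact_Icc.prod isCompact_Icc).inter_left hS
  have hKR : ∀ x u, (x, u) ∈ K → c.Region x u ∧ ¬ (x = c.X ∧ u = c.X) := fun x u h =>
    hSR x u h.1 h.2.1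
  have hU : IsOpen {w : ℝ × ℝ | c.Q w.1 w.2 ≠ 0} :=
    isOpen_ne_fun continuous_Q continuous_const
  obtain ⟨h, C, M, hC, hM, hEq⟩ := exists_lipschitz_extension
    (f := fun w : ℝ × ℝ => c.F w.1 w.2) hK hU
    (fun w hw => ((hKR w.1 w.2 hw).1.Q_pos (hKR w.1 w.2 hw).2).ne') fun w hw => contDiffAt_F hw
  obtain ⟨y, hy0, hyd⟩ := exists_solution_of_lipschitz hC hM hx z₀
  have hyc : ContinuousOn y (Icc x₀ x₁) := fun x hx => (hyd x hx).continuousWithinAt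
  have hmemK : ∀ x u, x ∈ Icc x₀ x₁ → c.Region x u → (x, u) ∈ S → (x, u) ∈ K :=
    fun x u h1 h2 h3 => ⟨h3, h1, h2.u_pos.le, h2.le_up.trans (up_le_up h2.pos h1.2)⟩
  obtain ⟨b, hb, hbK, hbex⟩ := exists_exit_time hK.isClosed hx hyc (by
    rw [hy0]
    exact hmemK _ _ (left_mem_Icc.2 hx) (hSR _ _ h0 (left_mem_Icc.2 hx)).1 h0)
  have hsub : Icc x₀ b ⊆ Icc x₀ x₁ := Icc_subset_Icc_right hb.2
  have hR : ∀ x ∈ Icc x₀ b, c.Region x (y x) ∧ ¬ (x = c.X ∧ y x = c.X) := fun x hx =>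
    hKR x (y x) (hbK x hx)
  have hyF : ∀ x ∈ Icc x₀ b, HasDerivWithinAt y (c.F x (y x)) (Icc x₀ x₁) x := fun x hx => by
    have h1 := hEq (hbK x hx)
    have h2 := hyd x (hsub hx)
    rw [h1] at h2
    exact h2
  have hode : ∀ x ∈ Ioo x₀ b, HasDerivAt y (c.F x (y x)) x := fun x hx =>
    (hyF x (Ioo_subset_Icc_self hx)).hasDerivAt (Icc_mem_nhds hx.1 (hx.2.trans_le hb.2))
  refine ⟨b, hb, y, hy0, hyc.mono hsub, hR, hode, fun hlt => ?_⟩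
  -- Off the lower branch `eventually_region` and `hstay` would keep the curve in K beyond its exit
  -- time.
  by_contra hdn
  have hbb : b ∈ Icc x₀ b := right_mem_Icc.2 hb.1
  have hmono : MonotoneOn y (Icc x₀ b) :=
    monotoneOn_Icc_of_hasDerivAt_off (A := c.X) (hyc.mono hsub) (fun x hx _ => hode x hx)
      fun x hx _ => (hR x (Ioo_subset_Icc_self hx)).1.F_nonneg
  have hge : z₀ ≤ y b := by
    rw [← hy0]; exact hmono (left_mem_Icc.2 hb.1) hbb hb.1
  have hd : HasDerivWithinAt y (c.F b (y b)) (Ioi b) b :=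
    (hyF b hbb).mono_of_mem_nhdsWithin
      (mem_of_superset (Ioo_mem_nhdsGT hlt) fun x hx => ⟨hb.1.trans hx.1.le, hx.2.le⟩)
  have hreg := eventually_region (hR b hbb).1 (hR b hbb).2 hdn hd
  have hSb := hstay b ⟨hb.1, hlt⟩ y (hbK b hbb).1 hge hd.continuousWithinAt.tendsto hreg
  refine hbex hlt ?_
  filter_upwards [hreg, hSb, Ioo_mem_nhdsGT hlt] with x h1 h2 h3
  exact hmemK x (y x) ⟨hb.1.trans h3.1.le, h3.2.le⟩ h1 h2

/-- The remaining exit through the lower branch cannot occur: left of X that branch is below the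
diagonal and the region strictly above it. -/
lemma exists_solution_left {α x₁ : ℝ} (hα : 0 < α) (hx : α ≤ x₁) (hX : x₁ < c.X) :
    ∃ y : ℝ → ℝ, y α = c.up α ∧ ContinuousOn y (Icc α x₁) ∧
      (∀ x ∈ Icc α x₁, c.Region x (y x)) ∧
      (∀ x ∈ Ioo α x₁, HasDerivAt y (c.F x (y x)) x) := by
  have hcP := continuous_P (c := c)
  obtain ⟨b, hb, y, h1, h2, h3, h4, h5⟩ := exists_solution_until (c := c) (x₀ := α) (x₁ := x₁)
    (z₀ := c.up α) (S := {w : ℝ × ℝ | 0 ≤ c.P w.1 w.2 ∧ w.1 ≤ w.2 ∧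
      (1 - c.p) * c.P w.1 w.2 ≤ c.b * w.1 * (w.2 - w.1)}) hx
    (by
      refine (isClosed_le continuous_const hcP).inter ((isClosed_le continuous_fst
        continuous_snd).inter (isClosed_le (f := fun w : ℝ × ℝ => (1 - c.p) * c.P w.1 w.2)
        (g := fun w : ℝ × ℝ => c.b * w.1 * (w.2 - w.1)) (by fun_prop) (by fun_prop))))
    (fun x u h hx => ⟨⟨hα.trans_le hx.1, h.1, fun _ => h.2⟩,
      fun h' => (hx.2.trans_lt hX).ne h'.1⟩)
    (by
      have := region_up (c := c) hα
      exact ⟨this.nonneg, this.left (hx.trans hX.le)⟩)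
    (fun b hb y _ _ _ hreg => by
      filter_upwards [hreg, Ioo_mem_nhdsGT (hb.2.trans hX)] with x h1 h2
      exact ⟨h1.nonneg, h1.left h2.2.le⟩)
  rcases hb.2.lt_or_eq with h | h
  · exfalso
    have h6 := h5 h
    have h7 := (h3 b (right_mem_Icc.2 hb.1)).1.lt_of_lt (h.trans hX)
    rw [h6] at h7
    exact absurd (dn_lt (hα.trans_le hb.1) (h.trans hX)) (not_lt.2 h7.le)
  · subst h
    exact ⟨y, h1, h2, fun x hx => (h3 x hx).1, h4⟩

/-- Left of the singular abscissa solutions exist up to that abscissa. -/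
lemma exists_solution_to_X {α : ℝ} (hα : 0 < α) (hX : α < c.X) :
    ∃ y : ℝ → ℝ, y α = c.up α ∧ ContinuousOn y (Icc α c.X) ∧
      (∀ x ∈ Icc α c.X, c.Region x (y x)) ∧
      (∀ x ∈ Ioo α c.X, HasDerivAt y (c.F x (y x)) x) := by
  have hex : ∀ x₁ : ℝ, ∃ y : ℝ → ℝ, α ≤ x₁ → x₁ < c.X → y α = c.up α ∧
      ContinuousOn y (Icc α x₁) ∧ (∀ x ∈ Icc α x₁, c.Region x (y x)) ∧
      (∀ x ∈ Ioo α x₁, HasDerivAt y (c.F x (y x)) x) := fun x₁ => by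
    by_cases h : α ≤ x₁ ∧ x₁ < c.X
    · obtain ⟨y, hy⟩ := exists_solution_left hα h.1 h.2
      exact ⟨y, fun _ _ => hy⟩
    · exact ⟨0, fun h1 h2 => absurd ⟨h1, h2⟩ h⟩
  choose y hy using hex
  have huniq : ∀ s t, α ≤ s → s ≤ t → t < c.X → ∀ x ∈ Icc α s, y s x = y t x := by
    intro s t hs hst ht
    obtain ⟨s1, s2, s3, s4⟩ := hy s hs (hst.trans_lt ht)
    obtain ⟨t1, t2, t3, t4⟩ := hy t (hs.trans hst) ht
    have hsub : Icc α s ⊆ Icc α t := Icc_subset_Icc_right hst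
    refine eqOn_Icc_of_forall_extend s2 (t2.mono hsub) (s1.trans t1.symm) fun z hz heq => ?_
    have hzs : Icc z s ⊆ Icc α s := Icc_subset_Icc_left hz.1
    refine eventually_eq_right (c := c) hz.2 (s2.mono hzs) (t2.mono (hzs.trans hsub))
      (fun x hx => (s3 x (hzs hx)).nonneg) (fun x hx => (t3 x (hsub (hzs hx))).nonneg)
      (fun x hx _ => s4 x ⟨hz.1.trans_lt hx.1, hx.2⟩)
      (fun x hx _ => t4 x ⟨hz.1.trans_lt hx.1, hx.2.trans_le hst⟩)
      (heq z (right_mem_Icc.2 hz.1)) (oneSided_regular ?_)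
    exact ((t3 z (hsub ⟨hz.1, hz.2.le⟩)).Q_pos fun h =>
      (hz.2.le.trans_lt (hst.trans_lt ht)).ne h.1).ne'
  -- The midpoint between x and X is an end-point beyond x, so f agrees near x with one single
  -- solution; its value at X is then supplied by monotone convergence.
  set f : ℝ → ℝ := fun x => y ((x + c.X) / 2) x with hf
  have hfy : ∀ t, t < c.X → ∀ x ∈ Icc α t, f x = y t x := by
    intro t ht x hx
    have hxX := hx.2.trans_lt ht
    rcases le_total ((x + c.X) / 2) t with h | h
    · exact huniq _ _ (by linarith [hx.1]) h ht x ⟨hx.1, by linarith⟩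
    · exact (huniq _ _ (hx.1.trans hx.2) h (by linarith) x hx).symm
  have hmid : ∀ x, α ≤ x → x < c.X → α ≤ (x + c.X) / 2 ∧ x < (x + c.X) / 2 ∧
      (x + c.X) / 2 < c.X := fun x h1 h2 => ⟨by linarith, by linarith, by linarith⟩
  have hfR : ∀ x ∈ Ico α c.X, c.Region x (f x) := fun x hx => by
    obtain ⟨m1, m2, m3⟩ := hmid x hx.1 hx.2
    exact (hy _ m1 m3).2.2.1 x ⟨hx.1, m2.le⟩
  have hfd : ∀ x ∈ Ioo α c.X, HasDerivAt f (c.F x (f x)) x := fun x hx => by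
    obtain ⟨m1, m2, m3⟩ := hmid x hx.1.le hx.2
    have h1 := (hy _ m1 m3).2.2.2 x ⟨hx.1, m2⟩
    refine h1.congr_of_eventuallyEq ?_
    filter_upwards [Icc_mem_nhds hx.1 m2] with z hz using hfy _ m3 z hz
  have hfc : ContinuousOn f (Ico α c.X) := fun x hx => by
    obtain ⟨m1, m2, m3⟩ := hmid x hx.1 hx.2
    have h1 := (hy _ m1 m3).2.1 x ⟨hx.1, m2.le⟩
    have h2 : ContinuousWithinAt f (Icc α ((x + c.X) / 2)) x :=
      h1.congr (fun z hz => hfy _ m3 z hz) (hfy _ m3 x ⟨hx.1, m2.le⟩)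
    refine h2.mono_of_mem_nhdsWithin ?_
    filter_upwards [self_mem_nhdsWithin, nhdsWithin_le_nhds (Iio_mem_nhds m2)] with z h3 h4
    exact ⟨h3.1, le_of_lt h4⟩
  have hf0 : f α = c.up α := by
    obtain ⟨m1, m2, m3⟩ := hmid α le_rfl hX
    exact (hy _ m1 m3).1
  have hmono : MonotoneOn f (Ioo α c.X) := by
    intro s hs t ht hst
    have : MonotoneOn f (Icc s t) := by
      refine monotoneOn_Icc_of_hasDerivAt_off (f' := fun x => c.F x (f x)) (A := c.X)
        (hfc.mono fun x hx => ⟨hs.1.le.trans hx.1, hx.2.trans_lt ht.2⟩)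
        (fun x hx _ => hfd x ⟨hs.1.trans hx.1, hx.2.trans ht.2⟩)
        fun x hx _ => (hfR x ⟨(hs.1.trans hx.1).le, hx.2.trans ht.2⟩).F_nonneg
    exact this (left_mem_Icc.2 hst) (right_mem_Icc.2 hst) hst
  have hlim := hmono.tendsto_nhdsWithin_Ioo_left (nonempty_Ioo.2 hX) ⟨c.up c.X, by
    rintro _ ⟨x, hx, rfl⟩
    exact (hfR x (Ioo_subset_Ico_self hx)).le_up.trans (up_le_up (hα.trans hx.1) hx.2.le)⟩
  set L := sSup (f '' Ioo α c.X) with hL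
  set F' : ℝ → ℝ := fun x => if x < c.X then f x else L with hF'
  have hF'1 : ∀ x, x < c.X → F' x = f x := fun x hx => by simp [hF', hx]
  have hF'2 : F' c.X = L := by simp [hF']
  have hlim2 : Tendsto (fun x => (x, f x)) (𝓝[<] c.X) (𝓝 (c.X, L)) :=
    Tendsto.prodMk_nhds (tendsto_nhdsWithin_of_tendsto_nhds tendsto_id) hlim
  have hev : ∀ᶠ x in 𝓝[<] c.X, x ∈ Ioo α c.X := Ioo_mem_nhdsLT hX
  have hPc := continuous_P (c := c)
  have hRL : c.Region c.X L := by
    refine ⟨X_pos, ?_, fun _ => ⟨?_, ?_⟩⟩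
    · refine ge_of_tendsto (hPc.continuousAt.tendsto.comp hlim2) (hev.mono fun x hx => ?_)
      exact (hfR x (Ioo_subset_Ico_self hx)).nonneg
    · refine le_of_tendsto_of_tendsto (tendsto_nhdsWithin_of_tendsto_nhds tendsto_id) hlim
        (hev.mono fun x hx => ?_)
      exact ((hfR x (Ioo_subset_Ico_self hx)).left hx.2.le).1
    · have c1 : Continuous fun w : ℝ × ℝ => (1 - c.p) * c.P w.1 w.2 := by fun_prop
      have c2 : Continuous fun w : ℝ × ℝ => c.b * w.1 * (w.2 - w.1) := by fun_prop
      refine le_of_tendsto_of_tendsto (c1.continuousAt.tendsto.comp hlim2)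
        (c2.continuousAt.tendsto.comp hlim2) (hev.mono fun x hx => ?_)
      exact ((hfR x (Ioo_subset_Ico_self hx)).left hx.2.le).2
  refine ⟨F', by rw [hF'1 α hX, hf0], fun x hx => ?_, fun x hx => ?_, fun x hx => ?_⟩
  · rcases hx.2.lt_or_eq with h | h
    · have h1 : ContinuousWithinAt F' (Ico α c.X) x :=
        (hfc x ⟨hx.1, h⟩).congr (fun z hz => hF'1 z hz.2) (hF'1 x h)
      refine h1.mono_of_mem_nhdsWithin ?_
      filter_upwards [self_mem_nhdsWithin, nhdsWithin_le_nhds (Iio_mem_nhds h)] with z h3 h4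
      exact ⟨h3.1, h4⟩
    · subst h
      have h1 : ContinuousWithinAt F' (Iio c.X) c.X := by
        rw [ContinuousWithinAt, hF'2]
        exact hlim.congr' (eventually_mem_nhdsWithin.mono fun z hz => (hF'1 z hz).symm)
      have h2 : ContinuousWithinAt F' (Iic c.X) c.X := by
        rw [← Iio_insert]; exact h1.insert
      exact h2.mono fun z hz => hz.2
  · rcases hx.2.lt_or_eq with h | h
    · rw [hF'1 x h]; exact hfR x ⟨hx.1, h⟩
    · rw [h, hF'2]; exact hRL
  · rw [hF'1 x hx.2]
    refine (hfd x hx).congr_of_eventuallyEq ?_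
    filter_upwards [Iio_mem_nhds hx.2] with z hz using hF'1 z hz

lemma up_le {x : ℝ} (hx : 0 < x) : c.up x ≤ 2 * (c.mu * x + 1) / c.d := by
  have := up_add_dn (c := c) x
  have := dn_pos (c := c) hx
  linarith

/-- Away from the singular abscissa, `u - x` is comparable to `x`. -/
lemma exists_abs_sub_ge {x₀ : ℝ} (hx₀ : c.X < x₀) :
    ∃ k > 0, ∀ x u, x₀ ≤ x → 0 ≤ c.P x u → k * x ≤ |u - x| := by
  have hX := X_pos (c := c)
  have h0 : 0 < x₀ := hX.trans hx₀
  have he := e_pos (c := c)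
  -- For x ≥ x₀ this gives r x ≤ e x - 1, so P ≥ 0 is possible only if |u - x| is of order x.
  set r := c.e - 1 / x₀ with hr
  have hr0 : 0 < r := by
    have := X_lt_iff.1 hx₀
    rw [hr, sub_pos, div_lt_iff₀ h0]; exact this
  set M := |c.b - c.d| + 2 * c.e with hM
  have hM0 : 0 < M := by positivity
  refine ⟨2 * r / M, by positivity, fun x u hx hP => ?_⟩
  have hx0 : 0 < x := h0.trans_le hx
  have hrx : r * x ≤ c.e * x - 1 := by
    have : 1 ≤ 1 / x₀ * x := by
      rw [one_div_mul_eq_div, le_div_iff₀ h0]; linarith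
    rw [hr]; linarith
  have hrx0 : 0 < r * x := mul_pos hr0 hx0
  rw [P_eq] at hP
  set v := u - x with hv
  have hu : u = x + v := by rw [hv]; ring
  rw [hu] at hP
  have h1 : (c.b - c.d) * v ≤ |c.b - c.d| * |v| := by
    rw [← abs_mul]; exact le_abs_self _
  have h2 := neg_abs_le v
  have h3 := abs_nonneg v
  have h4 : 2 * (x - |v|) * (c.e * x - 1) ≤ |c.b - c.d| * |v| * x := by
    have h5 : 2 * (x + v) * (c.e * x - 1) ≤ (c.b - c.d) * v * x := by
      nlinarith [mul_nonneg c.d_pos.le (sq_nonneg v)]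
    have h6 : 2 * (x - |v|) * (c.e * x - 1) ≤ 2 * (x + v) * (c.e * x - 1) := by
      apply mul_le_mul_of_nonneg_right _ (by linarith); linarith
    have h7 := mul_le_mul_of_nonneg_right h1 hx0.le
    linarith
  have h8 : 2 * x * (r * x) ≤ M * |v| * x := by
    have h9 : 2 * x * (r * x) ≤ 2 * x * (c.e * x - 1) := by gcongr
    have h10 : 2 * |v| * (c.e * x - 1) ≤ 2 * |v| * (c.e * x) := by gcongr; linarith
    have h11 : 2 * (x - |v|) * (c.e * x - 1) = 2 * x * (c.e * x - 1) - 2 * |v| * (c.e * x - 1) := by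
      ring
    have h12 : M * |v| * x = |c.b - c.d| * |v| * x + 2 * |v| * (c.e * x) := by rw [hM]; ring
    linarith
  have h13 : 2 * (r * x) ≤ M * |v| := by nlinarith
  rw [div_mul_eq_mul_div, div_le_iff₀ hM0]
  linarith

/-- To the right of the singular abscissa, `u / x` decreases at least logarithmically. -/
lemma exists_decay {x₀ : ℝ} (hx₀ : c.X < x₀) :
    ∃ k > 0, ∀ x u, x₀ ≤ x → 0 ≤ c.P x u → k * x ≤ u - x * c.F x u := by
  have hX := X_pos (c := c)
  have h0 : 0 < x₀ := hX.trans hx₀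
  obtain ⟨k, hk, hkx⟩ := exists_abs_sub_ge hx₀
  have hd := c.d_pos
  have hmin : 0 < min c.b c.d := lt_min c.b_pos c.d_pos
  set m := c.mu + 1 / x₀ with hm
  have hmu := c.mu_pos
  have hm0 : 0 < m := by positivity
  -- Bounds Q by C x²: here u ≤ (2 m / d) x and 2 x ≤ (2 / x₀) x², and the term of Q containing P is
  -- nonpositive.
  set C := |c.b - c.d| * (2 * m / c.d) + 2 * |c.mu - c.b| + 2 / x₀ with hC
  have hC0 : 0 < C := by positivity
  refine ⟨min c.b c.d * k ^ 2 / C, by positivity, fun x u hx hP => ?_⟩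
  have hx0 : 0 < x := h0.trans_le hx
  have hXx : c.X < x := hx₀.trans_le hx
  have hR := region_of_right hXx hP
  have hQ := hR.Q_pos fun h => hXx.ne' h.1
  have hu := hR.u_pos
  have hux : u ≤ 2 * m / c.d * x := by
    have h1 : c.mu * x + 1 ≤ m * x := by
      have : 1 ≤ 1 / x₀ * x := by rw [one_div_mul_eq_div, le_div_iff₀ h0]; linarith
      rw [hm]; linarith
    calc u ≤ c.up x := hR.le_up
      _ ≤ 2 * (c.mu * x + 1) / c.d := up_le hx0
      _ ≤ 2 * (m * x) / c.d := by gcongr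
      _ = _ := by ring
  have hQC : c.Q x u ≤ C * x ^ 2 := by
    have h1 : (c.b - c.d) * x * u ≤ |c.b - c.d| * x * (2 * m / c.d * x) := by
      have := le_abs_self (c.b - c.d)
      gcongr
    have h2 : 2 * (c.mu - c.b) * x ^ 2 ≤ 2 * |c.mu - c.b| * x ^ 2 := by
      have := le_abs_self (c.mu - c.b)
      gcongr
    have h3 : 2 * x ≤ 2 / x₀ * x ^ 2 := by
      have : 1 ≤ 1 / x₀ * x := by rw [one_div_mul_eq_div, le_div_iff₀ h0]; linarith
      calc 2 * x = 2 * x * 1 := by ring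
        _ ≤ 2 * x * (1 / x₀ * x) := by gcongr
        _ = _ := by ring
    have h4 : 0 ≤ (1 - c.p) * c.P x u := mul_nonneg one_sub_p_pos.le hP
    have h5 : c.Q x u = -((1 - c.p) * c.P x u) + (c.b - c.d) * x * u +
      2 * (c.mu - c.b) * x ^ 2 + 2 * x := by unfold Q; ring
    rw [h5, hC]
    linarith
  have hS := slack_pos_right hXx.le hP fun h => hXx.ne' h.1
  have hv : (k * x) ^ 2 ≤ (u - x) ^ 2 := by
    rw [← sq_abs (u - x)]
    exact pow_le_pow_left₀ (by positivity) (hkx x u hx hP) 2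
  have key : (u - x * c.F x u) * c.Q x u =
      (u - x) * (c.b * x * (u - x) - (1 - c.p) * c.P x u) := by
    have : c.F x u * c.Q x u = c.p * c.P x u := by unfold F; field_simp [hQ.ne']
    calc _ = u * c.Q x u - x * (c.F x u * c.Q x u) := by ring
      _ = _ := by rw [this, mul_Q_eq]; ring
  have h6 : min c.b c.d * x * (k * x) ^ 2 ≤ (u - x * c.F x u) * c.Q x u := by
    rw [key]
    refine le_trans ?_ hS
    gcongr
  have h7 : min c.b c.d * k ^ 2 / C * x * c.Q x u ≤ min c.b c.d * k ^ 2 / C * x * (C * x ^ 2) := by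
    gcongr
  have h8 : min c.b c.d * k ^ 2 / C * x * (C * x ^ 2) = min c.b c.d * x * (k * x) ^ 2 := by
    field_simp
  exact le_of_mul_le_mul_right (by linarith) hQ

/-- Solutions on `[x₀, x₁]` with `x₀ > X` are not too long. -/
lemma exists_log_bound {x₀ : ℝ} (hx₀ : c.X < x₀) :
    ∃ k > 0, ∀ x₁ x₂ y, x₀ ≤ x₁ → x₁ ≤ x₂ → ContinuousOn y (Icc x₁ x₂) →
      (∀ x ∈ Icc x₁ x₂, 0 ≤ c.P x (y x)) →
      (∀ x ∈ Ioo x₁ x₂, HasDerivAt y (c.F x (y x)) x) →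
      k * (Real.log x₂ - Real.log x₁) ≤ y x₁ / x₁ - y x₂ / x₂ := by
  obtain ⟨k, hk, hkx⟩ := exists_decay hx₀
  have h0 : 0 < x₀ := X_pos.trans hx₀
  refine ⟨k, hk, fun x₁ x₂ y h1 h2 hy hP hd => ?_⟩
  have hpos : ∀ x ∈ Icc x₁ x₂, 0 < x := fun x hx => h0.trans_le (h1.trans hx.1)
  have hmono : MonotoneOn (fun x => -(y x / x) - k * Real.log x) (Icc x₁ x₂) := by
    refine monotoneOn_Icc_of_hasDerivAt_off
      (f' := fun x => -((c.F x (y x) * x - y x * 1) / x ^ 2) - k * x⁻¹) (A := c.X)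
      ((hy.div continuousOn_id fun x hx => (hpos x hx).ne').neg.sub
        (continuousOn_const.mul (Real.continuousOn_log.mono fun x hx => (hpos x hx).ne')))
      (fun x hx _ => ?_) fun x hx _ => ?_
    · have hx0 := hpos x (Ioo_subset_Icc_self hx)
      exact (((hd x hx).div (hasDerivAt_id x) hx0.ne').neg).sub
        ((Real.hasDerivAt_log hx0.ne').const_mul k)
    · have hx0 := hpos x (Ioo_subset_Icc_self hx)
      have h3 := hkx x (y x) (h1.trans hx.1.le) (hP x (Ioo_subset_Icc_self hx))
      have h4 : -((c.F x (y x) * x - y x * 1) / x ^ 2) - k * x⁻¹ =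
          (y x - x * c.F x (y x) - k * x) / x ^ 2 := by field_simp; ring
      rw [h4]
      exact div_nonneg (by linarith) (sq_nonneg x)
  have := hmono (left_mem_Icc.2 h2) (right_mem_Icc.2 h2) h2
  simp only at this
  linarith

/-- The extra conditions of the region matter only at x = X, where u > X lets them be read off from
`slack_pos_right`. -/
lemma region_of_right_of_lt {x u : ℝ} (hx : c.X ≤ x) (hP : 0 ≤ c.P x u) (hu : x = c.X → c.X < u) :
    c.Region x u := by
  refine ⟨X_pos.trans_le hx, hP, fun h => ?_⟩
  have hxX : x = c.X := le_antisymm h hx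
  have hlt := hu hxX
  have h1 := slack_pos_right hx hP fun h' => hlt.ne' h'.2
  have hv : 0 < u - x := by rw [hxX]; linarith
  refine ⟨by linarith, ?_⟩
  have h2 : 0 ≤ min c.b c.d * x * (u - x) ^ 2 :=
    mul_nonneg (mul_nonneg (le_min c.b_pos.le c.d_pos.le) (X_pos.trans_le hx).le) (sq_nonneg _)
  by_contra! h3
  have := mul_pos hv (sub_pos.2 h3)
  linarith

/-- Right of the singular abscissa solutions exist up to the lower branch. -/
lemma exists_solution_right {x₀ z₀ : ℝ} (hx₀ : c.X ≤ x₀) (hP : 0 ≤ c.P x₀ z₀)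
    (hdn : z₀ ≠ c.dn x₀) (hsing : x₀ = c.X → c.X < z₀) :
    ∃ β > x₀, ∃ y : ℝ → ℝ, y x₀ = z₀ ∧ ContinuousOn y (Icc x₀ β) ∧
      (∀ x ∈ Icc x₀ β, c.Region x (y x)) ∧
      (∀ x ∈ Ioo x₀ β, HasDerivAt y (c.F x (y x)) x) ∧ y β = c.dn β := by
  have hX := X_pos (c := c)
  -- A level strictly below z₀ which keeps the compact set away from the singular point; the
  -- solution is increasing and therefore never comes down to it.
  obtain ⟨z₁, hz1, hz1X⟩ : ∃ z₁ < z₀, x₀ = c.X → c.X < z₁ := by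
    by_cases h : x₀ = c.X
    · have := hsing h
      exact ⟨(c.X + z₀) / 2, by linarith, fun _ => by linarith⟩
    · exact ⟨z₀ - 1, by linarith, fun h' => absurd h' h⟩
  set a := x₀ + 1 with ha
  have hXa : c.X < a := by linarith
  have ha0 : 0 < a := hX.trans hXa
  obtain ⟨k, hk, hlog⟩ := exists_log_bound hXa
  -- Survival up to x₁ would lower u / x by at least `c.up a / a + k`, making it negative.
  set x₁ := a * Real.exp (c.up a / a / k + 1) with hx₁
  have hup0 : 0 < c.up a / a := div_pos (up_pos ha0.le) ha0
  have hax : a < x₁ := by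
    have : 1 < Real.exp (c.up a / a / k + 1) := Real.one_lt_exp_iff.2 (by positivity)
    rw [hx₁]; nlinarith
  have hcP := continuous_P (c := c)
  have hRS : ∀ x u, (0 ≤ c.P x u ∧ z₁ ≤ u) → x ∈ Icc x₀ x₁ →
      c.Region x u ∧ ¬ (x = c.X ∧ u = c.X) := fun x u h hx => by
    have hxX : x = c.X → c.X < u := fun h' =>
      (hz1X (le_antisymm (h' ▸ hx.1) hx₀)).trans_le h.2
    exact ⟨region_of_right_of_lt (hx₀.trans hx.1) h.1 hxX,
      fun h' => (hxX h'.1).ne' h'.2⟩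
  obtain ⟨b, hb, y, h1, h2, h3, h4, h5⟩ := exists_solution_until (c := c) (x₀ := x₀) (x₁ := x₁)
    (z₀ := z₀) (S := {w : ℝ × ℝ | 0 ≤ c.P w.1 w.2 ∧ z₁ ≤ w.2}) (by linarith)
    ((isClosed_le continuous_const hcP).inter (isClosed_le continuous_const continuous_snd))
    hRS ⟨hP, hz1.le⟩ (fun b hb y _ hge hc hreg => by
      filter_upwards [hreg, hc.eventually (lt_mem_nhds (hz1.trans_le hge))] with x h1 h2
      exact ⟨h1.nonneg, h2.le⟩)
  have hbx : b < x₁ := by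
    refine lt_of_le_of_ne hb.2 fun hbx => ?_
    rw [hbx] at h2 h3 h4
    have hab : a ∈ Icc x₀ x₁ := ⟨by linarith, hax.le⟩
    have hs : Icc a x₁ ⊆ Icc x₀ x₁ := Icc_subset_Icc_left hab.1
    have h6 := hlog a x₁ y le_rfl hax.le (h2.mono hs) (fun x hx => (h3 x (hs hx)).1.nonneg)
      fun x hx => h4 x ⟨hab.1.trans_lt hx.1, hx.2⟩
    have h7 : Real.log x₁ = Real.log a + (c.up a / a / k + 1) := by
      rw [hx₁, Real.log_mul ha0.ne' (Real.exp_pos _).ne', Real.log_exp]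
    have h8 : 0 < y x₁ / x₁ :=
      div_pos (h3 x₁ (right_mem_Icc.2 (hab.1.trans hax.le))).1.u_pos (ha0.trans hax)
    have h9 : y a / a ≤ c.up a / a := by
      have := (h3 a hab).1.le_up
      gcongr
    have h10 : k * (c.up a / a / k + 1) = c.up a / a + k := by field_simp
    rw [h7] at h6
    linarith
  have hb0 : x₀ < b := by
    refine lt_of_le_of_ne hb.1 fun h => ?_
    have := h5 hbx
    rw [← h, h1] at this
    exact hdn this
  exact ⟨b, hb0, y, h1, h2, fun x hx => (h3 x hx).1, h4, h5 hbx⟩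

lemma exists_arc_right {α : ℝ} (hα : c.X ≤ α) (hne : ¬ (α = c.X ∧ c.up α = c.X)) :
    ∃ β g, c.Arc α β g := by
  have hα0 := X_pos.trans_le hα
  obtain ⟨β, hβ, y, h1, h2, h3, h4, h5⟩ := exists_solution_right hα (P_up hα0.le).ge
    (dn_lt_up hα0.le).ne' (fun h => by
      refine lt_of_le_of_ne ?_ fun h' => hne ⟨h, h'.symm⟩
      rw [h]; exact X_le_up_X)
  exact ⟨β, y, ⟨hα0, hβ, h2, h3, fun x hx _ => h4 x hx, h1, h5⟩⟩

/-- If b < d the starting point is the singular point and the cut-off argument is not available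
there, so the arc is obtained as the limit of arcs from α > X. -/
lemma exists_arc_X : ∃ β g, c.Arc c.X β g := by
  have : ∀ α, ∃ β, ∃ g : ℝ → ℝ, c.X < α → c.Arc α β g := fun α => by
    by_cases h : c.X < α
    · obtain ⟨β, g, hg⟩ := exists_arc_right h.le fun h' => h.ne' h'.1
      exact ⟨β, g, fun _ => hg⟩
    · exact ⟨0, 0, fun h' => absurd h' h⟩
  choose β g hg using this
  obtain ⟨b, f, hf, -⟩ := exists_right_limit X_pos hg
  exact ⟨b, f, hf⟩

/-- Two solutions which meet over the singular abscissa can be joined. -/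
lemma exists_glue {α β : ℝ} {y₁ y₂ : ℝ → ℝ} (hα : α < c.X) (hβ : c.X < β)
    (h₁ : ContinuousOn y₁ (Icc α c.X)) (h₂ : ContinuousOn y₂ (Icc c.X β))
    (h₁R : ∀ x ∈ Icc α c.X, c.Region x (y₁ x)) (h₂R : ∀ x ∈ Icc c.X β, c.Region x (y₂ x))
    (h₁d : ∀ x ∈ Ioo α c.X, HasDerivAt y₁ (c.F x (y₁ x)) x)
    (h₂d : ∀ x ∈ Ioo c.X β, HasDerivAt y₂ (c.F x (y₂ x)) x) (h0 : 0 < α)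
    (hstart : y₁ α = c.up α) (hterminal : y₂ β = c.dn β) (hX : y₁ c.X = y₂ c.X) :
    ∃ g, c.Arc α β g := by
  set g : ℝ → ℝ := fun x => if x ≤ c.X then y₁ x else y₂ x with hg
  have hg1 : ∀ x, x ≤ c.X → g x = y₁ x := fun x hx => by simp [hg, hx]
  have hg2 : ∀ x, c.X ≤ x → g x = y₂ x := fun x hx => by
    rcases hx.lt_or_eq with h | h
    · simp [hg, not_le.2 h]
    · rw [hg1 x h.symm.le, ← h, hX]
  refine ⟨g, h0, hα.trans hβ, ?_, fun x hx => ?_, fun x hx hne => ?_, ?_, ?_⟩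
  · rw [← Icc_union_Icc_eq_Icc hα.le hβ.le]
    exact (h₁.congr fun x hx => hg1 x hx.2).union_of_isClosed (h₂.congr fun x hx => hg2 x hx.1)
      isClosed_Icc isClosed_Icc
  · rcases le_total x c.X with h | h
    · rw [hg1 x h]; exact h₁R x ⟨hx.1, h⟩
    · rw [hg2 x h]; exact h₂R x ⟨h, hx.2⟩
  · rcases lt_or_gt_of_ne hne with h | h
    · rw [hg1 x h.le]
      refine (h₁d x ⟨hx.1, h⟩).congr_of_eventuallyEq ?_
      filter_upwards [Iio_mem_nhds h] with z hz using hg1 z (le_of_lt hz)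
    · rw [hg2 x h.le]
      refine (h₂d x ⟨h, hx.2⟩).congr_of_eventuallyEq ?_
      filter_upwards [Ioi_mem_nhds h] with z hz using hg2 z (le_of_lt hz)
  · rw [hg1 α hα.le, hstart]
  · rw [hg2 β hβ.le, hterminal]

/-- Every point of the upper branch is the starting point of an arc. -/
theorem exists_arc {α : ℝ} (hα : 0 < α) : ∃ β g, c.Arc α β g := by
  rcases lt_or_ge α c.X with h | h
  · obtain ⟨y, h1, h2, h3, h4⟩ := exists_solution_to_X hα h
    -- If b < d, the left piece must end in (X, X) and is joined to the arc from there. If d < b, it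
    -- arrives strictly above the singular point, which is on the lower branch, and is continued as
    -- a regular solution.
    rcases lt_or_gt_of_ne (b_ne_d (c := c)) with hbd | hdb
    · obtain ⟨β, f, hf⟩ := exists_arc_X
      obtain ⟨g, hg⟩ := exists_glue h hf.lt h2 hf.cont h3 hf.region h4
        (fun x hx => hf.ode x hx hx.1.ne') hα h1 hf.terminal (by
          rw [hf.start, up_X_of_lt hbd]
          exact eq_X_of_region hbd (h3 c.X (right_mem_Icc.2 h.le)))
      exact ⟨β, g, hg⟩
    · have h5 := ne_X_of_region hdb h h2 h3 h4
      have hRX := h3 c.X (right_mem_Icc.2 h.le)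
      have h6 : c.X < y c.X := lt_of_le_of_ne (hRX.left le_rfl).1 h5.symm
      obtain ⟨β, hβ, f, f1, f2, f3, f4, f5⟩ := exists_solution_right (c := c) le_rfl hRX.nonneg
        (by rw [dn_X_of_lt hdb]; exact h5) fun _ => h6
      obtain ⟨g, hg⟩ := exists_glue h hβ h2 f2 h3 f3 h4 f4 hα h1 f5 f1.symm
      exact ⟨β, g, hg⟩
  · by_cases hne : α = c.X ∧ c.up α = c.X
    · rw [hne.1]; exact exists_arc_X
    · exact exists_arc_right h hne

/-! ### The integral of F / x: continuity in α and divergence at zero -/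

namespace Arc

variable {α β : ℝ} {g : ℝ → ℝ}

lemma norm_F_div_le (h : c.Arc α β g) {x x₁ x₂ : ℝ} (hx₁ : 0 < x₁) (h1 : x₁ ≤ α) (h2 : β ≤ x₂)
    (hx : x ∈ Icc α β) : ‖c.F x (g x) / x‖ ≤ c.up x₂ / x₁ / x₁ := by
  have hx0 : 0 < x := h.pos.trans_le hx.1
  have hF := (h.region x hx).F_le hx₁ (h1.trans hx.1) (hx.2.trans h2)
  rw [norm_div, Real.norm_of_nonneg hx0.le]
  have hx1 : x₁ ≤ x := h1.trans hx.1
  have : 0 ≤ c.up x₂ / x₁ := (norm_nonneg _).trans hF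
  gcongr

lemma aestronglyMeasurable (h : c.Arc α β g) :
    AEStronglyMeasurable (fun x => c.F x (g x) / x) (volume.restrict (Ioo α β)) := by
  have hS : MeasurableSet (Ioo α β \ {c.X}) := measurableSet_Ioo.diff (measurableSet_singleton _)
  have hc : ContinuousOn (fun x => c.F x (g x) / x) (Ioo α β \ {c.X}) :=
    ContinuousOn.div (continuousOn_F (s := Ioo α β \ {c.X})
      (h.cont.mono (sdiff_subset.trans Ioo_subset_Icc_self))
      (fun x hx => h.region x (Ioo_subset_Icc_self hx.1)) fun hx => hx.2 rfl) continuousOn_id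
      fun x hx => (h.pos.trans hx.1.1).ne'
  have h1 := hc.aestronglyMeasurable (μ := volume) hS
  rwa [Measure.restrict_congr_set (sdiff_null_ae_eq_self (measure_singleton _))] at h1

lemma intervalIntegrable (h : c.Arc α β g) :
    IntervalIntegrable (fun x => c.F x (g x) / x) volume α β := by
  rw [intervalIntegrable_iff_integrableOn_Ioo_of_le h.lt.le]
  refine ⟨h.aestronglyMeasurable, HasFiniteIntegral.restrict_of_bounded (c.up β / α / α)
    (by simp) ?_⟩
  filter_upwards [ae_restrict_mem measurableSet_Ioo] with x hx
  exact h.norm_F_div_le h.pos le_rfl le_rfl (Ioo_subset_Icc_self hx)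

end Arc

/-- The integral of `g' / x` depends continuously on the arc. -/
lemma tendsto_integral {β : ℝ → ℝ} {g : ℝ → ℝ → ℝ} (h : ∀ α, 0 < α → c.Arc α (β α) (g α))
    {α₀ : ℝ} (hα₀ : 0 < α₀) {l : Filter ℝ} [l.IsCountablyGenerated] (hl : l ≤ 𝓝 α₀)
    (hβ : Tendsto β l (𝓝 (β α₀)))
    (hg : ∀ x ∈ Ioo α₀ (β α₀), Tendsto (fun α => g α x) l (𝓝 (g α₀ x))) :
    Tendsto (fun α => ∫ x in α..β α, c.F x (g α x) / x) l
      (𝓝 (∫ x in α₀..β α₀, c.F x (g α₀ x) / x)) := by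
  have hind : ∀ α, 0 < α → (∫ x in α..β α, c.F x (g α x) / x) =
      ∫ x, (Ioo α (β α)).indicator (fun x => c.F x (g α x) / x) x := fun α hα => by
    rw [intervalIntegral.integral_of_le (h α hα).lt.le, integral_Ioc_eq_integral_Ioo,
      integral_indicator measurableSet_Ioo]
  -- For α near α₀ all arcs live between α₀ / 2 and the end of the arc from α₀ + 1, by `end_le_end`,
  -- so one constant dominates all integrands.
  set x₁ := α₀ / 2 with hx₁
  have hx10 : 0 < x₁ := by positivity
  set x₂ := β (α₀ + 1) with hx₂
  have hev : ∀ᶠ α in l, x₁ < α ∧ α < α₀ + 1 :=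
    hl (Ioo_mem_nhds (by linarith) (by linarith))
  rw [hind α₀ hα₀]
  have hev' : ∀ᶠ α in l, (∫ x, (Ioo α (β α)).indicator (fun x => c.F x (g α x) / x) x) =
      ∫ x in α..β α, c.F x (g α x) / x :=
    hev.mono fun α hα => (hind α (hx10.trans hα.1)).symm
  refine Tendsto.congr' hev' ?_
  refine tendsto_integral_filter_of_dominated_convergence
    ((Ioo x₁ x₂).indicator fun _ => c.up x₂ / x₁ / x₁) ?_ ?_ ?_ ?_
  · filter_upwards [hev] with α hα
    exact (aestronglyMeasurable_indicator_iff measurableSet_Ioo).2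
      (h α (hx10.trans hα.1)).aestronglyMeasurable
  · filter_upwards [hev] with α hα
    have ha := h α (hx10.trans hα.1)
    have hb : β α ≤ x₂ := ha.end_le_end (h (α₀ + 1) (by linarith)) hα.2.le
    refine Eventually.of_forall fun x => ?_
    by_cases hx : x ∈ Ioo α (β α)
    · rw [indicator_of_mem hx, indicator_of_mem (Ioo_subset_Ioo hα.1.le hb hx)]
      exact ha.norm_F_div_le hx10 hα.1.le hb (Ioo_subset_Icc_self hx)
    · rw [indicator_of_notMem hx, norm_zero]
      refine indicator_nonneg (fun y hy => ?_) x
      have : 0 < x₂ := by linarith [hy.1, hy.2]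
      have := up_pos (c := c) this.le
      positivity
  · exact (integrable_indicator_iff measurableSet_Ioo).2 (by simp)
  -- At the two end-points the indicators need not converge, and at X the function F may be
  -- discontinuous.
  · have hne : ∀ᵐ x : ℝ, x ∉ ({α₀, β α₀, c.X} : Set ℝ) :=
      (Set.toFinite _).countable.ae_notMem _
    filter_upwards [hne] with x hx
    simp only [mem_insert_iff, mem_singleton_iff, not_or] at hx
    obtain ⟨hx1, hx2, hx3⟩ := hx
    have hz : ∀ (hx0 : x ∉ Ioo α₀ (β α₀)) (_ : ∀ᶠ α in l, x ∉ Ioo α (β α)),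
        Tendsto (fun α => (Ioo α (β α)).indicator (fun x => c.F x (g α x) / x) x) l
          (𝓝 ((Ioo α₀ (β α₀)).indicator (fun x => c.F x (g α₀ x) / x) x)) := fun hx0 hx4 => by
      rw [indicator_of_notMem hx0]
      exact tendsto_const_nhds.congr' (hx4.mono fun α hα => (indicator_of_notMem hα _).symm)
    rcases lt_or_gt_of_ne hx1 with h1 | h1
    · exact hz (fun h => h1.not_gt h.1) (by
        filter_upwards [hl (Ioi_mem_nhds h1)] with α hα h' using lt_asymm hα h'.1)
    rcases lt_or_gt_of_ne hx2 with h2 | h2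
    · have hxm : x ∈ Ioo α₀ (β α₀) := ⟨h1, h2⟩
      rw [indicator_of_mem hxm]
      have hQ := (((h α₀ hα₀).region x (Ioo_subset_Icc_self hxm)).Q_pos fun h => hx3 h.1).ne'
      refine ((tendsto_F hQ (hg x hxm)).div_const x).congr' ?_
      filter_upwards [hl (Iio_mem_nhds h1), hβ.eventually (lt_mem_nhds h2)] with α h3 h4
      rw [indicator_of_mem (show x ∈ Ioo α (β α) from ⟨h3, h4⟩)]
    · exact hz (fun h => h2.not_gt h.2) (by
        filter_upwards [hβ.eventually (gt_mem_nhds h2)] with α hα h' using lt_asymm hα h'.2)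

theorem continuousOn_integral {β : ℝ → ℝ} {g : ℝ → ℝ → ℝ} (h : ∀ α, 0 < α → c.Arc α (β α) (g α)) :
    ContinuousOn (fun α => ∫ x in α..β α, c.F x (g α x) / x) (Ioi 0) := by
  intro α₀ hα₀
  have hα : 0 < α₀ := hα₀
  refine ContinuousAt.continuousWithinAt (continuousAt_iff_continuous_left'_right'.2 ⟨?_, ?_⟩)
  · obtain ⟨h1, h2⟩ := tendsto_left hα fun α h0 _ => h α h0
    exact tendsto_integral h hα nhdsWithin_le_nhds h1 h2
  · obtain ⟨h1, h2⟩ := tendsto_right hα fun α h0 => h α (hα.trans_le h0)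
    exact tendsto_integral h hα nhdsWithin_le_nhds h1 h2

lemma P_le (x u : ℝ) : c.P x u ≤ 2 * (c.mu * x + 1) * u := by
  unfold P
  nlinarith [mul_nonneg c.d_pos.le (sq_nonneg u), mul_nonneg c.b_pos.le (sq_nonneg x)]

/-- Left of the singular abscissa, `Q` is at most proportional to `x`. -/
lemma Region.Q_le {x u : ℝ} (h : c.Region x u) (hx : x ≤ c.X) :
    c.Q x u ≤ (c.b * c.up c.X + 2 * c.p * (c.mu * c.X + 1)) * x := by
  have hu := h.u_pos
  have hx0 := h.pos
  have hup : u ≤ c.up c.X := h.le_up.trans (up_le_up hx0 hx)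
  obtain ⟨h1, h2⟩ := h.left hx
  have hP : c.P x u ≤ 2 * (c.mu * c.X + 1) * u := by
    refine (P_le x u).trans ?_
    have := c.mu_pos
    gcongr
  have h4 : (u - x) * (c.b * x * (u - x) - (1 - c.p) * c.P x u) ≤ c.b * x * (u * u) := by
    have h5 := mul_nonneg (sub_nonneg.2 h1) (mul_nonneg (one_sub_p_pos (c := c)).le h.nonneg)
    have h6 : (u - x) * (u - x) ≤ u * u :=
      mul_self_le_mul_self (sub_nonneg.2 h1) (by linarith)
    have h7 := mul_le_mul_of_nonneg_left h6 (mul_nonneg c.b_pos.le hx0.le)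
    nlinarith
  refine le_of_mul_le_mul_left ?_ hu
  rw [mul_Q_eq]
  have h8 : c.b * x * (u * u) ≤ c.b * x * (u * c.up c.X) := by
    have := c.b_pos
    gcongr
  have h9 : c.p * x * c.P x u ≤ c.p * x * (2 * (c.mu * c.X + 1) * u) := by
    have := c.p_pos
    gcongr
  linarith

lemma Region.P_le_mul_F {x u : ℝ} (h : c.Region x u) (hx : x < c.X) :
    c.P x u ≤ (c.b * c.up c.X + 2 * c.p * (c.mu * c.X + 1)) / c.p * x * c.F x u := by
  have hp := c.p_pos
  have hQ := h.Q_pos fun h' => hx.ne h'.1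
  have h2 : c.F x u * c.Q x u = c.p * c.P x u := by unfold F; field_simp
  have h3 := mul_le_mul_of_nonneg_left (h.Q_le hx.le) h.F_nonneg
  rw [h2] at h3
  rw [div_mul_eq_mul_div, div_mul_eq_mul_div, le_div_iff₀ hp]
  linarith

set_option maxHeartbeats 400000 in
/-- Lower bound for the integral of `g' / x` over arcs which start near zero. -/
lemma exists_log_le_integral : ∃ A > 0, ∃ B, ∃ x₀ > 0, ∀ α β g, c.Arc α β g → α < x₀ →
    A * (-Real.log α) - B ≤ ∫ x in α..β, c.F x (g x) / x := by
  have hX := X_pos (c := c)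
  have hmu := c.mu_pos
  have hb := c.b_pos
  have hd := c.d_pos
  have hp := c.p_pos
  have huX := up_pos (c := c) hX.le
  set m := c.mu / c.d with hm
  have hm0 : 0 < m := by positivity
  -- The second bound gives 2 b x ≤ m, while u ≥ 1 / d gives 2 μ u ≥ 2 m; together `Px ≥ m` on the
  -- arc up to x₀.
  set x₀ := min (c.X / 2) (m / (2 * c.b)) with hx₀
  have hx00 : 0 < x₀ := by positivity
  have hx0X : x₀ < c.X := (min_le_left _ _).trans_lt (by linarith)
  set C := (c.b * c.up c.X + 2 * c.p * (c.mu * c.X + 1)) / c.p with hC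
  have hC0 : 0 < C := by positivity
  set C₂ := 2 * c.d * c.up c.X with hC2
  have hC20 : 0 < C₂ := by positivity
  set M := 2 * (c.mu * c.X + 1) * c.up c.X with hM
  refine ⟨m / (C + C₂), by positivity, (M / x₀ - m * Real.log x₀) / (C + C₂), x₀, hx00,
    fun α β g h hα => ?_⟩
  have hβ : x₀ < β := hx0X.trans h.X_lt
  have hsub : Icc α x₀ ⊆ Icc α β := Icc_subset_Icc_right hβ.le
  have hpos : ∀ x ∈ Icc α x₀, 0 < x := fun x hx => h.pos.trans_le hx.1
  have hR : ∀ x ∈ Icc α x₀, c.Region x (g x) := fun x hx => h.region x (hsub hx)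
  have hFc : ContinuousOn (fun x => c.F x (g x) / x) (Icc α x₀) :=
    (continuousOn_F (h.cont.mono hsub) hR fun hx => hx0X.not_ge hx.2).div continuousOn_id
      fun x hx => (hpos x hx).ne'
  have hPc : ContinuousOn (fun x => c.P x (g x)) (Icc α x₀) :=
    (continuous_P (c := c)).comp_continuousOn (continuousOn_id.prodMk (h.cont.mono hsub))
  -- The derivative of P / x contains `Px` / x ≥ m / x. Its other terms cost at most multiples of F
  -- / x: C₂ for the term with `Pu`, and C for P / x² by `Region.P_le_mul_F`. Since P vanishes at α,
  -- only -m log α grows.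
  have hint := intervalIntegral.sub_le_integral_of_hasDeriv_right_of_le (a := α) (b := x₀)
    (g := fun x => m * Real.log x - c.P x (g x) / x)
    (g' := fun x => m * x⁻¹ -
      ((c.Px x (g x) + c.Pu x (g x) * c.F x (g x)) * x - c.P x (g x) * 1) / x ^ 2)
    (φ := fun x => (C + C₂) * (c.F x (g x) / x)) hα.le
    ((continuousOn_const.mul (Real.continuousOn_log.mono fun x hx => (hpos x hx).ne')).sub
      (hPc.div continuousOn_id fun x hx => (hpos x hx).ne'))
    (fun x hx => by
      have hx0 := hpos x (Ioo_subset_Icc_self hx)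
      have h1 := h.ode x ⟨hx.1, hx.2.trans hβ⟩ (hx.2.trans hx0X).ne
      exact (((Real.hasDerivAt_log hx0.ne').const_mul m).sub
        ((hasDerivAt_P h1).div (hasDerivAt_id x) hx0.ne')).hasDerivWithinAt)
    ((continuousOn_const.mul hFc).integrableOn_Icc)
    (fun x hx => by
      have hxm := Ioo_subset_Icc_self hx
      have hx0 := hpos x hxm
      have hRx := hR x hxm
      have hF := hRx.F_nonneg
      have hu : 1 / c.d ≤ g x := (inv_d_le_up h.pos.le).trans
        (h.start ▸ h.monotoneOn (left_mem_Icc.2 h.lt.le) (hsub hxm) hx.1.le)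
      have hup : g x ≤ c.up c.X := hRx.le_up.trans (up_le_up hx0 (hx.2.trans hx0X).le)
      have hPx : m ≤ c.Px x (g x) := by
        have h1 : x ≤ m / (2 * c.b) := hx.2.le.trans (min_le_right _ _)
        rw [le_div_iff₀ (by positivity)] at h1
        have h2 : 2 * c.mu * (1 / c.d) ≤ 2 * c.mu * g x := by gcongr
        have h3 : 2 * c.mu * (1 / c.d) = 2 * m := by rw [hm]; ring
        unfold Px; linarith
      have hPu : -C₂ ≤ c.Pu x (g x) := by
        have h1 : 2 * c.d * g x ≤ C₂ := by rw [hC2]; gcongr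
        have := mul_pos hmu hx0
        unfold Pu; linarith
      have hPF : c.P x (g x) ≤ C * x * c.F x (g x) := hRx.P_le_mul_F (hx.2.trans hx0X)
      have h5 := mul_le_mul_of_nonneg_right hPu hF
      have h6 : (m * x⁻¹ - ((c.Px x (g x) + c.Pu x (g x) * c.F x (g x)) * x -
          c.P x (g x) * 1) / x ^ 2) =
          ((m - c.Px x (g x) - c.Pu x (g x) * c.F x (g x)) * x + c.P x (g x)) / x ^ 2 := by
        field_simp; ring
      have h7 : (C + C₂) * (c.F x (g x) / x) = ((C₂ * c.F x (g x)) * x +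
          C * x * c.F x (g x)) / x ^ 2 := by field_simp; ring
      rw [h6, h7]
      gcongr
      linarith)
  have hle : ∫ x in α..x₀, c.F x (g x) / x ≤ ∫ x in α..β, c.F x (g x) / x := by
    refine intervalIntegral.integral_mono_interval le_rfl hα.le hβ.le ?_ h.intervalIntegrable
    filter_upwards [ae_restrict_mem measurableSet_Ioc] with x hx
    exact div_nonneg (h.region x (Ioc_subset_Icc_self hx)).F_nonneg (h.pos.trans hx.1).le
  rw [intervalIntegral.integral_const_mul] at hint
  have hMle : c.P x₀ (g x₀) / x₀ ≤ M / x₀ := by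
    have hRx := hR x₀ (right_mem_Icc.2 hα.le)
    have h1 : c.P x₀ (g x₀) ≤ 2 * (c.mu * x₀ + 1) * g x₀ := P_le _ _
    have h2 := hRx.le_up.trans (up_le_up hx00 hx0X.le)
    have h3 := hRx.u_pos
    have h4 : 2 * (c.mu * x₀ + 1) * g x₀ ≤ M := by rw [hM]; gcongr
    gcongr
    exact h1.trans h4
  have h0 : c.P α (g α) = 0 := by rw [h.start]; exact P_up h.pos.le
  simp only [h0, zero_div, sub_zero] at hint
  have hfin : m / (C + C₂) * (-Real.log α) - (M / x₀ - m * Real.log x₀) / (C + C₂) =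
      (m * Real.log x₀ - M / x₀ - m * Real.log α) / (C + C₂) := by field_simp; ring
  rw [hfin, div_le_iff₀ (by positivity)]
  have := mul_le_mul_of_nonneg_left hle (show 0 ≤ C + C₂ by positivity)
  linarith

theorem tendsto_integral_zero {β : ℝ → ℝ} {g : ℝ → ℝ → ℝ}
    (h : ∀ α, 0 < α → c.Arc α (β α) (g α)) :
    Tendsto (fun α => ∫ x in α..β α, c.F x (g α x) / x) (𝓝[>] 0) atTop := by
  obtain ⟨A, hA, B, x₀, hx₀, hle⟩ := exists_log_le_integral (c := c)
  refine tendsto_atTop_mono' _ (f₁ := fun α => A * (-Real.log α) - B) ?_ ?_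
  · filter_upwards [Ioo_mem_nhdsGT hx₀] with α hα
    exact hle α (β α) (g α) (h α hα.1) hα.2
  · exact tendsto_atTop_add_const_right _ _
      ((tendsto_neg_atBot_atTop.comp Real.tendsto_log_nhdsGT_zero).const_mul_atTop hA)

end ReducedODE
end

/-! ### The limit at infinity as an integral over slopes -/

noncomputable section

namespace ReducedODE

variable (c : ReducedODE)

/-- The leading part of `P` along the ray `u = s x`. -/
def Y (s : ℝ) : ℝ := -c.d * s ^ 2 + 2 * c.mu * s - c.b

/-- The leading part of `u Q - p x P` along the ray `u = s x`. -/
def E (s : ℝ) : ℝ := (s - 1) * (c.b * (s - 1) - (1 - c.p) * c.Y s)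

/-- The square root of the discriminant of `Y`. -/
def rootY : ℝ := √(c.mu ^ 2 - c.b * c.d)

/-- The asymptotic slope of `up`. -/
def sUp : ℝ := (c.mu + c.rootY) / c.d

/-- The asymptotic slope of `dn`. -/
def sDn : ℝ := (c.mu - c.rootY) / c.d

variable {c}

lemma rootY_nonneg : 0 ≤ c.rootY := Real.sqrt_nonneg _

lemma rootY_sq : c.rootY ^ 2 = c.mu ^ 2 - c.b * c.d := Real.sq_sqrt (sub_nonneg.2 c.le_sq)

lemma sDn_le_sUp : c.sDn ≤ c.sUp := by
  have := rootY_nonneg (c := c)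
  have := c.d_pos
  unfold sDn sUp
  gcongr
  linarith

lemma Y_factor (s : ℝ) : c.Y s = c.d * ((c.sUp - s) * (s - c.sDn)) := by
  have hd := c.d_pos.ne'
  have h := rootY_sq (c := c)
  have h1 : c.sUp + c.sDn = 2 * c.mu / c.d := by unfold sUp sDn; field_simp; ring
  have h2 : c.sUp * c.sDn = c.b / c.d := by
    unfold sUp sDn
    field_simp
    linarith
  have : (c.sUp - s) * (s - c.sDn) = (c.sUp + c.sDn) * s - s ^ 2 - c.sUp * c.sDn := by ring
  rw [this, h1, h2]
  unfold Y
  field_simp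
  ring

lemma Y_nonneg {s : ℝ} (hs : s ∈ Icc c.sDn c.sUp) : 0 ≤ c.Y s := by
  rw [Y_factor]
  exact mul_nonneg c.d_pos.le (mul_nonneg (sub_nonneg.2 hs.2) (sub_nonneg.2 hs.1))

lemma mem_Ioo_of_Y_pos {s : ℝ} (hs : 0 < c.Y s) : s ∈ Ioo c.sDn c.sUp := by
  rw [Y_factor] at hs
  have h1 := pos_of_mul_pos_right hs c.d_pos.le
  have h := sDn_le_sUp (c := c)
  constructor
  · by_contra! h2
    nlinarith
  · by_contra! h2
    nlinarith

lemma P_mul (x s : ℝ) (hx : x ≠ 0) : c.P x (s * x) = x ^ 2 * (c.Y s + 2 * s / x) := by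
  unfold P Y
  field_simp
  ring

lemma continuous_Y : Continuous c.Y := by unfold Y; fun_prop

/-- The homogeneous version of `slack_pos_right`. -/
lemma E_ge_of_nonneg {x s : ℝ} (hx : c.X < x) (hP : 0 ≤ c.Y s + 2 * s / x) :
    min c.b c.d * (s - 1) ^ 2 ≤
      (s - 1) * (c.b * (s - 1) - (1 - c.p) * (c.Y s + 2 * s / x)) := by
  have hx0 : 0 < x := X_pos.trans hx
  have h1 : 0 ≤ c.P x (s * x) := by rw [P_mul x s hx0.ne']; positivity
  have h2 := slack_pos_right hx.le h1 fun h => hx.ne' h.1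
  rw [P_mul x s hx0.ne'] at h2
  have h3 : 0 < x ^ 3 := by positivity
  refine le_of_mul_le_mul_left ?_ h3
  calc _ = min c.b c.d * x * (s * x - x) ^ 2 := by ring
    _ ≤ _ := h2
    _ = _ := by ring

/-- Let x tend to infinity along the ray of slope s in `E_ge_of_nonneg`. -/
lemma E_ge {s : ℝ} (hs : 0 ≤ c.Y s) (hs0 : 0 ≤ s) : min c.b c.d * (s - 1) ^ 2 ≤ c.E s := by
  have h1 : Tendsto (fun x : ℝ => 2 * s / x) atTop (𝓝 0) :=
    tendsto_const_nhds.div_atTop tendsto_id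
  have h2 : Tendsto (fun x : ℝ => (s - 1) * (c.b * (s - 1) - (1 - c.p) * (c.Y s + 2 * s / x)))
      atTop (𝓝 ((s - 1) * (c.b * (s - 1) - (1 - c.p) * (c.Y s + 0)))) :=
    ((((h1.const_add _).const_mul _).const_sub _).const_mul _)
  rw [add_zero] at h2
  refine ge_of_tendsto h2 ?_
  filter_upwards [eventually_gt_atTop c.X] with x hx
  have := X_pos.trans hx
  exact E_ge_of_nonneg hx (by positivity)

/-- The slope density: along an arc, `g' / x` is close to `- w (g / x) (g / x)'` for large `x`. -/
lemma exists_density : ∃ (w : ℝ → ℝ) (C x₀ : ℝ), Continuous w ∧ c.X < x₀ ∧ 0 ≤ C ∧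
    (∀ s ∈ Icc c.sDn c.sUp, 0 < c.E s ∧ w s = c.p * c.Y s / c.E s) ∧
    ∀ x u, x₀ ≤ x → 0 ≤ c.P x u →
      w (u / x) * (u - x * c.F x u) ≤ x * c.F x u ∧
      x * c.F x u ≤ (w (u / x) + C / x) * (u - x * c.F x u) := by
  have hX := X_pos (c := c)
  have hb := c.b_pos
  have hd := c.d_pos
  have hp := c.p_pos
  have hmu := c.mu_pos
  have hq := one_sub_p_pos (c := c)
  set x₀ := c.X + 1 with hx₀
  have hx0X : c.X < x₀ := by linarith
  have hx00 : 0 < x₀ := hX.trans hx0X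
  obtain ⟨k, hk, hkx⟩ := exists_abs_sub_ge hx0X
  set m := min c.b c.d with hm
  have hm0 : 0 < m := lt_min hb hd
  set S := 2 * (c.mu + 1 / x₀) / c.d with hS
  have hS0 : 0 < S := by positivity
  -- A lower bound for E on the relevant slopes. Cutting Y off at 0 and the denominator at a makes w
  -- continuous on the whole line without changing it between the asymptotic slopes.
  set a := m * k ^ 2 with ha
  have ha0 : 0 < a := by positivity
  have hks : ∀ x s, x₀ ≤ x → 0 ≤ c.Y s + 2 * s / x → k ^ 2 ≤ (s - 1) ^ 2 := fun x s hx hs => by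
    have hx0 : 0 < x := hx00.trans_le hx
    have h1 := hkx x (s * x) hx (by rw [P_mul x s hx0.ne']; positivity)
    rw [show s * x - x = (s - 1) * x by ring, abs_mul, abs_of_pos hx0] at h1
    have h2 := le_of_mul_le_mul_right h1 hx0
    rw [← sq_abs (s - 1)]
    gcongr
  have hDn0 : ∀ s ∈ Icc c.sDn c.sUp, 0 ≤ s := fun s hs => by
    have := Y_nonneg hs
    by_contra! h
    unfold Y at this
    nlinarith [mul_pos hmu (neg_pos.2 h), mul_pos hd (sq_pos_of_neg h)]
  set E' : ℝ → ℝ := fun s => (s - 1) * (c.b * (s - 1) - (1 - c.p) * max (c.Y s) 0) with hE'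
  have hE'c : Continuous E' := by
    have := continuous_Y (c := c)
    fun_prop
  refine ⟨fun s => c.p * max (c.Y s) 0 / max (E' s) a, 2 * c.p * c.b * S / (m * a), x₀, ?_, hx0X,
    by positivity, fun s hs => ?_, fun x u hx hP => ?_⟩
  · refine Continuous.div (continuous_const.mul (continuous_Y.max continuous_const))
      (hE'c.max continuous_const) fun s => ?_
    exact (lt_max_of_lt_right ha0).ne'
  · have hY := Y_nonneg hs
    have hs0 := hDn0 s hs
    have h1 := E_ge hY hs0
    have h2 := hks x₀ s le_rfl (by positivity)
    have h3 : a ≤ c.E s := le_trans (by rw [ha]; gcongr) h1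
    have h4 : E' s = c.E s := by simp only [hE', max_eq_left hY, E]
    exact ⟨ha0.trans_le h3, by simp only [h4, max_eq_left hY, max_eq_left h3]⟩
  · have hx0 : 0 < x := hx00.trans_le hx
    have hXx : c.X < x := hx0X.trans_le hx
    set s := u / x with hs
    have hu : u = s * x := by rw [hs]; field_simp
    have hRx := region_of_right hXx hP
    have hs0 : 0 < s := div_pos hRx.u_pos hx0
    have hsS : s ≤ S := by
      rw [hs, div_le_iff₀ hx0]
      have h1 : c.mu * x + 1 ≤ (c.mu + 1 / x₀) * x := by
        have : 1 ≤ 1 / x₀ * x := by rw [one_div_mul_eq_div, le_div_iff₀ hx00]; linarith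
        linarith
      calc u ≤ 2 * (c.mu * x + 1) / c.d := hRx.le_up.trans (up_le hx0)
        _ ≤ 2 * ((c.mu + 1 / x₀) * x) / c.d := by gcongr
        _ = _ := by rw [hS]; ring
    have hPx : c.P x u = x ^ 2 * (c.Y s + 2 * s / x) := by rw [hu]; exact P_mul x s hx0.ne'
    set y := c.Y s + 2 * s / x with hy
    have hy0 : 0 ≤ y := by
      rw [hPx] at hP
      exact nonneg_of_mul_nonneg_right hP (by positivity)
    set z := max (c.Y s) 0 with hz
    have hz0 : 0 ≤ z := le_max_right _ _
    have hzy : z ≤ y := max_le (by rw [hy]; have : 0 < 2 * s / x := by positivity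
                                   linarith) hy0
    have hyz : y - z ≤ 2 * S / x := by
      have h1 : c.Y s ≤ z := le_max_left _ _
      have h2 : 2 * s / x ≤ 2 * S / x := by gcongr
      rw [hy]; linarith
    set v := s - 1 with hv
    have hm1 : m * v ^ 2 ≤ v * (c.b * v - (1 - c.p) * y) := E_ge_of_nonneg hXx hy0
    have hk1 : k ^ 2 ≤ v ^ 2 := hks x s hx hy0
    set e₁ := v * (c.b * v - (1 - c.p) * y) with he₁
    have hae : a ≤ m * v ^ 2 := by rw [ha]; gcongr
    have hE'e : E' s = v * (c.b * v - (1 - c.p) * z) := rfl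
    have hE'a : m * v ^ 2 ≤ E' s := by
      rw [hE'e]
      rcases le_total v 0 with h | h
      · have h1 : 0 ≤ -v * ((1 - c.p) * z) := mul_nonneg (neg_nonneg.2 h) (mul_nonneg hq.le hz0)
        have h2 : m * v ^ 2 ≤ c.b * v ^ 2 := by
          have : m ≤ c.b := min_le_left _ _
          gcongr
        linarith
      · refine hm1.trans ?_
        rw [he₁]
        gcongr
    have hmax : max (E' s) a = E' s := max_eq_left (hae.trans hE'a)
    have hE'0 : 0 < E' s := ha0.trans_le (hae.trans hE'a)
    have hQ := hRx.Q_pos fun h => hXx.ne' h.1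
    have hFQ : c.F x u * c.Q x u = c.p * (x ^ 2 * y) := by rw [← hPx]; unfold F; field_simp
    have hGQ : (u - x * c.F x u) * c.Q x u = x ^ 3 * e₁ := by
      calc _ = u * c.Q x u - x * (c.F x u * c.Q x u) := by ring
        _ = _ := by rw [mul_Q_eq, hFQ, hPx, hu, he₁, hv]; ring
    -- Cross difference between the density y / e₁ at finite x and its limit z / E'. Only the term
    -- with b v² survives, and y - z ≤ 2 S / x yields the error C / x.
    have hid : y * E' s - z * e₁ = c.b * v ^ 2 * (y - z) := by rw [hE'e, he₁]; ring
    have hx3 : 0 < x ^ 3 := by positivity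
    simp only [hmax]
    constructor
    · refine le_of_mul_le_mul_right ?_ hQ
      rw [mul_assoc, hGQ, mul_assoc, hFQ, div_mul_eq_mul_div, div_le_iff₀ hE'0]
      have h1 : 0 ≤ c.b * v ^ 2 * (y - z) :=
        mul_nonneg (mul_nonneg hb.le (sq_nonneg v)) (sub_nonneg.2 hzy)
      rw [← hid] at h1
      have h2 : 0 ≤ c.p * x ^ 3 * (y * E' s - z * e₁) := by positivity
      linarith
    · refine le_of_mul_le_mul_right ?_ hQ
      rw [mul_assoc, hFQ, mul_assoc, hGQ]
      have h1 : c.p * (c.b * v ^ 2 * (y - z)) ≤ c.p * (c.b * v ^ 2 * (2 * S / x)) := by gcongr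
      have h2 : c.p * (c.b * v ^ 2 * (2 * S / x)) =
          2 * c.p * c.b * S / (m * a) / x * ((m * v ^ 2) * a) := by field_simp
      have h3 : 2 * c.p * c.b * S / (m * a) / x * ((m * v ^ 2) * a) ≤
          2 * c.p * c.b * S / (m * a) / x * (e₁ * E' s) := by
        have h1 : a ≤ E' s := hae.trans hE'a
        have h2 : 0 ≤ e₁ := (mul_nonneg hm0.le (sq_nonneg v)).trans hm1
        gcongr
      have h4 : (c.p * z / E' s + 2 * c.p * c.b * S / (m * a) / x) * (x ^ 3 * e₁) =
          x ^ 3 * ((c.p * (z * e₁) + 2 * c.p * c.b * S / (m * a) / x * (e₁ * E' s)) / E' s) := by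
        field_simp
      have h5 : x * (c.p * (x ^ 2 * y)) = x ^ 3 * (c.p * y) := by ring
      rw [h4, h5]
      gcongr
      rw [le_div_iff₀ hE'0]
      rw [← hid] at h1
      linarith

lemma tendsto_root_div : Tendsto (fun x => c.root x / x) atTop (𝓝 c.rootY) := by
  have h1 : Tendsto (fun x : ℝ => 1 / x) atTop (𝓝 0) := tendsto_const_nhds.div_atTop tendsto_id
  have h2 : Tendsto (fun x : ℝ => √((c.mu + 1 / x) ^ 2 - c.b * c.d)) atTop
      (𝓝 (√((c.mu + 0) ^ 2 - c.b * c.d))) :=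
    (Real.continuous_sqrt.tendsto _).comp (((h1.const_add _).pow 2).sub_const _)
  rw [add_zero] at h2
  refine h2.congr' ?_
  filter_upwards [eventually_gt_atTop 0] with x hx
  rw [root, eq_div_iff hx.ne', ← Real.sqrt_sq hx.le, ← Real.sqrt_mul' _ (sq_nonneg x),
    Real.sqrt_sq hx.le]
  congr 1
  field_simp

lemma tendsto_up_div : Tendsto (fun x => c.up x / x) atTop (𝓝 c.sUp) := by
  have h1 : Tendsto (fun x : ℝ => 1 / x) atTop (𝓝 0) := tendsto_const_nhds.div_atTop tendsto_id
  have h2 := ((h1.const_add c.mu).add (tendsto_root_div (c := c))).div_const c.d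
  rw [add_zero] at h2
  refine h2.congr' ?_
  filter_upwards [eventually_gt_atTop 0] with x hx
  unfold up
  field_simp

lemma tendsto_dn_div : Tendsto (fun x => c.dn x / x) atTop (𝓝 c.sDn) := by
  have h1 : Tendsto (fun x : ℝ => 1 / x) atTop (𝓝 0) := tendsto_const_nhds.div_atTop tendsto_id
  have h2 := ((h1.const_add c.mu).sub (tendsto_root_div (c := c))).div_const c.d
  rw [add_zero] at h2
  refine h2.congr' ?_
  filter_upwards [eventually_gt_atTop 0] with x hx
  unfold dn
  field_simp

/-- With W a primitive of w, the function -W(g / x) has derivative close to F / x, with an error C /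
α times the decrease of g / x. At the ends g / x is `up` or `dn` divided by x, so the integral is
squeezed. -/
theorem tendsto_integral_atTop {β : ℝ → ℝ} {g : ℝ → ℝ → ℝ}
    (h : ∀ α, 0 < α → c.Arc α (β α) (g α)) :
    Tendsto (fun α => ∫ x in α..β α, c.F x (g α x) / x) atTop
      (𝓝 (∫ s in c.sDn..c.sUp, c.p * c.Y s / c.E s)) := by
  obtain ⟨w, C, x₀, hw, hx₀, hC, hwE, hwx⟩ := exists_density (c := c)
  have hx00 : 0 < x₀ := X_pos.trans hx₀
  set W : ℝ → ℝ := fun s => ∫ t in (0 : ℝ)..s, w t with hW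
  have hWd : ∀ s, HasDerivAt W (w s) s := fun s => hw.integral_hasStrictDerivAt 0 s |>.hasDerivAt
  have hWc : Continuous W := continuous_iff_continuousAt.2 fun s => (hWd s).continuousAt
  have hint : ∫ s in c.sDn..c.sUp, c.p * c.Y s / c.E s = W c.sUp - W c.sDn := by
    rw [hW, intervalIntegral.integral_interval_sub_left (hw.intervalIntegrable _ _)
      (hw.intervalIntegrable _ _)]
    refine intervalIntegral.integral_congr fun s hs => ?_
    rw [uIcc_of_le sDn_le_sUp] at hs
    exact (hwE s hs).2.symm
  have hβ : Tendsto β atTop atTop :=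
    tendsto_atTop_mono' _ (by
      filter_upwards [eventually_gt_atTop 0] with α hα using (h α hα).lt.le) tendsto_id
  have hUp := tendsto_up_div (c := c)
  have hDn := (tendsto_dn_div (c := c)).comp hβ
  have hlow : Tendsto (fun α => W (c.up α / α) - W (c.dn (β α) / β α)) atTop
      (𝓝 (W c.sUp - W c.sDn)) :=
    ((hWc.tendsto _).comp hUp).sub ((hWc.tendsto _).comp hDn)
  have hCα : Tendsto (fun α : ℝ => C / α) atTop (𝓝 0) := tendsto_const_nhds.div_atTop tendsto_id
  have hhigh : Tendsto (fun α => (W (c.up α / α) - W (c.dn (β α) / β α)) +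
      C / α * (c.up α / α - c.dn (β α) / β α)) atTop
      (𝓝 ((W c.sUp - W c.sDn) + 0 * (c.sUp - c.sDn))) :=
    hlow.add (hCα.mul (hUp.sub hDn))
  rw [zero_mul, add_zero] at hhigh
  rw [hint]
  have key : ∀ᶠ α in atTop,
      W (c.up α / α) - W (c.dn (β α) / β α) ≤ ∫ x in α..β α, c.F x (g α x) / x ∧
      ∫ x in α..β α, c.F x (g α x) / x ≤ (W (c.up α / α) - W (c.dn (β α) / β α)) +
        C / α * (c.up α / α - c.dn (β α) / β α) := by
    filter_upwards [eventually_ge_atTop x₀] with α hα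
    have hα0 : 0 < α := hx00.trans_le hα
    have ha := h α hα0
    have hpos : ∀ x ∈ Icc α (β α), 0 < x := fun x hx => hα0.trans_le hx.1
    have hsc : ContinuousOn (fun x => g α x / x) (Icc α (β α)) :=
      ha.cont.div continuousOn_id fun x hx => (hpos x hx).ne'
    have hsd : ∀ x ∈ Ioo α (β α), HasDerivAt (fun x => g α x / x)
        ((c.F x (g α x) * x - g α x * 1) / x ^ 2) x := fun x hx => by
      have hx0 := hpos x (Ioo_subset_Icc_self hx)
      exact (ha.ode x hx (hx₀.trans_le (hα.trans hx.1.le)).ne').div (hasDerivAt_id x) hx0.ne'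
    have hFi : IntegrableOn (fun x => c.F x (g α x) / x) (Icc α (β α)) :=
      (intervalIntegrable_iff_integrableOn_Icc_of_le ha.lt.le).1 ha.intervalIntegrable
    have hWs : ContinuousOn (fun x => -W (g α x / x)) (Icc α (β α)) :=
      (hWc.comp_continuousOn hsc).neg
    constructor
    · have := intervalIntegral.sub_le_integral_of_hasDeriv_right_of_le ha.lt.le hWs
        (fun x hx => (((hWd _).comp x (hsd x hx)).neg).hasDerivWithinAt) hFi fun x hx => by
          have hx0 := hpos x (Ioo_subset_Icc_self hx)
          have h1 := (hwx x (g α x) (hα.trans hx.1.le)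
            (ha.region x (Ioo_subset_Icc_self hx)).nonneg).1
          have h2 : -(w (g α x / x) * ((c.F x (g α x) * x - g α x * 1) / x ^ 2)) =
            w (g α x / x) * (g α x - x * c.F x (g α x)) / x ^ 2 := by ring
          have h3 : c.F x (g α x) / x = x * c.F x (g α x) / x ^ 2 := by field_simp
          rw [h2, h3]
          gcongr
      rw [ha.start, ha.terminal] at this
      linarith
    · have := intervalIntegral.integral_le_sub_of_hasDeriv_right_of_le ha.lt.le
        (hWs.sub (hsc.const_mul (C / α)))
        (fun x hx => ((((hWd _).comp x (hsd x hx)).neg).sub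
          ((hsd x hx).const_mul (C / α))).hasDerivWithinAt) hFi fun x hx => by
          have hx0 := hpos x (Ioo_subset_Icc_self hx)
          have hRx := ha.region x (Ioo_subset_Icc_self hx)
          have h1 := (hwx x (g α x) (hα.trans hx.1.le) hRx.nonneg).2
          have h2 : -(w (g α x / x) * ((c.F x (g α x) * x - g α x * 1) / x ^ 2)) -
            C / α * ((c.F x (g α x) * x - g α x * 1) / x ^ 2) =
            (w (g α x / x) + C / α) * (g α x - x * c.F x (g α x)) / x ^ 2 := by ring
          have h3 : c.F x (g α x) / x = x * c.F x (g α x) / x ^ 2 := by field_simp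
          have h4 : 0 ≤ g α x - x * c.F x (g α x) := sub_nonneg.2 hRx.x_mul_F_le
          rw [h2, h3]
          have h5 : C / x ≤ C / α := by have := hx.1.le; gcongr
          refine div_le_div_of_nonneg_right (h1.trans ?_) (sq_nonneg x)
          gcongr
      simp only [Pi.sub_apply] at this
      rw [ha.start, ha.terminal] at this
      linarith
  exact tendsto_of_tendsto_of_tendsto_of_le_of_le' hlow hhigh (key.mono fun _ h => h.1)
    (key.mono fun _ h => h.2)

end ReducedODE
end

/-! ### Slopes of the level curves and the change of variables to k -/

noncomputable section

namespace ReducedODE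

variable (c : ReducedODE)

/-- The leading part of `Q` along the ray `u = s x`. -/
def Qlead (s : ℝ) : ℝ := -(1 - c.p) * c.Y s + (c.b - c.d) * s + 2 * (c.mu - c.b)

/-- The coefficients of `k ↦ k Q - p P` along rays. -/
def lvA (k : ℝ) : ℝ := c.d * (c.p + (1 - c.p) * k)

def lvB (k : ℝ) : ℝ := 2 * c.mu * (c.p + (1 - c.p) * k) - k * (c.b - c.d)

def lvC (k : ℝ) : ℝ := c.b * (c.p + (1 - c.p) * k) + 2 * k * (c.mu - c.b)

def lvDisc (k : ℝ) : ℝ := c.lvB k ^ 2 - 4 * c.lvA k * c.lvC k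

/-- The larger asymptotic slope of the level curve `F = k`. -/
def lvUp (k : ℝ) : ℝ := (c.lvB k + √(c.lvDisc k)) / (2 * c.lvA k)

/-- The smaller asymptotic slope of the level curve `F = k`. -/
def lvDn (k : ℝ) : ℝ := (c.lvB k - √(c.lvDisc k)) / (2 * c.lvA k)

/-- The largest level with asymptotic slopes. -/
def kMax : ℝ := c.p * (c.mu - √(c.b * c.d)) / (c.e + c.p * (c.mu - √(c.b * c.d)))

variable {c}

lemma quad_eq (k s : ℝ) :
    c.lvA k * s ^ 2 - c.lvB k * s + c.lvC k = k * c.Qlead s - c.p * c.Y s := by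
  unfold lvA lvB lvC Qlead Y; ring

/-- The leading part of `mul_Q_eq` along rays; it links the density in s to the level k. -/
lemma mul_Qlead (s : ℝ) : s * c.Qlead s = c.E s + c.p * c.Y s := by
  unfold Qlead E Y; ring

lemma lvA_pos {k : ℝ} (hk : 0 ≤ k) : 0 < c.lvA k := by
  have := c.p_pos
  have := c.d_pos
  have := mul_nonneg (one_sub_p_pos (c := c)).le hk
  unfold lvA; positivity

lemma quad_factor {k : ℝ} (hk : 0 ≤ k) (hD : 0 ≤ c.lvDisc k) (s : ℝ) :
    c.lvA k * s ^ 2 - c.lvB k * s + c.lvC k = c.lvA k * ((s - c.lvUp k) * (s - c.lvDn k)) := by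
  have hA := (lvA_pos (c := c) hk).ne'
  have h1 : c.lvUp k + c.lvDn k = c.lvB k / c.lvA k := by unfold lvUp lvDn; field_simp; ring
  have h2 : c.lvUp k * c.lvDn k = c.lvC k / c.lvA k := by
    have : c.lvUp k * c.lvDn k = (c.lvB k ^ 2 - √(c.lvDisc k) ^ 2) / (4 * c.lvA k ^ 2) := by
      unfold lvUp lvDn; field_simp; ring
    rw [this, Real.sq_sqrt hD, lvDisc]
    field_simp
    ring
  have : (s - c.lvUp k) * (s - c.lvDn k) =
      s ^ 2 - (c.lvUp k + c.lvDn k) * s + c.lvUp k * c.lvDn k := by ring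
  rw [this, h1, h2]
  field_simp

lemma lvDn_le_lvUp {k : ℝ} (hk : 0 ≤ k) : c.lvDn k ≤ c.lvUp k := by
  have := lvA_pos (c := c) hk
  have := Real.sqrt_nonneg (c.lvDisc k)
  unfold lvUp lvDn
  gcongr
  linarith

lemma lvUp_zero : c.lvUp 0 = c.sUp := by
  have hp := c.p_pos
  have hd := c.d_pos
  have h : c.lvDisc 0 = (2 * c.p) ^ 2 * (c.mu ^ 2 - c.b * c.d) := by
    unfold lvDisc lvA lvB lvC; ring
  rw [lvUp, h, Real.sqrt_mul (sq_nonneg _), Real.sqrt_sq (by positivity), sUp, rootY, lvA, lvB]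
  simp only [mul_zero, add_zero, zero_mul, sub_zero]
  field_simp

lemma lvDn_zero : c.lvDn 0 = c.sDn := by
  have hp := c.p_pos
  have hd := c.d_pos
  have h : c.lvDisc 0 = (2 * c.p) ^ 2 * (c.mu ^ 2 - c.b * c.d) := by
    unfold lvDisc lvA lvB lvC; ring
  rw [lvDn, h, Real.sqrt_mul (sq_nonneg _), Real.sqrt_sq (by positivity), sDn, rootY, lvA, lvB]
  simp only [mul_zero, add_zero, zero_mul, sub_zero]
  field_simp

lemma continuousOn_lvUp (k₁ : ℝ) : ContinuousOn c.lvUp (Icc 0 k₁) := by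
  unfold lvUp
  refine ContinuousOn.div ?_ ?_ fun k hk => by linarith [lvA_pos (c := c) hk.1]
  · unfold lvDisc lvA lvB lvC; fun_prop
  · unfold lvA; fun_prop

lemma continuousOn_lvDn (k₁ : ℝ) : ContinuousOn c.lvDn (Icc 0 k₁) := by
  unfold lvDn
  refine ContinuousOn.div ?_ ?_ fun k hk => by linarith [lvA_pos (c := c) hk.1]
  · unfold lvDisc lvA lvB lvC; fun_prop
  · unfold lvA; fun_prop

lemma differentiableAt_coeffs (k : ℝ) : DifferentiableAt ℝ c.lvA k ∧ DifferentiableAt ℝ c.lvB k ∧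
    DifferentiableAt ℝ c.lvC k ∧ DifferentiableAt ℝ c.lvDisc k := by
  refine ⟨?_, ?_, ?_, ?_⟩
  · unfold lvA; fun_prop
  · unfold lvB; fun_prop
  · unfold lvC; fun_prop
  · unfold lvDisc lvA lvB lvC; fun_prop

/-- The derivative of a differentiable branch of the level slopes. -/
lemma deriv_branch {l : ℝ → ℝ} {k : ℝ} (hl : DifferentiableAt ℝ l k)
    (h : ∀ᶠ κ in 𝓝 k, c.lvA κ * l κ ^ 2 - c.lvB κ * l κ + c.lvC κ = 0) :
    (2 * c.lvA k * l k - c.lvB k) * deriv l k = -c.Qlead (l k) := by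
  have hl' := hl.hasDerivAt
  have hA : HasDerivAt c.lvA (c.d * ((1 - c.p) * 1)) k :=
    (((hasDerivAt_id k).const_mul (1 - c.p)).const_add c.p).const_mul c.d
  have hB : HasDerivAt c.lvB (2 * c.mu * ((1 - c.p) * 1) - 1 * (c.b - c.d)) k :=
    ((((hasDerivAt_id k).const_mul (1 - c.p)).const_add c.p).const_mul (2 * c.mu)).sub
      ((hasDerivAt_id k).mul_const _)
  have hC : HasDerivAt c.lvC (c.b * ((1 - c.p) * 1) + 2 * 1 * (c.mu - c.b)) k :=
    ((((hasDerivAt_id k).const_mul (1 - c.p)).const_add c.p).const_mul c.b).add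
      (((hasDerivAt_id k).const_mul 2).mul_const _)
  have h1 := ((hA.mul (hl'.fun_pow 2)).sub (hB.mul hl')).add hC
  have h2 := ((hasDerivAt_const k (0 : ℝ)).congr_of_eventuallyEq h).unique h1
  unfold Qlead Y
  push_cast at h2
  simp only [pow_one] at h2
  linarith

/-- The equation at the largest level. -/
lemma kMax_spec : 0 ≤ c.kMax ∧ c.lvDisc c.kMax = 0 ∧ (c.kMax = 0 → c.sDn = c.sUp) ∧
    (0 < c.kMax → ∃ s, 0 < c.Y s ∧
      ∀ x, c.lvA c.kMax * x ^ 2 - c.lvB c.kMax * x + c.lvC c.kMax = c.lvA c.kMax * (x - s) ^ 2) := by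
  have hb := c.b_pos
  have hd := c.d_pos
  have hp := c.p_pos
  have he := e_pos (c := c)
  have hq := one_sub_p_pos (c := c)
  -- With b = β², d = γ² and μ = βγ + m, the quantities at the largest level, including the double
  -- root s below, are rational in β, γ, m and p.
  obtain ⟨β, hβ, hbβ⟩ : ∃ β > 0, c.b = β ^ 2 := ⟨√c.b, Real.sqrt_pos.2 hb, (Real.sq_sqrt hb.le).symm⟩
  obtain ⟨γ, hγ, hdγ⟩ : ∃ γ > 0, c.d = γ ^ 2 := ⟨√c.d, Real.sqrt_pos.2 hd, (Real.sq_sqrt hd.le).symm⟩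
  have hsq : √(c.b * c.d) = β * γ := by
    rw [hbβ, hdγ, ← mul_pow, Real.sqrt_sq (by positivity)]
  have hm0 : 0 ≤ c.mu - √(c.b * c.d) := sub_nonneg.2 (Real.sqrt_le_iff.2 ⟨c.mu_pos.le, c.le_sq⟩)
  obtain ⟨m, hm⟩ : ∃ m, m = c.mu - √(c.b * c.d) := ⟨_, rfl⟩
  rw [← hm] at hm0
  have hmu : c.mu = β * γ + m := by rw [hm, hsq]; ring
  have hK : c.kMax = c.p * m / (c.e + c.p * m) := by rw [kMax, ← hm]
  have hee : c.e = (γ - β) ^ 2 / 2 - m := by unfold e; rw [hbβ, hdγ, hmu]; ring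
  have hden : 0 < c.e + c.p * m := by positivity
  have hε : γ - β ≠ 0 := by
    intro h
    rw [h] at hee
    linarith
  have hr : c.p + (1 - c.p) * c.kMax = c.p * (γ - β) ^ 2 / (2 * (c.e + c.p * m)) := by
    have : (γ - β) ^ 2 = 2 * (c.e + m) := by rw [hee]; ring
    rw [hK, this]
    field_simp
    ring
  set s := β / γ + 2 * m / (γ * (γ - β)) with hs
  have hAK : c.lvA c.kMax = γ ^ 2 * (c.p * (γ - β) ^ 2 / (2 * (c.e + c.p * m))) := by
    rw [lvA, hr, hdγ]
  have hBK : c.lvB c.kMax = 2 * c.lvA c.kMax * s := by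
    rw [hAK, lvB, hr, hbβ, hdγ, hmu, hK, hs]
    field_simp
    ring
  have hCK : c.lvC c.kMax = c.lvA c.kMax * s ^ 2 := by
    rw [hAK, lvC, hr, hbβ, hmu, hK, hs]
    field_simp
    ring
  refine ⟨by rw [hK]; positivity, ?_, fun h0 => ?_, fun h0 => ⟨s, ?_, fun x => ?_⟩⟩
  · rw [lvDisc, hBK, hCK]; ring
  · have hm1 : m = 0 := by
      rw [hK, div_eq_zero_iff] at h0
      rcases h0 with h0 | h0
      · exact (mul_eq_zero.1 h0).resolve_left hp.ne'
      · exact absurd h0 hden.ne'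
    have : c.rootY = 0 := by
      rw [rootY, hbβ, hdγ, hmu, hm1, Real.sqrt_eq_zero']
      apply le_of_eq; ring
    rw [sDn, sUp, this, sub_zero, add_zero]
  · have hm1 : 0 < m := by
      rcases hm0.lt_or_eq with h | h
      · exact h
      · rw [hK, ← h] at h0; simp at h0
    have hY : c.Y s = 4 * m * β * c.e / (γ * (γ - β) ^ 2) := by
      rw [Y, hee, hbβ, hdγ, hmu, hs]
      field_simp
      ring
    rw [hY]
    have : 0 < (γ - β) ^ 2 := by positivity
    positivity
  · rw [hBK, hCK]; ring

lemma Qlead_pos {s : ℝ} (hs : s ∈ Icc c.sDn c.sUp) (hE : 0 < c.E s) : 0 < c.Qlead s := by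
  have hY := Y_nonneg hs
  have hs0 : 0 < s := by
    have := c.d_pos; have := c.b_pos; have := c.mu_pos
    by_contra! h
    unfold Y at hY
    nlinarith [mul_nonneg c.mu_pos.le (neg_nonneg.2 h), mul_nonneg c.d_pos.le (sq_nonneg s)]
  have h := mul_Qlead (c := c) s
  have h1 : 0 < s * c.Qlead s := by
    rw [h]
    have := mul_nonneg c.p_pos.le hY
    linarith
  exact pos_of_mul_pos_right h1 hs0.le

/-- Below the largest level, the slopes are simple and lie between those of the branches of
`P = 0`. -/
lemma lv_mem {k : ℝ} (h0 : 0 ≤ k) (hk : k < c.kMax) : 0 < c.lvDisc k ∧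
    c.lvUp k ∈ Icc c.sDn c.sUp ∧ c.lvDn k ∈ Icc c.sDn c.sUp := by
  obtain ⟨w, C, x₀, -, -, -, hwE, -⟩ := exists_density (c := c)
  obtain ⟨-, -, -, h⟩ := kMax_spec (c := c)
  obtain ⟨s, hs, hsq⟩ := h (h0.trans_lt hk)
  have hsm := mem_Ioo_of_Y_pos hs
  have hle := sDn_le_sUp (c := c)
  have hQ := Qlead_pos (Ioo_subset_Icc_self hsm) (hwE s (Ioo_subset_Icc_self hsm)).1
  have hA := lvA_pos (c := c) h0
  -- At the double root s for `kMax` the quadratic k Q - p Y vanishes; lowering k makes it negative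
  -- since Q > 0 there. Hence the two roots for k are separated by s.
  have hneg : c.lvA k * s ^ 2 - c.lvB k * s + c.lvC k < 0 := by
    have h1 := hsq s
    rw [quad_eq, sub_self, zero_pow two_ne_zero, mul_zero] at h1
    rw [quad_eq]
    have := mul_lt_mul_of_pos_right hk hQ
    linarith
  have hD : 0 < c.lvDisc k := by
    have h1 : c.lvDisc k = (2 * c.lvA k * s - c.lvB k) ^ 2 -
      4 * c.lvA k * (c.lvA k * s ^ 2 - c.lvB k * s + c.lvC k) := by unfold lvDisc; ring
    rw [h1]
    have := mul_pos hA (neg_pos.2 hneg)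
    nlinarith [sq_nonneg (2 * c.lvA k * s - c.lvB k)]
  have hle' := lvDn_le_lvUp (c := c) h0
  -- At the asymptotic slopes of P = 0 the quadratic equals k Q ≥ 0, so these slopes are not
  -- strictly between the roots.
  have hend : ∀ t ∈ Icc c.sDn c.sUp, c.Y t = 0 → 0 ≤ (t - c.lvUp k) * (t - c.lvDn k) :=
    fun t ht hYt => by
    have h1 := quad_factor (c := c) h0 hD.le t
    rw [quad_eq, hYt, mul_zero, sub_zero] at h1
    have h2 := mul_nonneg h0 (Qlead_pos ht (hwE t ht).1).le
    rw [h1] at h2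
    exact nonneg_of_mul_nonneg_right h2 hA
  have hs1 : (s - c.lvUp k) * (s - c.lvDn k) < 0 := by
    rw [quad_factor h0 hD.le] at hneg
    by_contra! h
    have := mul_nonneg hA.le h
    linarith
  have hU := hend c.sUp (right_mem_Icc.2 hle) (by rw [Y_factor]; ring)
  have hDn := hend c.sDn (left_mem_Icc.2 hle) (by rw [Y_factor]; ring)
  have hsU : s < c.lvUp k := by
    by_contra! h
    nlinarith
  have hsD : c.lvDn k < s := by
    by_contra! h
    nlinarith
  have h3 : c.lvUp k ≤ c.sUp := by
    by_contra! h
    nlinarith [hsm.2]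
  have h4 : c.sDn ≤ c.lvDn k := by
    by_contra! h
    nlinarith [hsm.1]
  exact ⟨hD, ⟨by linarith, h3⟩, ⟨h4, by linarith⟩⟩

/-- The integrand in the variable `k`. -/
def lvIntegrand (c : ReducedODE) (k : ℝ) : ℝ :=
  k * (deriv c.lvUp k / (k - c.lvUp k) - deriv c.lvDn k / (k - c.lvDn k))

/-- On the level `k`, the slope density is `k / (s - k)`. -/
lemma density_eq {k s : ℝ} (hs : s ∈ Icc c.sDn c.sUp) (hE : 0 < c.E s)
    (hq : c.lvA k * s ^ 2 - c.lvB k * s + c.lvC k = 0) :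
    k < s ∧ c.p * c.Y s / c.E s = k / (s - k) := by
  have hQ := Qlead_pos hs hE
  rw [quad_eq] at hq
  have h1 : c.p * c.Y s = k * c.Qlead s := by linarith
  have h2 : c.E s = (s - k) * c.Qlead s := by
    have := mul_Qlead (c := c) s
    linarith
  have h3 : 0 < s - k := pos_of_mul_pos_left (h2 ▸ hE) hQ.le
  refine ⟨by linarith, ?_⟩
  rw [h1, h2, mul_div_mul_right _ _ hQ.ne']

/-- Integration over slopes and integration over levels give the same result. -/
theorem integral_lvIntegrand : IntervalIntegrable c.lvIntegrand volume 0 c.kMax ∧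
    ∫ k in (0 : ℝ)..c.kMax, c.lvIntegrand k = ∫ s in c.sDn..c.sUp, c.p * c.Y s / c.E s := by
  obtain ⟨w, C, x₀, hw, -, -, hwE, -⟩ := exists_density (c := c)
  obtain ⟨hK0, hKD, hK1, -⟩ := kMax_spec (c := c)
  set W : ℝ → ℝ := fun s => ∫ t in (0 : ℝ)..s, w t with hW
  have hWd : ∀ s, HasDerivAt W (w s) s := fun s => hw.integral_hasStrictDerivAt 0 s |>.hasDerivAt
  have hWc : Continuous W := continuous_iff_continuousAt.2 fun s => (hWd s).continuousAt
  have hint : ∫ s in c.sDn..c.sUp, c.p * c.Y s / c.E s = W c.sUp - W c.sDn := by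
    rw [hW, intervalIntegral.integral_interval_sub_left (hw.intervalIntegrable _ _)
      (hw.intervalIntegrable _ _)]
    refine intervalIntegral.integral_congr fun s hs => ?_
    rw [uIcc_of_le sDn_le_sUp] at hs
    exact (hwE s hs).2.symm
  -- By `density_eq` and the chain rule H is a primitive of the integrand. It vanishes at `kMax`,
  -- where the slopes merge, and at 0 it is minus the integral over slopes.
  set H : ℝ → ℝ := fun k => W (c.lvDn k) - W (c.lvUp k) with hH
  have hHc : ContinuousOn H (Icc 0 c.kMax) :=
    (hWc.comp_continuousOn (continuousOn_lvDn _)).sub (hWc.comp_continuousOn (continuousOn_lvUp _))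
  have hder : ∀ k ∈ Ioo 0 c.kMax, HasDerivAt H (c.lvIntegrand k) k ∧ 0 ≤ c.lvIntegrand k := by
    intro k hk
    obtain ⟨hD, hU, hDn⟩ := lv_mem hk.1.le hk.2
    have hA := lvA_pos (c := c) hk.1.le
    obtain ⟨dA, dB, dC, dD⟩ := differentiableAt_coeffs (c := c) k
    have hlU : DifferentiableAt ℝ c.lvUp k :=
      (dB.add (dD.sqrt hD.ne')).div (dA.const_mul 2) (by linarith)
    have hlD : DifferentiableAt ℝ c.lvDn k :=
      (dB.sub (dD.sqrt hD.ne')).div (dA.const_mul 2) (by linarith)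
    have hev : ∀ᶠ κ in 𝓝 k, 0 ≤ κ ∧ 0 ≤ c.lvDisc κ := by
      filter_upwards [Ioo_mem_nhds hk.1 hk.2] with κ hκ
      exact ⟨hκ.1.le, (lv_mem hκ.1.le hκ.2).1.le⟩
    have eU : ∀ᶠ κ in 𝓝 k, c.lvA κ * c.lvUp κ ^ 2 - c.lvB κ * c.lvUp κ + c.lvC κ = 0 :=
      hev.mono fun κ hκ => by rw [quad_factor hκ.1 hκ.2]; ring
    have eD : ∀ᶠ κ in 𝓝 k, c.lvA κ * c.lvDn κ ^ 2 - c.lvB κ * c.lvDn κ + c.lvC κ = 0 :=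
      hev.mono fun κ hκ => by rw [quad_factor hκ.1 hκ.2]; ring
    have bU := deriv_branch hlU eU
    have bD := deriv_branch hlD eD
    obtain ⟨oU, rU⟩ := density_eq hU (hwE _ hU).1 eU.self_of_nhds
    obtain ⟨oD, rD⟩ := density_eq hDn (hwE _ hDn).1 eD.self_of_nhds
    have sU : 2 * c.lvA k * c.lvUp k - c.lvB k = √(c.lvDisc k) := by
      unfold lvUp; field_simp; ring
    have sD : 2 * c.lvA k * c.lvDn k - c.lvB k = -√(c.lvDisc k) := by
      unfold lvDn; field_simp; ring
    rw [sU] at bU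
    rw [sD] at bD
    have hroot := Real.sqrt_pos.2 hD
    have qU := Qlead_pos hU (hwE _ hU).1
    have qD := Qlead_pos hDn (hwE _ hDn).1
    have nU : deriv c.lvUp k ≤ 0 := by
      by_contra! h
      have := mul_pos hroot h
      linarith
    have nD : 0 ≤ deriv c.lvDn k := by
      by_contra! h
      have := mul_pos_of_neg_of_neg (neg_neg_of_pos hroot) h
      linarith
    have hUne : c.lvUp k - k ≠ 0 := by linarith
    have hDne : c.lvDn k - k ≠ 0 := by linarith
    have hval : c.lvIntegrand k = k / (c.lvDn k - k) * deriv c.lvDn k -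
        k / (c.lvUp k - k) * deriv c.lvUp k := by
      unfold lvIntegrand
      rw [← neg_sub (c.lvUp k) k, ← neg_sub (c.lvDn k) k, div_neg, div_neg]
      ring
    rw [hval]
    constructor
    · have h1 := ((hWd (c.lvDn k)).comp k hlD.hasDerivAt).sub ((hWd (c.lvUp k)).comp k hlU.hasDerivAt)
      rwa [(hwE _ hU).2, (hwE _ hDn).2, rU, rD] at h1
    · have h1 : 0 ≤ k / (c.lvDn k - k) := div_nonneg hk.1.le (by linarith)
      have h2 : 0 ≤ k / (c.lvUp k - k) := div_nonneg hk.1.le (by linarith)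
      have h3 := mul_nonneg h1 nD
      have h4 := mul_nonneg h2 (neg_nonneg.2 nU)
      linarith
  have hii : IntervalIntegrable c.lvIntegrand volume 0 c.kMax := by
    rw [intervalIntegrable_iff_integrableOn_Ioc_of_le hK0]
    -- A nonnegative derivative of a continuous function is integrable, so no bound on the slopes'
    -- derivatives is needed near `kMax`, where the discriminant vanishes.
    exact intervalIntegral.integrableOn_deriv_of_nonneg hHc (fun k hk => (hder k hk).1)
      fun k hk => (hder k hk).2
  refine ⟨hii, ?_⟩
  rw [intervalIntegral.integral_eq_sub_of_hasDerivAt_of_le hK0 hHc (fun k hk => (hder k hk).1) hii,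
    hint]
  have h1 : c.lvUp c.kMax = c.lvDn c.kMax := by
    unfold lvUp lvDn; rw [hKD, Real.sqrt_zero, add_zero, sub_zero]
  simp only [hH, h1, lvUp_zero, lvDn_zero]
  ring

lemma Arc.congr {α β : ℝ} {f g : ℝ → ℝ} (h : c.Arc α β f) (hfg : EqOn g f (Icc α β)) :
    c.Arc α β g := by
  refine ⟨h.pos, h.lt, h.cont.congr hfg, fun x hx => ?_, fun x hx hne => ?_, ?_, ?_⟩
  · rw [hfg hx]; exact h.region x hx
  · rw [hfg (Ioo_subset_Icc_self hx)]
    refine (h.ode x hx hne).congr_of_eventuallyEq ?_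
    filter_upwards [Ioo_mem_nhds hx.1 hx.2] with y hy using hfg (Ioo_subset_Icc_self hy)
  · rw [hfg (left_mem_Icc.2 h.lt.le)]; exact h.start
  · rw [hfg (right_mem_Icc.2 h.lt.le)]; exact h.terminal

end ReducedODE

/-! ### Translation to the original coordinates -/

namespace Market

/-- The standing assumptions on the parameters. -/
structure Admissible (m : Market) : Prop where
  mu_pos : 0 < m.mu
  sigma_pos : 0 < m.sigma
  delta_pos : 0 < m.delta
  p_pos : 0 < m.p
  p_lt : m.p < 1
  gMean_le : m.gMean ≤ m.mu
  lt_aMean : m.mu < m.aMean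

variable {m : Market}

namespace Admissible

lemma one_sub_p_pos (h : m.Admissible) : 0 < 1 - m.p := sub_pos.2 h.p_lt

lemma q_pos (h : m.Admissible) : 0 < m.q := div_pos h.p_pos h.one_sub_p_pos

lemma q_mul (h : m.Admissible) : m.q * (1 - m.p) = m.p := div_mul_cancel₀ _ h.one_sub_p_pos.ne'

lemma gMean_eq (h : m.Admissible) :
    m.gMean = √((1 - m.p) * m.sigma ^ 2 * (2 * m.delta / m.p)) := by
  have := h.p_pos
  rw [gMean]
  congr 1
  field_simp

/-- The equation in the coordinate `u = q z`. -/
def ode (h : m.Admissible) : ReducedODE where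
  p := m.p
  mu := m.mu
  b := (1 - m.p) * m.sigma ^ 2
  d := 2 * m.delta / m.p
  p_pos := h.p_pos
  p_lt := h.p_lt
  mu_pos := h.mu_pos
  b_pos := mul_pos h.one_sub_p_pos (pow_pos h.sigma_pos 2)
  d_pos := div_pos (mul_pos two_pos h.delta_pos) h.p_pos
  le_sq := (Real.sqrt_le_iff.1 (h.gMean_eq ▸ h.gMean_le)).2
  lt_mean := by
    have h1 := h.lt_aMean
    have h2 : m.aMean = ((1 - m.p) * m.sigma ^ 2 + 2 * m.delta / m.p) / 2 := by
      unfold aMean; ring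
    rw [h2] at h1
    linarith

lemma polyP_eq (h : m.Admissible) (x z : ℝ) : m.polyP x z = (1 - m.p) * h.ode.P x (m.q * z) := by
  have hq := h.q_mul
  have hp := h.p_pos
  have h1 : m.q * m.delta = (1 - m.p) * (m.delta / m.p) * m.q ^ 2 := by
    calc m.q * m.delta = (m.q * (1 - m.p)) * (m.delta / m.p) * m.q := by rw [hq]; field_simp
      _ = _ := by ring
  simp only [polyP, ReducedODE.P, ode]
  linear_combination (-2 * z ^ 2) * h1 - 2 * (m.mu * x + 1) * z * hq

lemma polyQ_eq (h : m.Admissible) (x z : ℝ) : m.polyQ x z = h.ode.Q x (m.q * z) := by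
  have hq := h.q_mul
  have hp := h.p_pos
  have h1 : m.deltaHat = m.q * (m.delta / m.p) := by
    have : 1 + m.q = m.q / m.p := by
      have := h.one_sub_p_pos
      rw [q]; field_simp; ring
    rw [deltaHat, this]; ring
  rw [polyQ, h.polyP_eq, h1]
  simp only [ReducedODE.Q, ReducedODE.P, ode]
  linear_combination (-x * z * m.sigma ^ 2) * hq

lemma rhs_eq (h : m.Admissible) (x z : ℝ) : m.rhs x z = h.ode.F x (m.q * z) / m.q := by
  have hq := h.q_pos
  have hF : h.ode.F x (m.q * z) = m.p * h.ode.P x (m.q * z) / h.ode.Q x (m.q * z) := rfl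
  rw [rhs, h.polyP_eq, h.polyQ_eq, hF, eq_div_iff hq.ne']
  linear_combination h.ode.P x (m.q * z) / h.ode.Q x (m.q * z) * h.q_mul

lemma xP_eq (h : m.Admissible) : m.xP = h.ode.X := by
  simp only [xP, aMean, ReducedODE.X, ReducedODE.e, ode]
  congr 2
  ring

lemma polyP_eq_zero_iff (h : m.Admissible) {x z : ℝ} :
    m.polyP x z = 0 ↔ h.ode.P x (m.q * z) = 0 := by
  rw [h.polyP_eq, mul_eq_zero, or_iff_right h.one_sub_p_pos.ne']

lemma levelSection_zero (h : m.Admissible) {x : ℝ} (hx : 0 < x) :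
    m.levelSection x 0 = {h.ode.dn x / m.q, h.ode.up x / m.q} := by
  have hq := h.q_pos
  ext z
  simp only [levelSection, mem_ofPred_eq, zero_mul, mem_insert_iff, mem_singleton_iff]
  rw [h.polyP_eq_zero_iff, ReducedODE.P_eq_zero_iff hx.le, eq_div_iff hq.ne', eq_div_iff hq.ne',
    mul_comm]

lemma dn_div_le (h : m.Admissible) {x : ℝ} (hx : 0 < x) :
    h.ode.dn x / m.q ≤ h.ode.up x / m.q :=
  div_le_div_of_nonneg_right (ReducedODE.dn_lt_up hx.le).le h.q_pos.le

lemma Tu_eq (h : m.Admissible) {x : ℝ} (hx : 0 < x) : m.Tu x 0 = h.ode.up x / m.q := by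
  rw [Tu, h.levelSection_zero hx, csSup_pair, max_eq_right (h.dn_div_le hx)]

lemma Td_eq (h : m.Admissible) {x : ℝ} (hx : 0 < x) : m.Td x 0 = h.ode.dn x / m.q := by
  rw [Td, h.levelSection_zero hx, csInf_pair, min_eq_left (h.dn_div_le hx)]

lemma mem_levelDomain (h : m.Admissible) {x : ℝ} (hx : 0 < x) : x ∈ m.levelDomain 0 :=
  ⟨hx, by rw [h.levelSection_zero hx]; exact insert_nonempty _ _⟩

lemma inner_iff (h : m.Admissible) {x z : ℝ} (hx : 0 < x) :
    (x ∈ m.levelDomain 0 ∧ m.Td x 0 ≤ z ∧ z ≤ m.Tu x 0) ↔ 0 ≤ h.ode.P x (m.q * z) := by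
  rw [h.Tu_eq hx, h.Td_eq hx, ReducedODE.P_nonneg_iff hx.le, div_le_iff₀ h.q_pos,
    le_div_iff₀ h.q_pos, mul_comm z, and_iff_right (h.mem_levelDomain hx)]

lemma hasDerivAt_iff (h : m.Admissible) {g : ℝ → ℝ} {x : ℝ} :
    HasDerivAt g (m.rhs x (g x)) x ↔
      HasDerivAt (fun x => m.q * g x) (h.ode.F x (m.q * g x)) x := by
  have hq := h.q_pos.ne'
  rw [h.rhs_eq]
  constructor
  · intro h1
    exact (h1.const_mul m.q).congr_deriv (by field_simp)
  · intro h1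
    refine (h1.div_const m.q).congr_of_eventuallyEq (Eventually.of_forall fun y => ?_)
    simp only
    field_simp

lemma isInnerSolution_iff (h : m.Admissible) {D : Set ℝ} {g : ℝ → ℝ} :
    m.IsInnerSolution D g ↔ D.Nonempty ∧ h.ode.Inner D fun x => m.q * g x := by
  have hq := h.q_pos.ne'
  constructor
  · intro hg
    refine ⟨hg.nonempty, hg.interval, hg.pos, continuousOn_const.mul hg.continuousOn,
      fun x hx => (h.inner_iff (hg.pos hx)).1 (hg.inner x hx), fun x hx hne => ?_⟩
    obtain ⟨h1, h2⟩ := hg.ode x hx (by rwa [h.xP_eq])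
    exact ⟨by rwa [← h.polyQ_eq], h.hasDerivAt_iff.1 h2⟩
  · rintro ⟨hn, hg⟩
    refine ⟨⟨hn, hg.interval, hg.pos, ?_, fun x hx hne => ?_⟩,
      fun x hx => (h.inner_iff (hg.pos hx)).2 (hg.nonneg x hx)⟩
    · refine (hg.cont.div_const m.q).congr fun x _ => ?_
      simp only
      field_simp
    · obtain ⟨h1, h2⟩ := hg.ode x hx (by rwa [← h.xP_eq])
      exact ⟨by rwa [h.polyQ_eq], h.hasDerivAt_iff.2 h2⟩

lemma eq_singularPoint_iff (h : m.Admissible) {α : ℝ} (hα : 0 < α) :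
    (α, m.Tu α 0) = m.singularPoint ↔ α = h.ode.X ∧ h.ode.up α = h.ode.X := by
  rw [singularPoint, Prod.mk.injEq, zP, h.Tu_eq hα, h.xP_eq, div_left_inj' h.q_pos.ne']

lemma mul_div_q (h : m.Admissible) (f : ℝ → ℝ) : (fun x => m.q * (f x / m.q)) = f := by
  have hq := h.q_pos.ne'
  ext x
  field_simp

/-- The arcs from regular points are maximal inner solutions. -/
lemma isMaximal_of_arc (h : m.Admissible) {α β : ℝ} {f : ℝ → ℝ} (hf : h.ode.Arc α β f)
    (hne : (α, m.Tu α 0) ≠ m.singularPoint) :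
    m.IsMaximalInnerSolution (Icc α β) fun x => f x / m.q := by
  have hq := h.q_pos.ne'
  refine ⟨h.isInnerSolution_iff.2 ⟨nonempty_Icc.2 hf.lt.le, ?_⟩, fun D' g' hg' hD hgg => ?_⟩
  · rw [h.mul_div_q]; exact hf.inner
  · have hin := (h.isInnerSolution_iff.1 hg').2
    have hα := left_mem_Icc.2 hf.lt.le
    have h0 : m.q * g' α = f α := by
      rw [hgg hα]; simp only; field_simp
    refine subset_antisymm (fun x hx => ?_) hD
    have hαx := ReducedODE.Inner.left hin (hD hα) (h0.trans hf.start)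
      (fun h' => hne ((h.eq_singularPoint_iff hf.pos).2 h')) hx
    exact ⟨hαx, (ReducedODE.Inner.right hf hin (hD hα) h0 hx hαx).1⟩

/-- Maximal inner solutions from regular points are arcs. -/
lemma arc_of_isMaximal (h : m.Admissible) {α : ℝ} {D : Set ℝ} {g : ℝ → ℝ}
    (hα0 : 0 < α) (hne : (α, m.Tu α 0) ≠ m.singularPoint) (hg : m.IsMaximalInnerSolution D g)
    (hα : α ∈ D) (hgα : g α = m.Tu α 0) :
    ∃ β, D = Icc α β ∧ h.ode.Arc α β fun x => m.q * g x := by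
  have hq := h.q_pos.ne'
  obtain ⟨β, f, hf⟩ := ReducedODE.exists_arc (c := h.ode) hα0
  have hin := (h.isInnerSolution_iff.1 hg.toIsInnerSolution).2
  have h0 : m.q * g α = h.ode.up α := by rw [hgα, h.Tu_eq hα0]; field_simp
  have key : ∀ x ∈ D, x ∈ Icc α β ∧ m.q * g x = f x := fun x hx => by
    have h1 := ReducedODE.Inner.left hin hα h0
      (fun h' => hne ((h.eq_singularPoint_iff hα0).2 h')) hx
    obtain ⟨h2, h3⟩ := ReducedODE.Inner.right hf hin hα (h0.trans hf.start.symm) hx h1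
    exact ⟨⟨h1, h2⟩, h3⟩
  -- Uniqueness places the given solution inside the arc; since the arc is an inner solution
  -- extending it, maximality makes the domains equal.
  have hD := hg.maximal (Icc α β) (fun x => f x / m.q)
    (h.isMaximal_of_arc hf hne).toIsInnerSolution (fun x hx => (key x hx).1)
    fun x hx => by simp only; rw [← (key x hx).2]; field_simp
  exact ⟨β, hD.symm, hf.congr fun x hx => (key x (hD ▸ hx)).2⟩

lemma rightEnd_Icc {α β : ℝ} (hαβ : α ≤ β) : rightEnd (Icc α β) = (β : EReal) := by
  refine IsGreatest.csSup_eq ⟨⟨β, right_mem_Icc.2 hαβ, rfl⟩, ?_⟩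
  rintro _ ⟨x, hx, rfl⟩
  exact EReal.coe_le_coe_iff.2 hx.2

lemma exists_arcs (h : m.Admissible) :
    ∃ (β : ℝ → ℝ) (f : ℝ → ℝ → ℝ), ∀ α, 0 < α → h.ode.Arc α (β α) (f α) := by
  have : ∀ α, ∃ β, ∃ f : ℝ → ℝ, 0 < α → h.ode.Arc α β f := fun α => by
    by_cases hα : 0 < α
    · obtain ⟨β, f, hf⟩ := ReducedODE.exists_arc (c := h.ode) hα
      exact ⟨β, f, fun _ => hf⟩
    · exact ⟨0, 0, fun h' => absurd h' hα⟩
  choose β f hf using this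
  exact ⟨β, f, hf⟩

theorem exists_solutionFamily (h : m.Admissible) :
    ∃ (D : ℝ → Set ℝ) (g : ℝ → ℝ → ℝ), m.IsSolutionFamily D g := by
  have hq := h.q_pos.ne'
  obtain ⟨β, f, hf⟩ := h.exists_arcs
  refine ⟨fun α => Icc α (β α), fun α x => f α x / m.q, fun α hα hne =>
    ⟨h.isMaximal_of_arc (hf α hα) hne, left_mem_Icc.2 (hf α hα).lt.le, ?_⟩, fun hs => ?_⟩
  · rw [(hf α hα).start, h.Tu_eq hα]
  · have hX := ReducedODE.X_pos (c := h.ode)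
    rw [h.xP_eq] at hs
    have hup := ((h.eq_singularPoint_iff hX).1 hs).2
    obtain ⟨b, f₀, h1, h2, h3⟩ := ReducedODE.exists_right_limit hX
      fun α hα => hf α (hX.trans hα)
    obtain ⟨h4, h5⟩ := (hf _ hX).unique h1
    rw [h4] at h1 h2 h3
    rw [h.xP_eq, zP, h.xP_eq, (hf _ hX).start, hup]
    refine ⟨rfl, β h.ode.X, ?_, ?_, fun x hx hlt => ?_⟩
    · refine ((continuous_coe_real_ereal.tendsto _).comp h2).congr' ?_
      filter_upwards [self_mem_nhdsWithin] with α hα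
      exact (rightEnd_Icc (hf α (hX.trans hα)).lt.le).symm
    · ext x
      simp
    · have := (h3 x ⟨hlt, hx.2⟩).div_const m.q
      rwa [h5 hx] at this

/-- In every family of solutions all members are arcs. -/
theorem exists_arc_of_family (h : m.Admissible) {D : ℝ → Set ℝ} {g : ℝ → ℝ → ℝ}
    (hfam : m.IsSolutionFamily D g) {α : ℝ} (hα : 0 < α) :
    ∃ β, D α = Icc α β ∧ h.ode.Arc α β fun x => m.q * g α x := by
  have hq := h.q_pos.ne'
  by_cases hs : (α, m.Tu α 0) = m.singularPoint
  · have hX := ReducedODE.X_pos (c := h.ode)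
    obtain ⟨rfl, hup⟩ := (h.eq_singularPoint_iff hα).1 hs
    have harc : ∀ α, ∃ β, h.ode.X < α → D α = Icc α β ∧ h.ode.Arc α β fun x => m.q * g α x :=
      fun α => by
        by_cases hα : h.ode.X < α
        · have hα0 := hX.trans hα
          have hne : (α, m.Tu α 0) ≠ m.singularPoint := fun h' =>
            hα.ne' ((h.eq_singularPoint_iff hα0).1 h').1
          obtain ⟨h1, h2, h3⟩ := hfam.regular α hα0 hne
          obtain ⟨β, hβ⟩ := h.arc_of_isMaximal hα0 hne h1 h2 h3
          exact ⟨β, fun _ => hβ⟩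
        · exact ⟨0, fun h' => absurd h' hα⟩
    choose β hβ using harc
    -- The member at X is given only through limits. Uniqueness of limits identifies its end-point
    -- and values with those of the limiting arc.
    obtain ⟨b, f, h1, h2, h3⟩ := ReducedODE.exists_right_limit hX fun α hα => (hβ α hα).2
    have hsing := hfam.singular
    rw [h.xP_eq] at hsing
    obtain ⟨s1, b', s2, s3, s4⟩ := hsing hs
    have hb' : b' = (b : EReal) := by
      refine tendsto_nhds_unique s2 (((continuous_coe_real_ereal.tendsto _).comp h2).congr' ?_)
      filter_upwards [self_mem_nhdsWithin] with α hα
      rw [(hβ α hα).1]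
      exact (rightEnd_Icc (hβ α hα).2.lt.le).symm
    have hD : D h.ode.X = Icc h.ode.X b := by
      rw [s3, hb']
      ext x
      simp
    refine ⟨b, hD, h1.congr fun x hx => ?_⟩
    rcases hx.1.lt_or_eq with hlt | heq
    · exact tendsto_nhds_unique ((s4 x (hD ▸ hx) hlt).const_mul m.q) (h3 x ⟨hlt, hx.2⟩)
    · rw [← heq, s1, h1.start, hup, zP, h.xP_eq]
      field_simp
  · obtain ⟨h1, h2, h3⟩ := hfam.regular α hα hs
    exact h.arc_of_isMaximal hα hs h1 h2 h3

/-- The equation determines the derivative except at β and possibly at X, a null set. -/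
lemma eqOn_integrand (h : m.Admissible) {α β : ℝ} {g : ℝ → ℝ}
    (hg : h.ode.Arc α β fun x => m.q * g x) :
    ∀ᵐ x, x ∈ uIoc α β → h.ode.F x (m.q * g x) / x / m.q = deriv g x / x := by
  filter_upwards [Measure.ae_ne volume β, Measure.ae_ne volume h.ode.X] with x h1 h2 hx
  rw [uIoc_of_le hg.lt.le] at hx
  have h3 := h.hasDerivAt_iff.2 (hg.ode x ⟨hx.1, lt_of_le_of_ne hx.2 h1⟩ h2)
  rw [h3.deriv, h.rhs_eq]
  ring

lemma intervalIntegrable_deriv (h : m.Admissible) {α β : ℝ} {g : ℝ → ℝ}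
    (hg : h.ode.Arc α β fun x => m.q * g x) :
    IntervalIntegrable (fun x => deriv g x / x) volume α β :=
  (hg.intervalIntegrable.div_const m.q).congr_ae
    ((ae_restrict_iff' measurableSet_uIoc).2 (h.eqOn_integrand hg))

lemma integral_deriv (h : m.Admissible) {α β : ℝ} {g : ℝ → ℝ}
    (hg : h.ode.Arc α β fun x => m.q * g x) :
    ∫ x in α..β, deriv g x / x = (∫ x in α..β, h.ode.F x (m.q * g x) / x) / m.q := by
  rw [← intervalIntegral.integral_div]
  exact (intervalIntegral.integral_congr_ae (h.eqOn_integrand hg)).symm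

/-- As b ≠ d, `mu_lt_b` and `b_lt_mu` show that the position of μ relative to b decides which of b
and d is larger. -/
lemma merton_lt_one_iff (h : m.Admissible) : m.merton < 1 ↔ h.ode.d < h.ode.b := by
  change m.mu / h.ode.b < 1 ↔ _
  rw [div_lt_one h.ode.b_pos]
  change h.ode.mu < h.ode.b ↔ _
  refine ⟨fun h1 => ?_, ReducedODE.mu_lt_b⟩
  by_contra! h2
  exact absurd (ReducedODE.b_lt_mu (lt_of_le_of_ne h2 ReducedODE.b_ne_d)) h1.not_gt

lemma one_lt_merton_iff (h : m.Admissible) : 1 < m.merton ↔ h.ode.b < h.ode.d := by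
  change 1 < m.mu / h.ode.b ↔ _
  rw [one_lt_div h.ode.b_pos]
  change h.ode.b < h.ode.mu ↔ _
  refine ⟨fun h1 => ?_, ReducedODE.b_lt_mu⟩
  by_contra! h2
  exact absurd (ReducedODE.mu_lt_b (lt_of_le_of_ne h2 ReducedODE.b_ne_d.symm)) h1.not_gt

lemma singularPoint_mem_iff (h : m.Admissible) {D : Set ℝ} {g : ℝ → ℝ} :
    m.singularPoint ∈ graphOver D g ↔ h.ode.X ∈ D ∧ m.q * g h.ode.X = h.ode.X := by
  have hq := h.q_pos.ne'
  simp only [graphOver, singularPoint, mem_image, Prod.mk.injEq, zP, h.xP_eq]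
  constructor
  · rintro ⟨x, hx, rfl, h1⟩
    exact ⟨hx, by rw [h1]; field_simp⟩
  · rintro ⟨hx, h1⟩
    exact ⟨_, hx, rfl, by rw [eq_div_iff hq, mul_comm, h1]⟩

lemma quad_eq (h : m.Admissible) (k s : ℝ) :
    m.coeffA k * s ^ 2 - m.coeffB k * s + m.coeffC k = (1 - m.p) / m.q *
      (h.ode.lvA (m.q * k) * (m.q * s) ^ 2 - h.ode.lvB (m.q * k) * (m.q * s) +
        h.ode.lvC (m.q * k)) := by
  have hp := h.p_pos
  have h1 := h.one_sub_p_pos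
  simp only [coeffA, coeffB, coeffC, ReducedODE.lvA, ReducedODE.lvB, ReducedODE.lvC, ode, q]
  field_simp
  ring

lemma slopes_eq (h : m.Admissible) {k : ℝ} (hk : 0 ≤ k) (hD : 0 ≤ h.ode.lvDisc (m.q * k)) :
    m.slopeU k = h.ode.lvUp (m.q * k) / m.q ∧ m.slopeD k = h.ode.lvDn (m.q * k) / m.q := by
  have hq := h.q_pos
  have hqk : 0 ≤ m.q * k := by positivity
  have hA := (ReducedODE.lvA_pos (c := h.ode) hqk).ne'
  have hset : {s | m.coeffA k * s ^ 2 - m.coeffB k * s + m.coeffC k = 0} =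
      {h.ode.lvDn (m.q * k) / m.q, h.ode.lvUp (m.q * k) / m.q} := by
    ext s
    have h2 : (1 - m.p) / m.q ≠ 0 := (div_pos h.one_sub_p_pos hq).ne'
    simp only [mem_ofPred_eq, mem_insert_iff, mem_singleton_iff]
    rw [h.quad_eq, ReducedODE.quad_factor hqk hD, mul_eq_zero, or_iff_right h2, mul_eq_zero,
      or_iff_right hA, mul_eq_zero, sub_eq_zero, sub_eq_zero, eq_div_iff hq.ne', eq_div_iff hq.ne',
      mul_comm s, or_comm]
  have hle : h.ode.lvDn (m.q * k) / m.q ≤ h.ode.lvUp (m.q * k) / m.q :=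
    div_le_div_of_nonneg_right (ReducedODE.lvDn_le_lvUp hqk) hq.le
  rw [slopeU, slopeD, hset, csSup_pair, csInf_pair, max_eq_right hle, min_eq_left hle]
  exact ⟨rfl, rfl⟩

lemma q_mul_constK (h : m.Admissible) : m.q * m.constK = h.ode.kMax := by
  have h1 : h.ode.e = m.aMean - m.mu := by
    simp only [ReducedODE.e, aMean, ode]; ring
  rw [constK, ReducedODE.kMax, h1, h.gMean_eq, mul_div_assoc', ← mul_assoc, h.q_mul]
  rfl

/-- Restricted to the open interval because the derivatives need the explicit slope formulas on a
neighbourhood. The factor q from rescaling k cancels the 1 / q from rescaling the slopes. -/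
lemma integrandC_eq (h : m.Admissible) :
    EqOn (fun k => h.ode.lvIntegrand (m.q * k)) m.integrandC (Ioo 0 m.constK) := by
  intro k hk
  have hq := h.q_pos
  have hmem : ∀ κ ∈ Ioo 0 m.constK, m.slopeU κ = h.ode.lvUp (m.q * κ) / m.q ∧
      m.slopeD κ = h.ode.lvDn (m.q * κ) / m.q := fun κ hκ =>
    h.slopes_eq hκ.1.le (ReducedODE.lv_mem (mul_nonneg hq.le hκ.1.le)
      (by rw [← h.q_mul_constK]; exact mul_lt_mul_of_pos_left hκ.2 hq)).1.le
  have hnhds : Ioo 0 m.constK ∈ 𝓝 k := Ioo_mem_nhds hk.1 hk.2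
  have hdU : deriv m.slopeU k = deriv h.ode.lvUp (m.q * k) := by
    have h1 : m.slopeU =ᶠ[𝓝 k] fun κ => h.ode.lvUp (m.q * κ) / m.q := by
      filter_upwards [hnhds] with κ hκ using (hmem κ hκ).1
    rw [h1.deriv_eq, deriv_div_const, deriv_comp_mul_left m.q h.ode.lvUp k, smul_eq_mul,
      mul_div_cancel_left₀ _ hq.ne']
  have hdD : deriv m.slopeD k = deriv h.ode.lvDn (m.q * k) := by
    have h1 : m.slopeD =ᶠ[𝓝 k] fun κ => h.ode.lvDn (m.q * κ) / m.q := by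
      filter_upwards [hnhds] with κ hκ using (hmem κ hκ).2
    rw [h1.deriv_eq, deriv_div_const, deriv_comp_mul_left m.q h.ode.lvDn k, smul_eq_mul,
      mul_div_cancel_left₀ _ hq.ne']
  have hsub : ∀ l, k - l / m.q = (m.q * k - l) / m.q := fun l => by field_simp
  change h.ode.lvIntegrand (m.q * k) = _
  rw [integrandC, hdU, hdD, (hmem k hk).1, (hmem k hk).2, hsub, hsub, div_div_eq_mul_div,
    div_div_eq_mul_div, ReducedODE.lvIntegrand]
  ring

lemma constK_nonneg (h : m.Admissible) : 0 ≤ m.constK := by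
  have h1 := (ReducedODE.kMax_spec (c := h.ode)).1
  rw [← h.q_mul_constK] at h1
  exact nonneg_of_mul_nonneg_right h1 h.q_pos

theorem integrandC_spec (h : m.Admissible) : IntervalIntegrable m.integrandC volume 0 m.constK ∧
    m.constC = (∫ s in h.ode.sDn..h.ode.sUp, h.ode.p * h.ode.Y s / h.ode.E s) / m.q := by
  have hq := h.q_pos
  obtain ⟨h1, h2⟩ := ReducedODE.integral_lvIntegrand (c := h.ode)
  constructor
  · have h3 := h1.comp_mul_left (c := m.q)
    rw [← h.q_mul_constK, zero_div, mul_div_cancel_left₀ _ hq.ne'] at h3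
    refine h3.congr_uIoo ?_
    rw [uIoo_of_le h.constK_nonneg]
    exact h.integrandC_eq
  · rw [constC, ← intervalIntegral.integral_congr_Ioo_of_le h.constK_nonneg h.integrandC_eq,
      intervalIntegral.integral_comp_mul_left _ hq.ne', mul_zero, h.q_mul_constK, h2, smul_eq_mul,
      inv_mul_eq_div]

end Admissible

end Market
end

theorem proposition6p9 (m : Market) (hmu : 0 < m.mu) (hsigma : 0 < m.sigma) (hdelta : 0 < m.delta)
    (hp0 : 0 < m.p) (hp1 : m.p < 1) (hG : m.gMean ≤ m.mu) (hA : m.mu < m.aMean) :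
    -- the constant `C` is a convergent integral
    IntervalIntegrable m.integrandC volume 0 m.constK ∧
    -- the solutions exist
    (∃ (D : ℝ → Set ℝ) (g : ℝ → ℝ → ℝ), m.IsSolutionFamily D g) ∧
    -- and, however they are chosen, they have the following properties
    ∀ (D : ℝ → Set ℝ) (g : ℝ → ℝ → ℝ), m.IsSolutionFamily D g →
      -- the right end-point of the domain is finite, and the curve `P = 0` is hit there
      (∀ α : ℝ, 0 < α → Market.rightEnd (D α) < ⊤ ∧
        ∃ β : ℝ, (β : EReal) = Market.rightEnd (D α) ∧ α < β ∧ D α = Icc α β ∧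
          (β, g α β) ∈ m.curveT) ∧
      -- passage through the singular point
      (m.merton < 1 → ∀ α : ℝ, 0 < α → m.singularPoint ∉ Market.graphOver (D α) (g α)) ∧
      (1 < m.merton → ∀ α : ℝ, 0 < α →
        (m.singularPoint ∈ Market.graphOver (D α) (g α) ↔ α ≤ m.xP)) ∧
      -- the integral of `g α ' (x) / x` over `[α, β α]`
      (∀ α : ℝ, 0 < α → IntervalIntegrable (fun x => deriv (g α) x / x) volume
        α (Market.rightEnd (D α)).toReal) ∧
      ContinuousOn
        (fun α : ℝ => ∫ x in α..(Market.rightEnd (D α)).toReal, deriv (g α) x / x) (Ioi 0) ∧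
      Tendsto (fun α : ℝ => ∫ x in α..(Market.rightEnd (D α)).toReal, deriv (g α) x / x)
        (𝓝[>] 0) atTop ∧
      Tendsto (fun α : ℝ => ∫ x in α..(Market.rightEnd (D α)).toReal, deriv (g α) x / x)
        atTop (𝓝 m.constC) := by
  have h : m.Admissible := ⟨hmu, hsigma, hdelta, hp0, hp1, hG, hA⟩
  have hq := h.q_pos
  obtain ⟨hint, hC⟩ := h.integrandC_spec
  refine ⟨hint, h.exists_solutionFamily, fun D g hfam => ?_⟩
  have harc : ∀ α, ∃ β, 0 < α → D α = Icc α β ∧ h.ode.Arc α β fun x => m.q * g α x := fun α => by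
    by_cases hα : 0 < α
    · obtain ⟨β, hβ⟩ := h.exists_arc_of_family hfam hα
      exact ⟨β, fun _ => hβ⟩
    · exact ⟨0, fun h' => absurd h' hα⟩
  choose β hβ using harc
  have ha : ∀ α, 0 < α → h.ode.Arc α (β α) fun x => m.q * g α x := fun α hα => (hβ α hα).2
  have hend : ∀ α, 0 < α → Market.rightEnd (D α) = (β α : EReal) := fun α hα => by
    rw [(hβ α hα).1, Market.Admissible.rightEnd_Icc (ha α hα).lt.le]
  have hG' : ∀ α, 0 < α → (∫ x in α..β α, h.ode.F x (m.q * g α x) / x) / m.q =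
      ∫ x in α..(Market.rightEnd (D α)).toReal, deriv (g α) x / x := fun α hα => by
    rw [hend α hα, EReal.toReal_coe, h.integral_deriv (ha α hα)]
  refine ⟨fun α hα => ?_, fun hm α hα hmem => ?_, fun hm α hα => ?_, fun α hα => ?_, ?_, ?_, ?_⟩
  · rw [hend α hα]
    refine ⟨EReal.coe_lt_top _, β α, rfl, (ha α hα).lt, (hβ α hα).1, hα.trans (ha α hα).lt, ?_⟩
    rw [h.polyP_eq_zero_iff]
    exact (ha α hα).terminal ▸ ReducedODE.P_dn (hα.trans (ha α hα).lt).le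
  · rw [h.singularPoint_mem_iff, (hβ α hα).1] at hmem
    exact (ha α hα).ne_X (h.merton_lt_one_iff.1 hm) hmem.1 ⟨rfl, hmem.2⟩
  · rw [h.singularPoint_mem_iff, (hβ α hα).1, h.xP_eq]
    refine ⟨fun hmem => hmem.1.1, fun hle => ?_⟩
    have hX : h.ode.X ∈ Icc α (β α) := ⟨hle, (ha α hα).X_lt.le⟩
    exact ⟨hX, ReducedODE.eq_X_of_region (h.one_lt_merton_iff.1 hm) ((ha α hα).region _ hX)⟩
  · rw [hend α hα, EReal.toReal_coe]
    exact h.intervalIntegrable_deriv (ha α hα)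
  · exact ((ReducedODE.continuousOn_integral ha).div_const m.q).congr fun α hα => (hG' α hα).symm
  · refine ((ReducedODE.tendsto_integral_zero ha).atTop_div_const hq).congr' ?_
    filter_upwards [self_mem_nhdsWithin] with α hα using hG' α hα
  · rw [hC]
    refine ((ReducedODE.tendsto_integral_atTop ha).div_const m.q).congr' ?_
    filter_upwards [eventually_gt_atTop 0] with α hα using hG' α hα
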